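/- Let $L,T>0$, $a<0$ and $b,d>0$, let $r\ge 2$ and $0\le\mu\le r-2$ be integers, and let $(\eta,u)$ be a classical solution on $[-L,L]\times[0,T]$ of the initial-boundary value problem $$\eta_t+u_x+(\eta u)_x+a\,u_{xxx}-b\,\eta_{xxt}=0,\qquad u_t+\eta_x+u u_x-d\,u_{xxt}=0\qquad\text{in }(-L,L)\times(0,T),$$ $$\eta(x,0)=\eta_0(x),\quad u(x,0)=u_0(x),\qquad u(\pm L,t)=u_{xx}(\pm L,t)=0,$$ with $\eta\in C([0,T];C^r[-L,L])$, $u\in C([0,T];C^{r+1}[-L,L])$ and $\eta_t,u_t\in C([0,T];C^2[-L,L])$. For an integer $N\ge1$ let $h=2L/N$, $x_i=-L+ih$, let $$S_h=\{\phi\in C^\mu[-L,L]:\ \phi|_{[x_i,x_{i+1}]}\text{ is a polynomial of degree at most }r-1,\ 0\le i<N\},\qquad S_h^0=\{\phi\in S_h:\phi(\pm L)=0\},$$ and write $(\cdot,\cdot)$, $\|\cdot\|$ and $\|\cdot\|_1$ for the inner product of $L^2(-L,L)$ and the norms of $L^2(-L,L)$ and $H^1(-L,L)$, and $A_q(v,w)=(v,w)+q(v_x,w_x)$.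 For $v\in S_h^0$ let $\partial_h^2v\in S_h^0$ be the discrete Laplacian, $(\partial_h^2v,\phi)=-(v_x,\phi_x)$ for all $\phi\in S_h^0$. A semidiscrete solution on $[0,T]$ is a pair $\tilde\eta:[0,T]\to S_h$, $\tilde u:[0,T]\to S_h^0$, continuous on $[0,T]$ and differentiable on $(0,T]$, such that for $0<t\le T$ $$A_b(\tilde\eta_t,\chi)+([\tilde u+\tilde\eta\tilde u+a\,\partial_h^2\tilde u]_x,\chi)=0\quad\forall\chi\in S_h,\qquad A_d(\tilde u_t,\phi)+(\tilde\eta_x+\tilde u\tilde u_x,\phi)=0\quad\forall\phi\in S_h^0,$$ and whose initial values are the elliptic projections of $\eta_0$ and $u_0$: $A_b(\tilde\eta(0),\chi)=A_b(\eta_0,\chi)$ for all $\chi\in S_h$ and $A_d(\tilde u(0),\phi)=A_d(u_0,\phi)$ for all $\phi\in S_h^0$. Then for every $N\ge 1$ there is at most one semidiscrete solution on $[0,T]$, and for all sufficiently small $h$ there is one. There is a constant $C$, independent of $h$ and $t$, such that for every $h$ for which the semidiscrete solution on $[0,T]$ exists, and for all $t\in[0,T]$, $$\|\tilde\eta-\eta\|+\|\tilde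 u-u\|\le Ch^r,\qquad \|\tilde\eta-\eta\|_1+\|\tilde u-u\|_1\le Ch^{r-1}.$$ In particular $\|\tilde\eta-\eta\|_1+\|\tilde u-u\|_1\to0$ as $h\to0$, uniformly in $t\in[0,T]$. -/

import Mathlib

open Set Filter Topology

namespace RegNwogu

noncomputable section

/-- The spatial domain `[-L, L]`. -/
def dom (L : ℝ) : Set ℝ := Icc (-L) L

/-- `∂_x^j v`, one-sided at `±L`, for a function `v` on `[-L, L]`. -/
def dx (L : ℝ) (j : ℕ) (v : ℝ → ℝ) (x : ℝ) : ℝ := iteratedDerivWithin j v (dom L) x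

/-- `∂_t v` for `v = v(t, x)`, `t ∈ [0, T]`, one-sided at `0` and `T`. -/
def dt (T : ℝ) (v : ℝ → ℝ → ℝ) (t x : ℝ) : ℝ := derivWithin (fun s => v s x) (Icc 0 T) t

/-- `v ∈ C([0, T]; C^k[-L, L])`: every `v(t, ·)` is of class `C^k` on `[-L, L]`, and the derivatives
`∂_x^j v`, `j ≤ k`, are jointly continuous on the compact set `[0, T] × [-L, L]`; the latter
is the same as continuity of `t ↦ v(t, ·)` in the norm of `C^k[-L, L]`. -/
def ContinuousInto (L T : ℝ) (k : ℕ) (v : ℝ → ℝ → ℝ) : Prop :=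
  (∀ t ∈ Icc 0 T, ContDiffOn ℝ k (v t) (dom L)) ∧
  ∀ j ≤ k, ContinuousOn (fun p : ℝ × ℝ => dx L j (v p.1) p.2) (Icc 0 T ×ˢ dom L)

/-- `v = v(t, x)` is differentiable with respect to `t` on `[0, T]`, at every point of `[-L, L]`. -/
def TimeDifferentiable (L T : ℝ) (v : ℝ → ℝ → ℝ) : Prop :=
  ∀ x ∈ dom L, DifferentiableOn ℝ (fun s => v s x) (Icc 0 T)

/-- `(η, u)` is a classical solution on `[-L, L] × [0, T]`, with spatial regularity
`η ∈ C([0, T]; C^r)` and `u ∈ C([0, T]; C^(r+1))`, of the initial-boundary value problem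
`η_t + u_x + (η u)_x + a u_xxx - b η_xxt = 0`, `u_t + η_x + u u_x - d u_xxt = 0`,
`η(·, 0) = η₀`, `u(·, 0) = u₀`, `u = u_xx = 0` at `x = ±L`.
The time derivatives belong to `C([0, T]; C^2)`, so that the two equations make sense pointwise.
(The condition `η_x = 0` at `x = ±L` follows from the second equation.) -/
structure IsClassicalSolution (L T a b d : ℝ) (r : ℕ) (η₀ u₀ : ℝ → ℝ) (η u : ℝ → ℝ → ℝ) :
    Prop where
  regular_η : ContinuousInto L T r η
  regular_u : ContinuousInto L T (r + 1) u
  differentiable_η : TimeDifferentiable L T η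
  differentiable_u : TimeDifferentiable L T u
  regular_η_t : ContinuousInto L T 2 (dt T η)
  regular_u_t : ContinuousInto L T 2 (dt T u)
  mass : ∀ t ∈ Ioo 0 T, ∀ x ∈ Ioo (-L) L,
    dt T η t x + dx L 1 (u t) x + dx L 1 (fun y => η t y * u t y) x
      + (a * dx L 3 (u t) x - b * dx L 2 (dt T η t) x) = 0
  momentum : ∀ t ∈ Ioo 0 T, ∀ x ∈ Ioo (-L) L,
    dt T u t x + dx L 1 (η t) x + u t x * dx L 1 (u t) x - d * dx L 2 (dt T u t) x = 0
  init_η : ∀ x ∈ dom L, η 0 x = η₀ x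
  init_u : ∀ x ∈ dom L, u 0 x = u₀ x
  boundary : ∀ t ∈ Icc 0 T, u t (-L) = 0 ∧ u t L = 0
  boundary_xx : ∀ t ∈ Icc 0 T, dx L 2 (u t) (-L) = 0 ∧ dx L 2 (u t) L = 0

/-- The inner product `(v, w)` of `L²(-L, L)`. -/
def ip (L : ℝ) (v w : ℝ → ℝ) : ℝ := ∫ x in (-L)..L, v x * w x

/-- The norm of `L²(-L, L)`. -/
def normL2 (L : ℝ) (v : ℝ → ℝ) : ℝ := √(ip L v v)

/-- The norm of `H¹(-L, L)`. For a function that is absolutely continuous on `[-L, L]`, such as a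
continuous and piecewise continuously differentiable one, the derivative `deriv v`, which exists
almost everywhere, is the weak derivative. -/
def normH1 (L : ℝ) (v : ℝ → ℝ) : ℝ := √(ip L v v + ip L (deriv v) (deriv v))

/-- The bilinear form `A_q(v, w) = (v, w) + q (v_x, w_x)` on `H¹(-L, L)`. -/
def bilin (L q : ℝ) (v w : ℝ → ℝ) : ℝ := ip L v w + q * ip L (deriv v) (deriv w)

/-- The grid size `h = 2L/N`. -/
def meshSize (L : ℝ) (N : ℕ) : ℝ := 2 * L / N

/-- The grid points `x_i = -L + i h`, `0 ≤ i ≤ N`. -/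
def node (L : ℝ) (N i : ℕ) : ℝ := -L + i * meshSize L N

/-- The finite element space `S_h(μ, r)`: functions in `C^μ[-L, L]` which on every cell
`[x_i, x_{i+1}]` are polynomials of degree at most `r - 1`. Values outside `[-L, L]` play
no role. -/
def femSpace (L : ℝ) (N μ r : ℕ) : Set (ℝ → ℝ) :=
  {φ | ContDiffOn ℝ μ φ (dom L) ∧
    ∀ i < N, ∃ p : Polynomial ℝ, p.natDegree ≤ r - 1 ∧
      ∀ x ∈ Icc (node L N i) (node L N (i + 1)), φ x = p.eval x}

/-- The finite element space `S_h^0(μ, r)`: elements of `S_h(μ, r)` vanishing at `±L`. -/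
def femSpaceZero (L : ℝ) (N μ r : ℕ) : Set (ℝ → ℝ) :=
  {φ | φ ∈ femSpace L N μ r ∧ φ (-L) = 0 ∧ φ L = 0}

/-- `w` is the elliptic projection of `v` onto the space `V` with respect to `A_q`. -/
def IsEllipticProjection (L q : ℝ) (V : Set (ℝ → ℝ)) (v w : ℝ → ℝ) : Prop :=
  w ∈ V ∧ ∀ χ ∈ V, bilin L q w χ = bilin L q v χ

/-- `z = ∂_h² v` is the discrete Laplacian of `v` in the space `V = S_h^0`:
`z ∈ V` and `(z, φ) = -(v_x, φ_x)` for all `φ ∈ V`. -/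
def IsDiscreteLaplacian (L : ℝ) (V : Set (ℝ → ℝ)) (v z : ℝ → ℝ) : Prop :=
  z ∈ V ∧ ∀ φ ∈ V, ip L z φ = -ip L (deriv v) (deriv φ)

/-- `(η', u')` is a solution on `[0, T]` of the modified Galerkin semidiscretization on the uniform
grid with `N` cells: `η' : [0, T] → S_h` and `u' : [0, T] → S_h^0` are continuous on `[0, T]` and
differentiable for `0 < t ≤ T` (for maps into a finite-dimensional space of functions this may be
tested pointwise in `x`), they start from the elliptic projections of `η₀` and `u₀`, and for
`0 < t ≤ T`
`A_b(η'_t, χ) + ([u' + η' u' + a ∂_h² u']_x, χ) = 0` for all `χ ∈ S_h`,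
`A_d(u'_t, φ) + (η'_x + u' u'_x, φ) = 0` for all `φ ∈ S_h^0`. -/
structure IsSemidiscreteSolution (L T a b d : ℝ) (N μ r : ℕ) (η₀ u₀ : ℝ → ℝ)
    (η' u' : ℝ → ℝ → ℝ) : Prop where
  mem_η : ∀ t ∈ Icc 0 T, η' t ∈ femSpace L N μ r
  mem_u : ∀ t ∈ Icc 0 T, u' t ∈ femSpaceZero L N μ r
  continuous_η : ∀ x ∈ dom L, ContinuousOn (fun t => η' t x) (Icc 0 T)
  continuous_u : ∀ x ∈ dom L, ContinuousOn (fun t => u' t x) (Icc 0 T)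
  differentiable_η : ∀ x ∈ dom L, ∀ t ∈ Ioc 0 T,
    DifferentiableWithinAt ℝ (fun s => η' s x) (Icc 0 T) t
  differentiable_u : ∀ x ∈ dom L, ∀ t ∈ Ioc 0 T,
    DifferentiableWithinAt ℝ (fun s => u' s x) (Icc 0 T) t
  init_η : IsEllipticProjection L b (femSpace L N μ r) η₀ (η' 0)
  init_u : IsEllipticProjection L d (femSpaceZero L N μ r) u₀ (u' 0)
  mass : ∀ t ∈ Ioc 0 T, ∃ z, IsDiscreteLaplacian L (femSpaceZero L N μ r) (u' t) z ∧
    ∀ χ ∈ femSpace L N μ r,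
      bilin L b (dt T η' t) χ
        + ip L (deriv fun x => u' t x + η' t x * u' t x + a * z x) χ = 0
  momentum : ∀ t ∈ Ioc 0 T, ∀ φ ∈ femSpaceZero L N μ r,
    bilin L d (dt T u' t) φ
      + ip L (fun x => deriv (η' t) x + u' t x * deriv (u' t) x) φ = 0

end

end RegNwogu

namespace RegNwogu

noncomputable section

open MeasureTheory
open scoped NNReal ENNReal

/-! Let `R` and `R'` be the elliptic projections of `η(t)` and `u(t)`, and put `θ = R - η̃`, `ξ = R'
- ũ`. The projection errors have the optimal orders, `h^r` in `L²` and `h^(r-1)` in `H¹`, so the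
point is to bound `θ` and `ξ`, which vanish at `t = 0`. After integration by parts they satisfy
`A_b(θ_t, χ) = (F, χ_x)` and `A_d(ξ_t, φ) = (G, φ_x)`, where `F` and `G` are differences of fluxes.
The obstacle is the dispersive part `u_xx - ∂_h² ũ` of `F`: in `L²` it is only of size `h^(r-1) +
h⁻¹(‖ξ_x‖ + ‖u - R'‖)`, one power of `h` too large.

The remedy is to measure `θ` in `L²` only, with energy `‖θ‖² + A_d(ξ, ξ)`. Let `χ ∈ S_h` solve
`A_b(χ, φ) = (θ, φ)` for all `φ ∈ S_h`; then half the time derivative of `‖θ‖²` is `A_b(θ_t, χ) =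
(F, χ_x)`. As the discrete solution of a Neumann problem, `χ` has a derivative within `O(h‖θ‖)` of
some `W ∈ S_h^0` with `‖W_x‖ = O(‖θ‖)` (`exists_dual_close`). Against `χ_x - W` the missing power of
`h` is regained. Against `W` the definition of `∂_h²` moves a derivative onto `W`, and the
definition of `R'` turns the consistency error into `d⁻¹(u - R', W)`. This is
`exists_dispersive_bound`. Gronwall's inequality then bounds the energy by `C h^(2r)`
(`exists_energy_bound`), and the inverse inequality supplies `‖θ_x‖`.

The products in the fluxes are truncated at a level `M` that dominates the exact solution. In
coordinates the truncated problem is a globally Lipschitz system of ordinary differential equations,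
so it is solvable on all of `[0, T]`, and the energy estimate needs no bound on the discrete
solution. If `M` exceeds a bound of the exact solution by 1, the Sobolev inequality shows that the
truncation is inactive for small `h`, which gives existence. Two semidiscrete solutions are both
bounded, hence solve one and the same truncated system: this is uniqueness. On each of the finitely
many remaining grids the solution, if there is one, is unique and bounded, so the same estimate
holds with a constant of its own, and these constants are added up.

The approximation theory rests on B-spline quasi-interpolation into the smoothest splines, which
belong to `S_h` for every `μ ≤ r - 2`. The `L²` estimate of the projections is an Aubin-Nitsche
argument in discrete form: the derivative of the discrete dual solution `χ` is compared with an
explicit primitive `Y` satisfying `f = χ - q Y'`, so no regularity theory enters. All functions of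
`x` that are integrated by parts are Lipschitz on `[-L, L]`; their derivatives exist almost
everywhere and are bounded. -/

/-- Lebesgue measure on `(-L, L]`. -/
abbrev vol (L : ℝ) : Measure ℝ := volume.restrict (Ioc (-L) L)

/-- `f` is Lipschitz on `[-L, L]`. -/
def Lip (L : ℝ) (f : ℝ → ℝ) : Prop := ∃ K : ℝ≥0, LipschitzOnWith K f (dom L)

/-- `f` is essentially bounded on `(-L, L]`. -/
def BM (L : ℝ) (f : ℝ → ℝ) : Prop := MemLp f ⊤ (vol L)

variable {L : ℝ} {f g v w : ℝ → ℝ}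

/-! ### Lipschitz functions -/

theorem uIcc_dom (hL : 0 < L) : uIcc (-L) L = dom L := uIcc_of_le (by linarith)

theorem Ioo_subset_dom : Ioo (-L) L ⊆ dom L := Ioo_subset_Icc_self

theorem dom_mem_nhds {x : ℝ} (hx : x ∈ Ioo (-L) L) : dom L ∈ 𝓝 x := Icc_mem_nhds hx.1 hx.2

theorem left_mem_dom (hL : 0 < L) : -L ∈ dom L := ⟨le_rfl, by linarith⟩

theorem right_mem_dom (hL : 0 < L) : L ∈ dom L := ⟨by linarith, le_rfl⟩

theorem Lip.of_abs_le {K : ℝ} (h : ∀ x ∈ dom L, ∀ y ∈ dom L, |f x - f y| ≤ K * |x - y|) :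
    Lip L f := by
  refine ⟨⟨max K 0, le_max_right _ _⟩, LipschitzOnWith.of_dist_le_mul fun x hx y hy => ?_⟩
  rw [Real.dist_eq, Real.dist_eq]
  exact (h x hx y hy).trans (mul_le_mul_of_nonneg_right (le_max_left _ _) (abs_nonneg _))

theorem Lip.exists_abs_le (hf : Lip L f) :
    ∃ K, 0 ≤ K ∧ ∀ x ∈ dom L, ∀ y ∈ dom L, |f x - f y| ≤ K * |x - y| := by
  obtain ⟨K, hK⟩ := hf
  refine ⟨K, K.2, fun x hx y hy => ?_⟩
  simpa [Real.dist_eq] using hK.dist_le_mul x hx y hy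

theorem Lip.congr (hf : Lip L f) (h : EqOn f g (dom L)) : Lip L g := by
  obtain ⟨K, -, hK⟩ := hf.exists_abs_le
  exact Lip.of_abs_le fun x hx y hy => by rw [← h hx, ← h hy]; exact hK x hx y hy

theorem Lip.continuousOn (hf : Lip L f) : ContinuousOn f (dom L) := by
  obtain ⟨K, hK⟩ := hf; exact hK.continuousOn

theorem ContinuousOn.exists_bound_dom (hf : ContinuousOn f (dom L)) :
    ∃ C, 0 ≤ C ∧ ∀ x ∈ dom L, |f x| ≤ C := by
  obtain ⟨C, hC⟩ := isCompact_Icc.exists_bound_of_continuousOn hf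
  exact ⟨max C 0, le_max_right _ _, fun x hx => (hC x hx).trans (le_max_left _ _)⟩

theorem Lip.add (hf : Lip L f) (hg : Lip L g) : Lip L (fun x => f x + g x) := by
  obtain ⟨K, hK⟩ := hf; obtain ⟨K', hK'⟩ := hg; exact ⟨_, hK.add hK'⟩

theorem Lip.sub (hf : Lip L f) (hg : Lip L g) : Lip L (fun x => f x - g x) := by
  obtain ⟨K, hK⟩ := hf; obtain ⟨K', hK'⟩ := hg; exact ⟨_, hK.sub hK'⟩

theorem Lip.mul (hf : Lip L f) (hg : Lip L g) : Lip L (fun x => f x * g x) := by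
  obtain ⟨A, hA, hfA⟩ := ContinuousOn.exists_bound_dom hf.continuousOn
  obtain ⟨B, hB, hgB⟩ := ContinuousOn.exists_bound_dom hg.continuousOn
  obtain ⟨K, hK0, hK⟩ := hf.exists_abs_le
  obtain ⟨K', hK0', hK'⟩ := hg.exists_abs_le
  refine Lip.of_abs_le (K := K * B + A * K') fun x hx y hy => ?_
  have : f x * g x - f y * g y = (f x - f y) * g x + f y * (g x - g y) := by ring
  rw [this]
  refine (abs_add_le _ _).trans ?_
  rw [abs_mul, abs_mul]
  have h1 := mul_le_mul (hK x hx y hy) (hgB x hx) (abs_nonneg _)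
    (mul_nonneg hK0 (abs_nonneg _))
  have h2 := mul_le_mul (hfA y hy) (hK' x hx y hy) (abs_nonneg _) hA
  linarith

theorem Lip.const (c : ℝ) : Lip L (fun _ => c) := ⟨0, LipschitzWith.const c |>.lipschitzOnWith⟩

theorem Lip.id : Lip L (fun x => x) := ⟨1, LipschitzWith.id.lipschitzOnWith⟩

theorem Lip.const_mul (c : ℝ) (hf : Lip L f) : Lip L (fun x => c * f x) := (Lip.const c).mul hf

theorem Lip.sum {ι : Type*} (s : Finset ι) {F : ι → ℝ → ℝ} (h : ∀ i ∈ s, Lip L (F i)) :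
    Lip L (fun x => ∑ i ∈ s, F i x) := by
  classical
  induction s using Finset.induction_on with
  | empty => simpa using Lip.const 0
  | insert a s ha ih =>
    simp only [Finset.sum_insert ha]
    exact (h a (by simp)).add (ih fun i hi => h i (by simp [hi]))

theorem ContDiffOn.lip {n : WithTop ℕ∞} (hn : n ≠ 0) (hf : ContDiffOn ℝ n f (dom L)) : Lip L f :=
  hf.exists_lipschitzOnWith hn (convex_Icc _ _) isCompact_Icc

theorem Lip.ac (hL : 0 < L) (hf : Lip L f) : AbsolutelyContinuousOnInterval f (-L) L := by
  obtain ⟨K, hK⟩ := hf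
  rw [← uIcc_dom hL] at hK
  exact hK.absolutelyContinuousOnInterval

theorem ae_mem_Ioo : ∀ᵐ x ∂vol L, x ∈ Ioo (-L) L := by
  rw [vol, ← Measure.restrict_congr_set Ioo_ae_eq_Ioc]
  exact ae_restrict_mem measurableSet_Ioo

theorem Lip.ae_differentiableAt (hL : 0 < L) (hf : Lip L f) :
    ∀ᵐ x ∂vol L, DifferentiableAt ℝ f x := by
  filter_upwards [ae_mem_Ioo, ae_restrict_of_ae (hf.ac hL).ae_differentiableAt] with x hx h
  exact h (by rw [uIcc_dom hL]; exact Ioo_subset_dom hx)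

/-! ### Essentially bounded functions -/

theorem BM.of_bound (hm : AEStronglyMeasurable f (vol L)) {C : ℝ} (h : ∀ᵐ x ∂vol L, |f x| ≤ C) :
    BM L f := memLp_top_of_bound hm C h

theorem ContinuousOn.bm (hf : ContinuousOn f (dom L)) : BM L f := by
  obtain ⟨C, -, hC⟩ := ContinuousOn.exists_bound_dom hf
  refine BM.of_bound (C := C)
    ((hf.mono Ioc_subset_Icc_self).aestronglyMeasurable measurableSet_Ioc) ?_
  filter_upwards [ae_mem_Ioo] with x hx using hC x (Ioo_subset_dom hx)

theorem Lip.bm (hf : Lip L f) : BM L f := ContinuousOn.bm hf.continuousOn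

theorem abs_deriv_le {K : ℝ} (hK0 : 0 ≤ K)
    (hK : ∀ x ∈ dom L, ∀ y ∈ dom L, |f x - f y| ≤ K * |x - y|)
    {x : ℝ} (hx : x ∈ Ioo (-L) L) : |deriv f x| ≤ K := by
  refine norm_deriv_le_of_lip' (f := f) hK0 ?_
  filter_upwards [dom_mem_nhds hx] with y hy
  exact hK y hy x (Ioo_subset_dom hx)

theorem Lip.exists_deriv_le (hf : Lip L f) : ∃ C, 0 ≤ C ∧ ∀ x ∈ Ioo (-L) L, |deriv f x| ≤ C := by
  obtain ⟨K, hK0, hK⟩ := hf.exists_abs_le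
  exact ⟨K, hK0, fun x hx => abs_deriv_le hK0 hK hx⟩

theorem Lip.bm_deriv (hf : Lip L f) : BM L (deriv f) := by
  obtain ⟨C, -, hC⟩ := hf.exists_deriv_le
  refine BM.of_bound (C := C) (measurable_deriv f).aestronglyMeasurable ?_
  filter_upwards [ae_mem_Ioo] with x hx using hC x hx

theorem BM.add (hf : BM L f) (hg : BM L g) : BM L (fun x => f x + g x) := MemLp.add hf hg

theorem BM.sub (hf : BM L f) (hg : BM L g) : BM L (fun x => f x - g x) := MemLp.sub hf hg

theorem BM.const_mul (c : ℝ) (hf : BM L f) : BM L (fun x => c * f x) := MemLp.const_mul hf c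

theorem BM.mul (hf : BM L f) (hg : BM L g) : BM L (fun x => f x * g x) := MemLp.mul hg hf

theorem BM.const (c : ℝ) : BM L (fun _ => c) := memLp_const c

theorem BM.abs (hf : BM L f) : BM L (fun x => |f x|) := MemLp.abs hf

theorem BM.congr (hf : BM L f) (h : f =ᵐ[vol L] g) : BM L g := (memLp_congr_ae h).1 hf

theorem BM.integrable (hf : BM L f) : Integrable f (vol L) := MemLp.integrable le_top hf

theorem BM.memLp_two (hf : BM L f) : MemLp f 2 (vol L) := MemLp.mono_exponent hf le_top

/-! ### The inner product -/

theorem ip_eq (hL : 0 < L) (v w : ℝ → ℝ) : ip L v w = ∫ x, v x * w x ∂vol L :=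
  intervalIntegral.integral_of_le (by linarith)

theorem ip_comm (v w : ℝ → ℝ) : ip L v w = ip L w v := by simp only [ip, mul_comm]

theorem ip_congr (hL : 0 < L) {v v' w w' : ℝ → ℝ} (hv : v =ᵐ[vol L] v') (hw : w =ᵐ[vol L] w') :
    ip L v w = ip L v' w' := by
  rw [ip_eq hL, ip_eq hL]
  exact integral_congr_ae (by filter_upwards [hv, hw] with x h1 h2; rw [h1, h2])

theorem ae_eq_of_Ioo {v v' : ℝ → ℝ} (h : EqOn v v' (Ioo (-L) L)) : v =ᵐ[vol L] v' := by
  filter_upwards [ae_mem_Ioo] with x hx using h hx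

theorem ae_eq_of_dom {v v' : ℝ → ℝ} (h : EqOn v v' (dom L)) : v =ᵐ[vol L] v' :=
  ae_eq_of_Ioo (h.mono Ioo_subset_dom)

/-- Values outside `[-L, L]` are arbitrary, so `deriv` is meaningful only in the open interval. The
end points are negligible under every integral. -/
theorem deriv_eqOn_of_dom {v v' : ℝ → ℝ} (h : EqOn v v' (dom L)) :
    EqOn (deriv v) (deriv v') (Ioo (-L) L) := fun x hx =>
  Filter.EventuallyEq.deriv_eq (by filter_upwards [dom_mem_nhds hx] with y hy using h hy)

theorem ip_add_left (hL : 0 < L) {v v' w : ℝ → ℝ} (hv : BM L v) (hv' : BM L v') (hw : BM L w) :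
    ip L (fun x => v x + v' x) w = ip L v w + ip L v' w := by
  simp only [ip_eq hL, add_mul]
  exact integral_add (hv.mul hw).integrable (hv'.mul hw).integrable

theorem ip_sub_left (hL : 0 < L) {v v' w : ℝ → ℝ} (hv : BM L v) (hv' : BM L v') (hw : BM L w) :
    ip L (fun x => v x - v' x) w = ip L v w - ip L v' w := by
  simp only [ip_eq hL, sub_mul]
  exact integral_sub (hv.mul hw).integrable (hv'.mul hw).integrable

theorem ip_smul_left (hL : 0 < L) (c : ℝ) (v w : ℝ → ℝ) :
    ip L (fun x => c * v x) w = c * ip L v w := by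
  simp only [ip_eq hL, mul_assoc]
  exact integral_const_mul _ _

theorem ip_sub_right (hL : 0 < L) {v w w' : ℝ → ℝ} (hv : BM L v) (hw : BM L w) (hw' : BM L w') :
    ip L v (fun x => w x - w' x) = ip L v w - ip L v w' := by
  rw [ip_comm, ip_sub_left hL hw hw' hv, ip_comm w, ip_comm w']

theorem ip_smul_right (hL : 0 < L) (c : ℝ) (v w : ℝ → ℝ) :
    ip L v (fun x => c * w x) = c * ip L v w := by
  rw [ip_comm, ip_smul_left hL, ip_comm]

theorem ip_sum_left (hL : 0 < L) {ι : Type*} (s : Finset ι) {F : ι → ℝ → ℝ}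
    (h : ∀ i ∈ s, BM L (F i)) (hw : BM L w) :
    ip L (fun x => ∑ i ∈ s, F i x) w = ∑ i ∈ s, ip L (F i) w := by
  simp only [ip_eq hL, Finset.sum_mul]
  exact integral_finsetSum _ fun i hi => ((h i hi).mul hw).integrable

theorem ip_sum_right (hL : 0 < L) {ι : Type*} (s : Finset ι) {F : ι → ℝ → ℝ}
    (h : ∀ i ∈ s, BM L (F i)) (hv : BM L v) :
    ip L v (fun x => ∑ i ∈ s, F i x) = ∑ i ∈ s, ip L v (F i) := by
  rw [ip_comm, ip_sum_left hL s h hv]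
  exact Finset.sum_congr rfl fun i _ => ip_comm _ _

theorem ip_self_nonneg (hL : 0 < L) (v : ℝ → ℝ) : 0 ≤ ip L v v := by
  rw [ip_eq hL]; exact integral_nonneg fun x => mul_self_nonneg _

theorem ip_self_eq_zero (hL : 0 < L) (hv : ContinuousOn v (dom L)) (h : ip L v v = 0) :
    ∀ x ∈ dom L, v x = 0 := by
  by_contra! hc
  obtain ⟨x, hx, hne⟩ := hc
  have : 0 < ∫ x in (-L)..L, v x * v x := by
    refine intervalIntegral.integral_pos (by linarith) (hv.mul hv)
      (fun y _ => mul_self_nonneg _) ⟨x, hx, mul_self_pos.2 hne⟩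
  exact this.ne' h

/-! ### The `L²` norm -/

theorem normL2_nonneg : 0 ≤ normL2 L v := Real.sqrt_nonneg _

theorem normL2_sq (hL : 0 < L) (v : ℝ → ℝ) : normL2 L v ^ 2 = ip L v v :=
  Real.sq_sqrt (ip_self_nonneg hL v)

/-- The bridge to the Hilbert space `Lp`, from which the triangle and Cauchy-Schwarz inequalities
are inherited. -/
theorem normL2_eq_norm (hL : 0 < L) (hv : BM L v) : normL2 L v = ‖hv.memLp_two.toLp v‖ := by
  rw [normL2, ip_eq hL, norm_eq_sqrt_real_inner, L2.inner_def]
  congr 1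
  refine integral_congr_ae ?_
  filter_upwards [hv.memLp_two.coeFn_toLp] with x hx
  simp [hx, sq]

theorem normL2_congr (hL : 0 < L) (h : v =ᵐ[vol L] w) : normL2 L v = normL2 L w := by
  rw [normL2, normL2, ip_congr hL h h]

theorem normL2_add_le (hL : 0 < L) (hv : BM L v) (hw : BM L w) :
    normL2 L (fun x => v x + w x) ≤ normL2 L v + normL2 L w := by
  rw [normL2_eq_norm hL hv, normL2_eq_norm hL hw, normL2_eq_norm hL (hv.add hw)]
  exact norm_add_le (hv.memLp_two.toLp v) (hw.memLp_two.toLp w)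

theorem normL2_smul (hL : 0 < L) (c : ℝ) (v : ℝ → ℝ) :
    normL2 L (fun x => c * v x) = |c| * normL2 L v := by
  rw [normL2, ip_smul_left hL, ip_smul_right hL, ← mul_assoc, Real.sqrt_mul (mul_self_nonneg c),
    Real.sqrt_mul_self_eq_abs, normL2]

theorem normL2_neg (hL : 0 < L) (v : ℝ → ℝ) : normL2 L (fun x => -v x) = normL2 L v := by
  have := normL2_smul hL (-1) v
  simpa using this

theorem normL2_sub_comm (hL : 0 < L) (v w : ℝ → ℝ) :
    normL2 L (fun x => v x - w x) = normL2 L (fun x => w x - v x) := by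
  rw [← normL2_neg hL]; simp

theorem normL2_sub_le (hL : 0 < L) (hv : BM L v) (hw : BM L w) :
    normL2 L (fun x => v x - w x) ≤ normL2 L v + normL2 L w := by
  have := normL2_add_le hL hv (hw.const_mul (-1))
  rw [normL2_smul hL] at this
  simpa [sub_eq_add_neg] using this

/-- The triangle inequality through an intermediate function. -/
theorem normL2_sub_trans (hL : 0 < L) {u : ℝ → ℝ} (hu : BM L u) (hv : BM L v) (hw : BM L w) :
    normL2 L (fun x => u x - w x) ≤ normL2 L (fun x => u x - v x) + normL2 L (fun x => v x - w x) := by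
  have := normL2_add_le hL (hu.sub hv) (hv.sub hw)
  simpa using this

theorem abs_ip_le (hL : 0 < L) (hv : BM L v) (hw : BM L w) :
    |ip L v w| ≤ normL2 L v * normL2 L w := by
  rw [normL2_eq_norm hL hv, normL2_eq_norm hL hw]
  refine le_trans (le_of_eq ?_) (abs_real_inner_le_norm (hv.memLp_two.toLp v) (hw.memLp_two.toLp w))
  rw [ip_eq hL, L2.inner_def]
  congr 1
  refine integral_congr_ae ?_
  filter_upwards [hv.memLp_two.coeFn_toLp, hw.memLp_two.coeFn_toLp] with x hx hx'
  simp [hx, hx', mul_comm]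

theorem ip_le (hL : 0 < L) (hv : BM L v) (hw : BM L w) :
    ip L v w ≤ normL2 L v * normL2 L w := (le_abs_self _).trans (abs_ip_le hL hv hw)

/-- Monotonicity of the `L²` norm. -/
theorem normL2_mono (hL : 0 < L) (hv : BM L v) (hw : BM L w) (h : ∀ᵐ x ∂vol L, |v x| ≤ |w x|) :
    normL2 L v ≤ normL2 L w := by
  rw [normL2, normL2, ip_eq hL, ip_eq hL]
  refine Real.sqrt_le_sqrt (integral_mono_ae (hv.mul hv).integrable (hw.mul hw).integrable ?_)
  filter_upwards [h] with x hx
  rw [← abs_mul_abs_self (v x), ← abs_mul_abs_self (w x)]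
  exact mul_self_le_mul_self (abs_nonneg _) hx

theorem normL2_const (hL : 0 < L) (c : ℝ) : normL2 L (fun _ => c) = |c| * √(2 * L) := by
  have h1 : normL2 L (fun _ => (1 : ℝ)) = √(2 * L) := by
    rw [normL2, ip]
    congr 1
    simp; ring
  have := normL2_smul hL c (fun _ => (1 : ℝ))
  rw [h1] at this
  simpa using this

theorem normL2_le_of_abs_le (hL : 0 < L) (hv : BM L v) {C : ℝ} (hC : 0 ≤ C)
    (h : ∀ x ∈ Ioo (-L) L, |v x| ≤ C) : normL2 L v ≤ √(2 * L) * C := by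
  have h1 : normL2 L v ≤ normL2 L (fun _ => C) := by
    refine normL2_mono hL hv (BM.const C) ?_
    filter_upwards [ae_mem_Ioo] with x hx
    rw [abs_of_nonneg hC]; exact h x hx
  rwa [normL2_const hL, abs_of_nonneg hC, mul_comm] at h1

/-- `‖v‖ ≤ C * ‖w‖` when `|v| ≤ C * |w|`. -/
theorem normL2_le_mul (hL : 0 < L) (hv : BM L v) (hw : BM L w) {C : ℝ} (hC : 0 ≤ C)
    (h : ∀ x ∈ Ioo (-L) L, |v x| ≤ C * |w x|) : normL2 L v ≤ C * normL2 L w := by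
  have h1 : normL2 L v ≤ normL2 L (fun x => C * w x) := by
    refine normL2_mono hL hv (hw.const_mul C) ?_
    filter_upwards [ae_mem_Ioo] with x hx
    rw [abs_mul, abs_of_nonneg hC]; exact h x hx
  rwa [normL2_smul hL, abs_of_nonneg hC] at h1

/-! ### Derivatives of Lipschitz functions -/

theorem Lip.deriv_add (hL : 0 < L) (hf : Lip L f) (hg : Lip L g) :
    deriv (fun x => f x + g x) =ᵐ[vol L] fun x => deriv f x + deriv g x := by
  filter_upwards [hf.ae_differentiableAt hL, hg.ae_differentiableAt hL] with x h1 h2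
  exact deriv_fun_add h1 h2

theorem Lip.deriv_sub (hL : 0 < L) (hf : Lip L f) (hg : Lip L g) :
    deriv (fun x => f x - g x) =ᵐ[vol L] fun x => deriv f x - deriv g x := by
  filter_upwards [hf.ae_differentiableAt hL, hg.ae_differentiableAt hL] with x h1 h2
  exact deriv_fun_sub h1 h2

theorem deriv_smul_eq (c : ℝ) (f : ℝ → ℝ) : deriv (fun x => c * f x) = fun x => c * deriv f x := by
  funext x; exact deriv_const_mul_field c

theorem Lip.deriv_mul (hL : 0 < L) (hf : Lip L f) (hg : Lip L g) :
    deriv (fun x => f x * g x) =ᵐ[vol L] fun x => deriv f x * g x + f x * deriv g x := by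
  filter_upwards [hf.ae_differentiableAt hL, hg.ae_differentiableAt hL] with x h1 h2
  exact deriv_fun_mul h1 h2

theorem Lip.deriv_sum (hL : 0 < L) {ι : Type*} [Fintype ι] {F : ι → ℝ → ℝ}
    (h : ∀ i, Lip L (F i)) :
    deriv (fun x => ∑ i, F i x) =ᵐ[vol L] fun x => ∑ i, deriv (F i) x := by
  have : ∀ᵐ x ∂vol L, ∀ i, DifferentiableAt ℝ (F i) x :=
    ae_all_iff.2 fun i => (h i).ae_differentiableAt hL
  filter_upwards [this] with x hx
  exact deriv_fun_sum fun i _ => hx i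

/-- Integration by parts. -/
theorem ip_deriv_left (hL : 0 < L) (hf : Lip L f) (hg : Lip L g) :
    ip L (deriv f) g = f L * g L - f (-L) * g (-L) - ip L f (deriv g) := by
  have := (hf.ac hL).integral_mul_deriv_eq_deriv_mul (hg.ac hL)
  simp only [ip]; linarith

theorem ip_deriv_left_of_zero (hL : 0 < L) (hf : Lip L f) (hg : Lip L g) (h1 : f (-L) = 0)
    (h2 : f L = 0) : ip L (deriv f) g = -ip L f (deriv g) := by
  rw [ip_deriv_left hL hf hg, h1, h2]; ring

theorem normL2_deriv_sub_trans (hL : 0 < L) {u : ℝ → ℝ} (hu : Lip L u) (hv : Lip L v)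
    (hw : Lip L w) : normL2 L (deriv fun x => u x - w x) ≤
      normL2 L (deriv fun x => u x - v x) + normL2 L (deriv fun x => v x - w x) := by
  have h := normL2_add_le hL (hu.sub hv).bm_deriv (hv.sub hw).bm_deriv
  rw [← normL2_congr hL ((hu.sub hv).deriv_add hL (hv.sub hw))] at h
  simpa using h

theorem normL2_deriv_congr (hL : 0 < L) (h : EqOn v w (dom L)) :
    normL2 L (deriv v) = normL2 L (deriv w) :=
  normL2_congr hL (ae_eq_of_Ioo (deriv_eqOn_of_dom h))

/-- The one-dimensional Sobolev inequality. -/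
theorem Lip.abs_le_sobolev (hL : 0 < L) (hv : Lip L v) {x : ℝ} (hx : x ∈ dom L) :
    2 * L * |v x| ≤ √(2 * L) * normL2 L v + 2 * L * (√(2 * L) * normL2 L (deriv v)) := by
  -- The oscillation is at most the integral of `|v'|`; Cauchy-Schwarz against the constant 1 brings
  -- in `√(2 * L)`.
  have hdiff : ∀ y ∈ dom L, |v x - v y| ≤ √(2 * L) * normL2 L (deriv v) := by
    intro y hy
    have hac : AbsolutelyContinuousOnInterval v y x := (hv.ac hL).mono (by
      rw [uIcc_dom hL]; exact uIcc_subset_Icc hy hx)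
    rw [← hac.integral_deriv_eq_sub]
    have h1 : |∫ s in y..x, deriv v s| ≤ ∫ s in uIoc y x, |deriv v s| := by
      simpa only [Real.norm_eq_abs] using
        intervalIntegral.norm_integral_le_integral_norm_uIoc (f := deriv v) (a := y) (b := x)
          (μ := volume)
    have h2 : ∫ s in uIoc y x, |deriv v s| ≤ ∫ s, |deriv v s| ∂vol L := by
      refine setIntegral_mono_set hv.bm_deriv.abs.integrable ?_ ?_
      · exact ae_of_all _ fun _ => abs_nonneg _
      · refine LE.le.eventuallyLE ?_
        rw [uIoc]
        exact Ioc_subset_Ioc (le_min hy.1 hx.1) (max_le hy.2 hx.2)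
    have h3 : ∫ s, |deriv v s| ∂vol L = ip L (fun s => |deriv v s|) (fun _ => 1) := by
      rw [ip_eq hL]; simp
    have h4 := ip_le hL hv.bm_deriv.abs (BM.const (L := L) 1)
    have h5 : normL2 L (fun s => |deriv v s|) ≤ normL2 L (deriv v) :=
      normL2_mono hL hv.bm_deriv.abs hv.bm_deriv (ae_of_all _ fun s => by simp)
    rw [normL2_const hL, abs_one, one_mul] at h4
    have h6 := mul_le_mul_of_nonneg_right h5 (Real.sqrt_nonneg (2 * L))
    linarith
  have h1 : ip L (fun y => |v y|) (fun _ => 1) ≤ normL2 L v * √(2 * L) := by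
    have h4 := ip_le hL hv.bm.abs (BM.const (L := L) 1)
    have h5 : normL2 L (fun s => |v s|) ≤ normL2 L v :=
      normL2_mono hL hv.bm.abs hv.bm (ae_of_all _ fun s => by simp)
    rw [normL2_const hL, abs_one, one_mul] at h4
    exact h4.trans (mul_le_mul_of_nonneg_right h5 (Real.sqrt_nonneg (2 * L)))
  -- The lower bound for `|v y|` just obtained is integrated over `y`, with `x` fixed.
  have h2 : ip L (fun _ => |v x| - √(2 * L) * normL2 L (deriv v)) (fun _ => 1)
      ≤ ip L (fun y => |v y|) (fun _ => 1) := by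
    rw [ip_eq hL, ip_eq hL]
    refine integral_mono_ae ((BM.const _).mul (BM.const 1)).integrable
      (hv.bm.abs.mul (BM.const 1)).integrable ?_
    filter_upwards [ae_mem_Ioo] with y hy
    have := hdiff y (Ioo_subset_dom hy)
    have h' := abs_sub_abs_le_abs_sub (v x) (v y)
    simp only [mul_one]; linarith
  have h3 : ip L (fun _ => |v x| - √(2 * L) * normL2 L (deriv v)) (fun _ => 1)
      = 2 * L * (|v x| - √(2 * L) * normL2 L (deriv v)) := by
    simp [ip]; ring
  rw [h3] at h2
  linarith

/-! ### The `H¹` norm -/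

theorem normH1_le (hL : 0 < L) (v : ℝ → ℝ) : normH1 L v ≤ normL2 L v + normL2 L (deriv v) := by
  rw [normH1, ← normL2_sq hL v, ← normL2_sq hL (deriv v)]
  refine (Real.sqrt_le_left (add_nonneg normL2_nonneg normL2_nonneg)).2 ?_
  have := mul_nonneg (normL2_nonneg (L := L) (v := v)) (normL2_nonneg (L := L) (v := deriv v))
  nlinarith

/-! ### The form `A_q` -/

theorem bilin_comm (q : ℝ) (v w : ℝ → ℝ) : bilin L q v w = bilin L q w v := by
  simp only [bilin, ip_comm]

theorem bilin_congr (hL : 0 < L) (q : ℝ) {v v' w w' : ℝ → ℝ} (hv : EqOn v v' (dom L))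
    (hw : EqOn w w' (dom L)) : bilin L q v w = bilin L q v' w' := by
  rw [bilin, bilin, ip_congr hL (ae_eq_of_dom hv) (ae_eq_of_dom hw),
    ip_congr hL (ae_eq_of_Ioo (deriv_eqOn_of_dom hv)) (ae_eq_of_Ioo (deriv_eqOn_of_dom hw))]

theorem bilin_add_left (hL : 0 < L) (q : ℝ) {v v' w : ℝ → ℝ} (hv : Lip L v) (hv' : Lip L v')
    (hw : Lip L w) : bilin L q (fun x => v x + v' x) w = bilin L q v w + bilin L q v' w := by
  rw [bilin, bilin, bilin, ip_add_left hL hv.bm hv'.bm hw.bm,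
    ip_congr hL (hv.deriv_add hL hv') (EventuallyEq.refl _ _),
    ip_add_left hL hv.bm_deriv hv'.bm_deriv hw.bm_deriv]
  ring

theorem bilin_sub_left (hL : 0 < L) (q : ℝ) {v v' w : ℝ → ℝ} (hv : Lip L v) (hv' : Lip L v')
    (hw : Lip L w) : bilin L q (fun x => v x - v' x) w = bilin L q v w - bilin L q v' w := by
  rw [bilin, bilin, bilin, ip_sub_left hL hv.bm hv'.bm hw.bm,
    ip_congr hL (hv.deriv_sub hL hv') (EventuallyEq.refl _ _),
    ip_sub_left hL hv.bm_deriv hv'.bm_deriv hw.bm_deriv]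
  ring

theorem bilin_smul_left (hL : 0 < L) (q c : ℝ) (v w : ℝ → ℝ) :
    bilin L q (fun x => c * v x) w = c * bilin L q v w := by
  rw [bilin, bilin, ip_smul_left hL, deriv_smul_eq, ip_smul_left hL]; ring

theorem bilin_sum_left (hL : 0 < L) (q : ℝ) {ι : Type*} [Fintype ι] {F : ι → ℝ → ℝ}
    (h : ∀ i, Lip L (F i)) (hw : Lip L w) :
    bilin L q (fun x => ∑ i, F i x) w = ∑ i, bilin L q (F i) w := by
  simp only [bilin]
  rw [ip_sum_left hL _ (fun i _ => (h i).bm) hw.bm,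
    ip_congr hL (Lip.deriv_sum hL h) (EventuallyEq.refl _ _),
    ip_sum_left hL _ (fun i _ => (h i).bm_deriv) hw.bm_deriv, Finset.mul_sum,
    Finset.sum_add_distrib]

theorem bilin_self (hL : 0 < L) (q : ℝ) (v : ℝ → ℝ) :
    bilin L q v v = normL2 L v ^ 2 + q * normL2 L (deriv v) ^ 2 := by
  rw [bilin, normL2_sq hL, normL2_sq hL]

end

noncomputable section

open MeasureTheory
open scoped NNReal ENNReal

variable {L : ℝ} {f g v w : ℝ → ℝ} {N μ r : ℕ}

/-! ### The uniform grid -/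

theorem meshSize_pos (hL : 0 < L) (hN : 1 ≤ N) : 0 < meshSize L N := by
  have : (0 : ℝ) < N := by exact_mod_cast hN
  unfold meshSize; positivity

theorem mul_meshSize (hN : 1 ≤ N) : (N : ℝ) * meshSize L N = 2 * L := by
  have : (N : ℝ) ≠ 0 := by positivity
  unfold meshSize; field_simp

theorem meshSize_le (hL : 0 < L) (hN : 1 ≤ N) : meshSize L N ≤ 2 * L := by
  have h1 : (1 : ℝ) ≤ N := by exact_mod_cast hN
  have := mul_meshSize (L := L) hN
  nlinarith [meshSize_pos hL hN]

theorem node_zero : node L N 0 = -L := by simp [node]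

theorem node_last (hN : 1 ≤ N) : node L N N = L := by
  rw [node, mul_meshSize hN]; ring

theorem node_succ (i : ℕ) : node L N (i + 1) = node L N i + meshSize L N := by
  simp only [node]; push_cast; ring

theorem node_lt_succ (hL : 0 < L) (hN : 1 ≤ N) (i : ℕ) : node L N i < node L N (i + 1) := by
  rw [node_succ]; linarith [meshSize_pos hL hN]

theorem node_mono (hL : 0 < L) (hN : 1 ≤ N) {i j : ℕ} (h : i ≤ j) : node L N i ≤ node L N j := by
  have : (i : ℝ) ≤ j := by exact_mod_cast h
  simp only [node]
  nlinarith [meshSize_pos hL hN]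

theorem node_mem_dom (hL : 0 < L) (hN : 1 ≤ N) {i : ℕ} (h : i ≤ N) : node L N i ∈ dom L := by
  have h1 := node_mono hL hN (Nat.zero_le i)
  have h2 := node_mono hL hN h
  rw [node_zero] at h1; rw [node_last hN] at h2
  exact ⟨h1, h2⟩

theorem cell_subset_dom (hL : 0 < L) (hN : 1 ≤ N) {i : ℕ} (h : i < N) :
    Icc (node L N i) (node L N (i + 1)) ⊆ dom L :=
  Icc_subset_Icc (node_mem_dom hL hN h.le).1 (node_mem_dom hL hN (Nat.succ_le_of_lt h)).2

theorem exists_cell (hL : 0 < L) (hN : 1 ≤ N) {x : ℝ} (hx : x ∈ Ico (-L) L) :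
    ∃ i < N, x ∈ Ico (node L N i) (node L N (i + 1)) := by
  have hh := meshSize_pos hL hN
  have h0 : 0 ≤ (x + L) / meshSize L N := div_nonneg (by linarith [hx.1]) hh.le
  have h1 := Nat.floor_le h0
  have h2 := Nat.lt_floor_add_one ((x + L) / meshSize L N)
  rw [le_div_iff₀ hh] at h1
  rw [div_lt_iff₀ hh] at h2
  refine ⟨⌊(x + L) / meshSize L N⌋₊, ?_, ?_, ?_⟩
  · by_contra! hc
    have hc' : (N : ℝ) ≤ (⌊(x + L) / meshSize L N⌋₊ : ℝ) := by exact_mod_cast hc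
    have := mul_meshSize (L := L) hN
    nlinarith [hx.2]
  · simp only [node]; linarith
  · simp only [node]; push_cast; linarith

theorem integral_eq_sum_cells (hL : 0 < L) (hN : 1 ≤ N) {F : ℝ → ℝ} (hF : Integrable F (vol L)) :
    ∫ x in (-L)..L, F x = ∑ i ∈ Finset.range N, ∫ x in node L N i..node L N (i + 1), F x := by
  rw [intervalIntegral.sum_integral_adjacent_intervals, node_zero, node_last hN]
  intro k hk
  rw [intervalIntegrable_iff_integrableOn_Ioc_of_le (node_lt_succ hL hN k).le]
  exact IntegrableOn.mono_set hF (Ioc_subset_Ioc (node_mem_dom hL hN hk.le).1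
    (node_mem_dom hL hN (Nat.succ_le_of_lt hk)).2)

/-! ### Piecewise polynomial functions -/

/-- A continuous piecewise polynomial function is Lipschitz. -/
theorem lip_of_piecewise (hL : 0 < L) (hN : 1 ≤ N) (hf : ContinuousOn f (dom L))
    (h : ∀ i < N, ∃ p : Polynomial ℝ, ∀ x ∈ Ico (node L N i) (node L N (i + 1)), f x = p.eval x) :
    Lip L f := by
  choose! p hp using h
  have hb : ∀ i, ∃ C, 0 ≤ C ∧ ∀ x ∈ dom L, |(p i).derivative.eval x| ≤ C := fun i =>
    ContinuousOn.exists_bound_dom (Polynomial.continuous _).continuousOn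
  choose C hC0 hC using hb
  set K := ∑ i ∈ Finset.range N, C i with hK
  have hCK : ∀ i < N, C i ≤ K := fun i hi =>
    Finset.single_le_sum (f := C) (fun j _ => hC0 j) (Finset.mem_range.2 hi)
  choose! c hcN hcx using fun x (hx : x ∈ Ico (-L) L) => exists_cell hL hN hx
  -- The mean value inequality for right derivatives applies across nodes: to the right of every
  -- point `f` is locally one polynomial, that of the half-open cell containing the point.
  have key : ∀ x ∈ dom L, ∀ y ∈ dom L, x ≤ y → |f y - f x| ≤ K * (y - x) := by
    intro x hx y hy hxy
    have hsub : ∀ z ∈ Ico x y, z ∈ Ico (-L) L := fun z hz =>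
      ⟨hx.1.trans hz.1, hz.2.trans_le hy.2⟩
    refine norm_image_sub_le_of_norm_deriv_right_le_segment (a := x) (b := y) (f := f)
      (f' := fun z => (p (c z)).derivative.eval z) (hf.mono (Icc_subset_Icc hx.1 hy.2)) ?_ ?_ y
      (right_mem_Icc.2 hxy)
    · intro z hz
      have hz' := hsub z hz
      refine ((p (c z)).hasDerivAt z).hasDerivWithinAt.congr_of_eventuallyEq ?_
        (hp _ (hcN z hz') z (hcx z hz'))
      filter_upwards [Ico_mem_nhdsGE (hcx z hz').2] with t ht
      exact hp _ (hcN z hz') t ⟨(hcx z hz').1.trans ht.1, ht.2⟩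
    · intro z hz
      exact (hC _ z (Ico_subset_Icc_self (hsub z hz))).trans (hCK _ (hcN z (hsub z hz)))
  refine Lip.of_abs_le (K := K) fun x hx y hy => ?_
  rcases le_total x y with h | h
  · rw [abs_sub_comm, abs_sub_comm x y, abs_of_nonneg (sub_nonneg.2 h)]; exact key x hx y hy h
  · rw [abs_of_nonneg (sub_nonneg.2 h)]; exact key y hy x hx h

theorem femSpace.continuousOn (hf : f ∈ femSpace L N μ r) : ContinuousOn f (dom L) :=
  hf.1.continuousOn

theorem femSpace.lip (hL : 0 < L) (hN : 1 ≤ N) (hf : f ∈ femSpace L N μ r) : Lip L f :=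
  lip_of_piecewise hL hN (femSpace.continuousOn hf) fun i hi => by
    obtain ⟨p, -, hp⟩ := hf.2 i hi
    exact ⟨p, fun x hx => hp x (Ico_subset_Icc_self hx)⟩

theorem femSpace.add (hf : f ∈ femSpace L N μ r) (hg : g ∈ femSpace L N μ r) :
    (fun x => f x + g x) ∈ femSpace L N μ r := by
  refine ⟨hf.1.add hg.1, fun i hi => ?_⟩
  obtain ⟨p, hp, hp'⟩ := hf.2 i hi
  obtain ⟨q, hq, hq'⟩ := hg.2 i hi
  exact ⟨p + q, Polynomial.natDegree_add_le_of_degree_le hp hq, fun x hx => by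
    simp only [hp' x hx, hq' x hx, Polynomial.eval_add]⟩

theorem femSpace.smul (c : ℝ) (hf : f ∈ femSpace L N μ r) :
    (fun x => c * f x) ∈ femSpace L N μ r := by
  refine ⟨contDiffOn_const.mul hf.1, fun i hi => ?_⟩
  obtain ⟨p, hp, hp'⟩ := hf.2 i hi
  exact ⟨Polynomial.C c * p, (Polynomial.natDegree_C_mul_le c p).trans hp, fun x hx => by
    simp only [hp' x hx, Polynomial.eval_mul, Polynomial.eval_C]⟩

theorem femSpace.congr (hf : f ∈ femSpace L N μ r) (h : EqOn f g (dom L)) (hL : 0 < L)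
    (hN : 1 ≤ N) : g ∈ femSpace L N μ r := by
  refine ⟨hf.1.congr fun x hx => (h hx).symm, fun i hi => ?_⟩
  obtain ⟨p, hp, hp'⟩ := hf.2 i hi
  exact ⟨p, hp, fun x hx => by rw [← h (cell_subset_dom hL hN hi hx), hp' x hx]⟩

theorem femSpace.affine (hr : 2 ≤ r) (c d : ℝ) : (fun x => c + d * x) ∈ femSpace L N μ r := by
  refine ⟨by fun_prop, fun i hi => ⟨Polynomial.C c + Polynomial.C d * Polynomial.X, ?_, ?_⟩⟩
  · refine (Polynomial.natDegree_add_le_of_degree_le (n := 1) (by simp) ?_).trans (by omega)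
    exact (Polynomial.natDegree_C_mul_le _ _).trans Polynomial.natDegree_X_le
  · intro x _; simp

theorem femSpace.const (hr : 2 ≤ r) (c : ℝ) : (fun _ => c) ∈ femSpace L N μ r := by
  simpa using femSpace.affine (L := L) (N := N) (μ := μ) hr c 0

theorem femSpaceZero.add (hf : f ∈ femSpaceZero L N μ r) (hg : g ∈ femSpaceZero L N μ r) :
    (fun x => f x + g x) ∈ femSpaceZero L N μ r :=
  ⟨femSpace.add hf.1 hg.1, by simp [hf.2.1, hg.2.1], by simp [hf.2.2, hg.2.2]⟩

theorem femSpaceZero.smul (c : ℝ) (hf : f ∈ femSpaceZero L N μ r) :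
    (fun x => c * f x) ∈ femSpaceZero L N μ r :=
  ⟨femSpace.smul c hf.1, by simp [hf.2.1], by simp [hf.2.2]⟩

/-! ### The inverse inequality -/

/-- Equivalence of norms in finite dimension: both integrals are continuous and homogeneous of
degree 2 in the coefficients and the second is positive off zero, so their quotient is bounded on
the compact unit sphere of coefficient vectors. -/
theorem exists_poly_inverse_unit (n : ℕ) : ∃ C, 0 ≤ C ∧ ∀ p : Polynomial ℝ, p.degree < n →
    ∫ x in (0 : ℝ)..1, p.derivative.eval x ^ 2 ≤ C * ∫ x in (0 : ℝ)..1, p.eval x ^ 2 := by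
  set P : (Fin n → ℝ) → Polynomial ℝ := fun c =>
    ∑ i : Fin n, Polynomial.C (c i) * Polynomial.X ^ (i : ℕ) with hP
  have hPe : ∀ c x, (P c).eval x = ∑ i : Fin n, c i * x ^ (i : ℕ) := fun c x => by
    simp [hP, Polynomial.eval_finsetSum]
  have hPd : ∀ c x, (P c).derivative.eval x
      = ∑ i : Fin n, c i * ((i : ℕ) * x ^ ((i : ℕ) - 1)) := fun c x => by
    simp [hP, Polynomial.eval_finsetSum, Polynomial.derivative_X_pow]
  have hPs : ∀ (s : ℝ) c, P (s • c) = Polynomial.C s * P c := fun s c => by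
    simp [hP, Finset.mul_sum, mul_assoc]
  have hP0 : ∀ c, P c = 0 → c = 0 := fun c hc => by
    funext j
    have := congrArg (fun p => Polynomial.coeff p (j : ℕ)) hc
    simpa [hP, Polynomial.finsetSum_coeff, Polynomial.coeff_X_pow, Fin.val_inj] using this
  set F : (Fin n → ℝ) → ℝ := fun c => ∫ x in (0 : ℝ)..1, (P c).eval x ^ 2 with hF
  set G : (Fin n → ℝ) → ℝ := fun c => ∫ x in (0 : ℝ)..1, (P c).derivative.eval x ^ 2 with hG
  have hFc : Continuous F := by
    refine intervalIntegral.continuous_parametric_intervalIntegral_of_continuous'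
      (f := fun c x => (P c).eval x ^ 2) ?_ 0 1
    simp only [Function.uncurry_def, hPe]; fun_prop
  have hGc : Continuous G := by
    refine intervalIntegral.continuous_parametric_intervalIntegral_of_continuous'
      (f := fun c x => (P c).derivative.eval x ^ 2) ?_ 0 1
    simp only [Function.uncurry_def, hPd]; fun_prop
  have hFpos : ∀ c, c ≠ 0 → 0 < F c := by
    intro c hc
    by_contra! hcon
    apply hc
    apply hP0
    refine Polynomial.eq_zero_of_infinite_isRoot _ ((Icc_infinite (zero_lt_one' ℝ)).mono ?_)
    intro x hx
    by_contra hne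
    have hne' : (P c).eval x ≠ 0 := hne
    have : 0 < F c := intervalIntegral.integral_pos zero_lt_one
      ((Polynomial.continuous _).pow 2).continuousOn (fun y _ => sq_nonneg _)
      ⟨x, hx, by positivity⟩
    linarith
  have hcomp : IsCompact (Metric.sphere (0 : Fin n → ℝ) 1) := isCompact_sphere _ _
  have hcont : ContinuousOn (fun c => G c / F c) (Metric.sphere (0 : Fin n → ℝ) 1) :=
    hGc.continuousOn.div hFc.continuousOn fun c hc => (hFpos c (by
      rintro rfl; simp at hc)).ne'
  obtain ⟨C, hC⟩ := hcomp.exists_bound_of_continuousOn hcont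
  refine ⟨max C 0, le_max_right _ _, fun p hp => ?_⟩
  set c : Fin n → ℝ := fun i => p.coeff i with hc
  have hpc : p = P c := by
    ext j
    rcases lt_or_ge j n with hj | hj
    · simp only [hP, hc, Polynomial.finsetSum_coeff, Polynomial.coeff_C_mul, Polynomial.coeff_X_pow]
      rw [Finset.sum_eq_single (⟨j, hj⟩ : Fin n)]
      · simp
      · intro b _ hb
        rw [if_neg, mul_zero]
        intro h; exact hb (Fin.ext h.symm)
      · simp
    · rw [Polynomial.coeff_eq_zero_of_degree_lt (hp.trans_le (by exact_mod_cast hj))]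
      simp only [hP, Polynomial.finsetSum_coeff, Polynomial.coeff_C_mul, Polynomial.coeff_X_pow]
      refine (Finset.sum_eq_zero fun i _ => ?_).symm
      rw [if_neg, mul_zero]
      have := i.2; omega
  rw [hpc]
  change G c ≤ max C 0 * F c
  by_cases hc0 : c = 0
  · have hz : P c = 0 := by rw [hc0]; simp [hP]
    simp [hF, hG, hz]
  · have hn : 0 < ‖c‖ := norm_pos_iff.2 hc0
    set d := ‖c‖⁻¹ • c with hd
    have hds : d ∈ Metric.sphere (0 : Fin n → ℝ) 1 := by
      simp [hd, norm_smul, hn.ne']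
    have hcd : c = ‖c‖ • d := by rw [hd, smul_smul, mul_inv_cancel₀ hn.ne', one_smul]
    have hd0 : d ≠ 0 := by rintro h; rw [h] at hds; simp at hds
    have h1 : G d ≤ C * F d := by
      have := (le_abs_self _).trans (hC d hds)
      rwa [div_le_iff₀ (hFpos d hd0)] at this
    have hFs : F c = ‖c‖ ^ 2 * F d := by
      conv_lhs => rw [hcd]
      simp only [hF, hPs, Polynomial.eval_mul, Polynomial.eval_C, mul_pow]
      exact intervalIntegral.integral_const_mul _ _
    have hGs : G c = ‖c‖ ^ 2 * G d := by
      conv_lhs => rw [hcd]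
      simp only [hG, hPs, Polynomial.derivative_C_mul, Polynomial.eval_mul, Polynomial.eval_C,
        mul_pow]
      exact intervalIntegral.integral_const_mul _ _
    rw [hFs, hGs]
    have h2 : C * F d ≤ max C 0 * F d :=
      mul_le_mul_of_nonneg_right (le_max_left _ _) (hFpos d hd0).le
    have h3 := mul_le_mul_of_nonneg_left (h1.trans h2) (sq_nonneg ‖c‖)
    linarith

/-- Scaling of the inequality on the unit interval: the substitution `a + h * x` multiplies the
derivative by `h`, whence the factor `h ^ 2`. -/
theorem exists_poly_inverse (n : ℕ) : ∃ C, 0 ≤ C ∧ ∀ (p : Polynomial ℝ), p.natDegree ≤ n →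
    ∀ (a h : ℝ), 0 < h → h ^ 2 * ∫ x in a..(a + h), p.derivative.eval x ^ 2
      ≤ C * ∫ x in a..(a + h), p.eval x ^ 2 := by
  obtain ⟨C, hC0, hC⟩ := exists_poly_inverse_unit (n + 1)
  refine ⟨C, hC0, fun p hp a h hh => ?_⟩
  set q : Polynomial ℝ := p.comp (Polynomial.C a + Polynomial.C h * Polynomial.X) with hq
  have hqd : q.natDegree ≤ n := by
    refine Polynomial.natDegree_comp_le.trans ?_
    have : (Polynomial.C a + Polynomial.C h * Polynomial.X).natDegree ≤ 1 :=
      Polynomial.natDegree_add_le_of_degree_le (by simp) 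
        ((Polynomial.natDegree_C_mul_le _ _).trans Polynomial.natDegree_X_le)
    calc _ ≤ n * 1 := Nat.mul_le_mul hp this
      _ = n := mul_one n
  have h1 := hC q (lt_of_le_of_lt Polynomial.degree_le_natDegree (by
    exact_mod_cast Nat.lt_succ_of_le hqd))
  have e1 : ∀ x, q.eval x = p.eval (a + h * x) := fun x => by simp [hq]
  have e2 : ∀ x, q.derivative.eval x = h * p.derivative.eval (a + h * x) := fun x => by
    simp [hq, Polynomial.derivative_comp]
  simp only [e1, e2, mul_pow] at h1
  rw [intervalIntegral.integral_const_mul] at h1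
  have s1 := intervalIntegral.smul_integral_comp_add_mul (a := 0) (b := 1)
    (fun x => p.eval x ^ 2) h a
  have s2 := intervalIntegral.smul_integral_comp_add_mul (a := 0) (b := 1)
    (fun x => p.derivative.eval x ^ 2) h a
  simp only [mul_zero, add_zero, mul_one, smul_eq_mul] at s1 s2
  rw [← s1, ← s2]
  nlinarith [mul_le_mul_of_nonneg_left h1 hh.le]

/-- The inverse inequality in the finite element spaces. -/
theorem exists_inverse_inequality (r : ℕ) : ∃ C, 0 ≤ C ∧ ∀ (L : ℝ) (N μ : ℕ), 0 < L → 1 ≤ N →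
    ∀ φ ∈ femSpace L N μ r, meshSize L N * normL2 L (deriv φ) ≤ C * normL2 L φ := by
  obtain ⟨C, hC0, hC⟩ := exists_poly_inverse (r - 1)
  refine ⟨√C, Real.sqrt_nonneg _, fun L N μ hL hN φ hφ => ?_⟩
  have hh := meshSize_pos hL hN
  have hlip := femSpace.lip hL hN hφ
  have key : meshSize L N ^ 2 * ip L (deriv φ) (deriv φ) ≤ C * ip L φ φ := by
    rw [ip, ip, integral_eq_sum_cells hL hN (hlip.bm_deriv.mul hlip.bm_deriv).integrable,
      integral_eq_sum_cells hL hN (hlip.bm.mul hlip.bm).integrable, Finset.mul_sum, Finset.mul_sum]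
    refine Finset.sum_le_sum fun i hi => ?_
    obtain ⟨p, hp, hpe⟩ := hφ.2 i (Finset.mem_range.1 hi)
    have hlt := node_lt_succ hL hN i
    have h1 := hC p hp (node L N i) (meshSize L N) hh
    rw [← node_succ] at h1
    have e1 : ∫ x in node L N i..node L N (i + 1), deriv φ x * deriv φ x
        = ∫ x in node L N i..node L N (i + 1), p.derivative.eval x ^ 2 := by
      rw [intervalIntegral.integral_of_le hlt.le, intervalIntegral.integral_of_le hlt.le,
        -- At the nodes `φ` may fail to be differentiable, so derivatives are compared on the open
        -- cell only.
        integral_Ioc_eq_integral_Ioo, integral_Ioc_eq_integral_Ioo]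
      refine setIntegral_congr_fun measurableSet_Ioo fun x hx => ?_
      have : deriv φ x = p.derivative.eval x := by
        rw [← Polynomial.deriv]
        refine Filter.EventuallyEq.deriv_eq ?_
        filter_upwards [Icc_mem_nhds hx.1 hx.2] with y hy using hpe y hy
      simp only [this, sq]
    have e2 : ∫ x in node L N i..node L N (i + 1), φ x * φ x
        = ∫ x in node L N i..node L N (i + 1), p.eval x ^ 2 := by
      refine intervalIntegral.integral_congr fun x hx => ?_
      rw [uIcc_of_le hlt.le] at hx
      simp only [hpe x hx, sq]
    rw [e1, e2]; exact h1
  rw [← normL2_sq hL, ← normL2_sq hL, ← mul_pow] at key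
  refine le_of_sq_le_sq ?_ (mul_nonneg (Real.sqrt_nonneg _) normL2_nonneg)
  rw [mul_pow √C, Real.sq_sqrt hC0]
  exact key

end

noncomputable section

open MeasureTheory
open scoped NNReal ENNReal

variable {L : ℝ} {f g v w : ℝ → ℝ} {N μ r : ℕ}

/-! ### Orthonormal bases of finite element spaces -/

/-- A linear space of piecewise polynomial functions on the grid, stable under changes of the
values outside `[-L, L]`. -/
structure IsFE (L : ℝ) (N r : ℕ) (S : Set (ℝ → ℝ)) : Prop where
  lip : ∀ φ ∈ S, Lip L φ
  poly : ∀ φ ∈ S, ∀ i < N, ∃ p : Polynomial ℝ, p.natDegree ≤ r - 1 ∧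
      ∀ x ∈ Icc (node L N i) (node L N (i + 1)), φ x = p.eval x
  zero : (fun _ => 0) ∈ S
  add : ∀ φ ∈ S, ∀ ψ ∈ S, (fun x => φ x + ψ x) ∈ S
  smul : ∀ (c : ℝ), ∀ φ ∈ S, (fun x => c * φ x) ∈ S
  congr : ∀ φ ∈ S, ∀ ψ, EqOn φ ψ (dom L) → ψ ∈ S

theorem isFE_femSpace (hL : 0 < L) (hN : 1 ≤ N) (hr : 2 ≤ r) :
    IsFE L N r (femSpace L N μ r) where
  lip _ h := femSpace.lip hL hN h
  poly _ h := h.2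
  zero := femSpace.const hr 0
  add _ h _ h' := femSpace.add h h'
  smul c _ h := femSpace.smul c h
  congr _ h _ h' := femSpace.congr h h' hL hN

theorem isFE_femSpaceZero (hL : 0 < L) (hN : 1 ≤ N) (hr : 2 ≤ r) :
    IsFE L N r (femSpaceZero L N μ r) where
  lip _ h := femSpace.lip hL hN h.1
  poly _ h := h.1.2
  zero := ⟨femSpace.const hr 0, rfl, rfl⟩
  add _ h _ h' := femSpaceZero.add h h'
  smul c _ h := femSpaceZero.smul c h
  congr _ h _ h' := ⟨femSpace.congr h.1 h' hL hN, (h' (left_mem_dom hL)).symm.trans h.2.1,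
    (h' (right_mem_dom hL)).symm.trans h.2.2⟩

variable {S : Set (ℝ → ℝ)}

theorem IsFE.sub (hS : IsFE L N r S) {φ ψ : ℝ → ℝ} (hφ : φ ∈ S) (hψ : ψ ∈ S) :
    (fun x => φ x - ψ x) ∈ S := by
  have := hS.add _ hφ _ (hS.smul (-1) _ hψ)
  simpa [sub_eq_add_neg] using this

theorem IsFE.sum (hS : IsFE L N r S) {ι : Type*} (s : Finset ι) {F : ι → ℝ → ℝ}
    (h : ∀ i ∈ s, F i ∈ S) : (fun x => ∑ i ∈ s, F i x) ∈ S := by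
  classical
  induction s using Finset.induction_on with
  | empty => simpa using hS.zero
  | insert a s ha ih =>
    simp only [Finset.sum_insert ha]
    exact hS.add _ (h a (by simp)) _ (ih fun i hi => h i (by simp [hi]))

/-- An `A_q`-orthonormal basis of `S`. The coordinates are linear combinations of point values. -/
structure IsONB (L q : ℝ) (S : Set (ℝ → ℝ)) {n : ℕ} (e : Fin n → ℝ → ℝ) : Prop where
  mem : ∀ i, e i ∈ S
  orth : ∀ i j, bilin L q (e i) (e j) = if i = j then 1 else 0
  expand : ∀ φ ∈ S, ∀ x ∈ dom L, φ x = ∑ i, bilin L q φ (e i) * e i x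
  eval : ∀ i, ∃ (ι : Type) (_ : Fintype ι) (p c : ι → ℝ), (∀ k, p k ∈ dom L) ∧
    ∀ φ ∈ S, bilin L q φ (e i) = ∑ k, c k * φ (p k)

/-- The functions of `S` that vanish outside `[-L, L]`. -/
def IsFE.submodule (hS : IsFE L N r S) : Submodule ℝ (ℝ → ℝ) where
  carrier := {φ | φ ∈ S ∧ ∀ x ∉ dom L, φ x = 0}
  add_mem' := fun {_ _} ha hb => ⟨hS.add _ ha.1 _ hb.1, fun y hy => by
    simp [ha.2 y hy, hb.2 y hy]⟩
  zero_mem' := ⟨hS.zero, fun _ _ => rfl⟩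
  smul_mem' := fun c _ ha => ⟨hS.smul c _ ha.1, fun x hx => by simp [ha.2 x hx]⟩

theorem IsFE.indicator_mem (hS : IsFE L N r S) {φ : ℝ → ℝ} (hφ : φ ∈ S) :
    (dom L).indicator φ ∈ hS.submodule :=
  ⟨hS.congr _ hφ _ fun _ hx => (indicator_of_mem hx φ).symm, fun _ hx =>
    indicator_of_notMem hx φ⟩

/-- Points of the `i`-th cell which determine polynomials of degree less than `r`. -/
def evalPoint (L : ℝ) (N r : ℕ) (j : Fin N × Fin r) : ℝ :=
  node L N j.1 + meshSize L N * ((j.2 : ℕ) / r)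

theorem evalPoint_mem_cell (hL : 0 < L) (hN : 1 ≤ N) (j : Fin N × Fin r) :
    evalPoint L N r j ∈ Icc (node L N j.1) (node L N (j.1 + 1)) := by
  have hh := meshSize_pos hL hN
  have h1 : ((j.2 : ℕ) : ℝ) / r ≤ 1 := by
    refine div_le_one_of_le₀ ?_ (Nat.cast_nonneg _)
    exact_mod_cast j.2.2.le
  have h0 : 0 ≤ ((j.2 : ℕ) : ℝ) / r := by positivity
  rw [node_succ]
  constructor <;> simp only [evalPoint] <;> nlinarith

/-- Evaluation at `r` points of each cell is injective, which gives finite dimension. The form is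
positive definite even for `q = 0`, so an orthogonal basis exists and can be normalised. -/
theorem exists_isONB (hL : 0 < L) (hN : 1 ≤ N) (hr : 2 ≤ r) (hS : IsFE L N r S) {q : ℝ}
    (hq : 0 ≤ q) : ∃ (n : ℕ) (e : Fin n → ℝ → ℝ), IsONB L q S e := by
  classical
  -- Members of `S` are determined only on `[-L, L]`. Setting them to zero outside makes the space
  -- finite-dimensional and the form definite.
  set V := hS.submodule
  have hh := meshSize_pos hL hN
  let Ev : V →ₗ[ℝ] (Fin N × Fin r → ℝ) :=
    { toFun := fun φ j => (φ : ℝ → ℝ) (evalPoint L N r j)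
      map_add' := fun _ _ => rfl
      map_smul' := fun _ _ => rfl }
  have hEv : Function.Injective Ev := by
    rw [injective_iff_map_eq_zero]
    intro φ hφ
    have hcell : ∀ i < N, ∀ x ∈ Icc (node L N i) (node L N (i + 1)), (φ : ℝ → ℝ) x = 0 := by
      intro i hi x hx
      obtain ⟨p, hp, hpe⟩ := hS.poly _ φ.2.1 i hi
      have hp0 : p = 0 := by
        refine Polynomial.eq_zero_of_natDegree_lt_card_of_eval_eq_zero p
          (f := fun k : Fin r => evalPoint L N r (⟨i, hi⟩, k)) ?_ ?_ ?_
        · intro k l hkl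
          have hr0 : (r : ℝ) ≠ 0 := by positivity
          simp only [evalPoint, add_right_inj, mul_eq_mul_left_iff, hh.ne', or_false] at hkl
          rw [div_left_inj' hr0] at hkl
          exact Fin.ext (by exact_mod_cast hkl)
        · intro k
          rw [← hpe _ (evalPoint_mem_cell hL hN (⟨i, hi⟩, k))]
          exact congrFun hφ (⟨i, hi⟩, k)
        · rw [Fintype.card_fin]; omega
      rw [hpe x hx, hp0, Polynomial.eval_zero]
    ext x
    change (φ : ℝ → ℝ) x = 0
    by_cases hx : x ∈ dom L
    · rcases lt_or_eq_of_le hx.2 with h | h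
      · obtain ⟨i, hi, hxi⟩ := exists_cell hL hN ⟨hx.1, h⟩
        exact hcell i hi x (Ico_subset_Icc_self hxi)
      -- The point `L` lies in no half-open cell; the last closed cell contains it.
      · refine hcell (N - 1) (by omega) x ?_
        have e1 : N - 1 + 1 = N := by omega
        have := node_lt_succ hL hN (N - 1)
        rw [e1, node_last hN] at *
        rw [h]; exact ⟨this.le, le_rfl⟩
    · exact φ.2.2 x hx
  have : FiniteDimensional ℝ V := Module.Finite.of_injective Ev hEv
  -- `G` recovers a function from its point values. Through it each coordinate becomes a fixed
  -- linear combination of point values, so that continuity and differentiability in time, assumed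
  -- pointwise in `x`, pass to the coordinates.
  obtain ⟨G, hG⟩ := LinearMap.exists_leftInverse_of_injective Ev (LinearMap.ker_eq_bot.2 hEv)
  have hlip : ∀ φ : V, Lip L (φ : ℝ → ℝ) := fun φ => hS.lip _ φ.2.1
  let B : LinearMap.BilinForm ℝ V := LinearMap.mk₂ ℝ (fun φ ψ => bilin L q φ ψ)
    (fun a b c => bilin_add_left hL q (hlip a) (hlip b) (hlip c))
    (fun c a b => bilin_smul_left hL q c a b)
    (fun a b c => by
      rw [bilin_comm, bilin_comm q (a : ℝ → ℝ) b, bilin_comm q (a : ℝ → ℝ) c]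
      exact bilin_add_left hL q (hlip b) (hlip c) (hlip a))
    (fun c a b => by
      rw [bilin_comm, bilin_comm q (a : ℝ → ℝ) b]
      exact bilin_smul_left hL q c b a)
  have hBapp : ∀ φ ψ : V, B φ ψ = bilin L q φ ψ := fun _ _ => rfl
  have hBsymm : LinearMap.IsSymm B := ⟨fun φ ψ => by
    simp only [hBapp, RingHom.id_apply]; exact bilin_comm _ _ _⟩
  have hBpos : ∀ φ : V, φ ≠ 0 → 0 < B φ φ := by
    intro φ hφ
    by_contra! hc
    apply hφ
    rw [hBapp, bilin_self hL, normL2_sq hL] at hc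
    have h0 : ip L (φ : ℝ → ℝ) φ = 0 := by
      have := ip_self_nonneg hL (φ : ℝ → ℝ)
      have := mul_nonneg hq (sq_nonneg (normL2 L (deriv (φ : ℝ → ℝ))))
      linarith
    ext x
    change (φ : ℝ → ℝ) x = 0
    by_cases hx : x ∈ dom L
    · exact ip_self_eq_zero hL (hlip φ).continuousOn h0 x hx
    · exact φ.2.2 x hx
  obtain ⟨u, hu⟩ := LinearMap.BilinForm.exists_orthogonal_basis hBsymm
  have hupos : ∀ i, 0 < B (u i) (u i) := fun i => hBpos _ (u.ne_zero i)
  have hoff : ∀ i j, i ≠ j → B (u i) (u j) = 0 := fun i j hij => hu hij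
  set s : Fin (Module.finrank ℝ V) → ℝ := fun i => (√(B (u i) (u i)))⁻¹ with hs
  have hs2 : ∀ i, s i * s i * B (u i) (u i) = 1 := fun i => by
    have h1 := Real.mul_self_sqrt (hupos i).le
    have h2 : √(B (u i) (u i)) ≠ 0 := (Real.sqrt_pos.2 (hupos i)).ne'
    simp only [hs]
    rw [← mul_inv, h1, inv_mul_cancel₀ (hupos i).ne']
  refine ⟨Module.finrank ℝ V, fun i => ((s i • u i : V) : ℝ → ℝ), ?_, ?_, ?_, ?_⟩
  · exact fun i => (s i • u i : V).2.1
  · intro i j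
    rw [← hBapp]
    simp only [map_smul, LinearMap.smul_apply, smul_eq_mul]
    split_ifs with hij
    · rw [← hij, ← hs2 i]; ring
    · rw [hoff i j hij]; ring
  · intro φ hφ x hx
    set φ' : V := ⟨(dom L).indicator φ, hS.indicator_mem hφ⟩ with hφ'
    have hEq : EqOn φ (φ' : ℝ → ℝ) (dom L) := fun y hy => (indicator_of_mem hy φ).symm
    have hcoef : ∀ i, bilin L q φ ((s i • u i : V) : ℝ → ℝ) * s i = u.repr φ' i := by
      intro i
      rw [bilin_congr hL q hEq (eqOn_refl _ _), ← hBapp, map_smul, smul_eq_mul]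
      have : B φ' (u i) = u.repr φ' i * B (u i) (u i) := by
        conv_lhs => rw [← u.sum_repr φ', map_sum, LinearMap.sum_apply]
        rw [Finset.sum_eq_single i]
        · simp
        · intro j _ hj
          rw [map_smul, LinearMap.smul_apply, hoff j i hj, smul_zero]
        · simp
      rw [this]
      calc _ = u.repr φ' i * (s i * s i * B (u i) (u i)) := by ring
        _ = _ := by rw [hs2, mul_one]
    have h1 : (φ' : ℝ → ℝ) x = ∑ i, u.repr φ' i * (u i : ℝ → ℝ) x := by
      have h2 := congrArg (fun ψ : V => (ψ : ℝ → ℝ) x) (u.sum_repr φ')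
      simp only [Submodule.coe_sum, Finset.sum_apply, Submodule.coe_smul, Pi.smul_apply,
        smul_eq_mul] at h2
      exact h2.symm
    rw [hEq hx, h1]
    refine Finset.sum_congr rfl fun i _ => ?_
    rw [← hcoef i, Submodule.coe_smul, Pi.smul_apply, smul_eq_mul, mul_assoc]
  · intro i
    refine ⟨Fin N × Fin r, inferInstance, evalPoint L N r,
      fun j => B (G (Pi.single j 1)) (s i • u i), fun j => ?_, fun φ hφ => ?_⟩
    · exact cell_subset_dom hL hN j.1.2 (evalPoint_mem_cell hL hN j)
    · set φ' : V := ⟨(dom L).indicator φ, hS.indicator_mem hφ⟩ with hφ'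
      have hEq : EqOn φ (φ' : ℝ → ℝ) (dom L) := fun y hy => (indicator_of_mem hy φ).symm
      rw [bilin_congr hL q hEq (eqOn_refl _ _), ← hBapp]
      have h1 : φ' = G (Ev φ') := (LinearMap.congr_fun hG φ').symm
      have h2 : Ev φ' = ∑ j, Ev φ' j • (Pi.single j (1 : ℝ) : Fin N × Fin r → ℝ) := by
        ext k; simp [Finset.sum_apply, Pi.single_apply]
      conv_lhs => rw [h1, h2]
      rw [map_sum, map_sum, LinearMap.sum_apply]
      simp only [map_smul, LinearMap.smul_apply, smul_eq_mul]
      refine Finset.sum_congr rfl fun j _ => ?_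
      have h3 : Ev φ' j = φ (evalPoint L N r j) := (hEq (cell_subset_dom hL hN j.1.2 (evalPoint_mem_cell hL hN j))).symm
      rw [h3]; ring

end

noncomputable section

open MeasureTheory
open scoped NNReal ENNReal

variable {L : ℝ} {f g v w s : ℝ → ℝ} {N μ r : ℕ}

/-! ### Primitives -/

theorem BM.intervalIntegrable (hs : BM L s) {x y : ℝ} (hx : x ∈ dom L)
    (hy : y ∈ dom L) : IntervalIntegrable s volume x y := by
  rw [intervalIntegrable_iff]
  refine IntegrableOn.mono_set (BM.integrable hs) ?_
  rw [uIoc]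
  exact Ioc_subset_Ioc (le_min hx.1 hy.1) (max_le hx.2 hy.2)

theorem primitive_sub (hL : 0 < L) (hs : BM L s) {x y : ℝ} (hx : x ∈ dom L) (hy : y ∈ dom L) :
    (∫ t in (-L)..y, s t) - ∫ t in (-L)..x, s t = ∫ t in x..y, s t :=
  intervalIntegral.integral_interval_sub_left (hs.intervalIntegrable (left_mem_dom hL) hy)
    (hs.intervalIntegrable (left_mem_dom hL) hx)

theorem BM.exists_ae_le (hs : BM L s) : ∃ C, 0 ≤ C ∧ ∀ᵐ x ∂vol L, |s x| ≤ C := by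
  refine ⟨(eLpNormEssSup s (vol L)).toReal, ENNReal.toReal_nonneg, ?_⟩
  have h : eLpNormEssSup s (vol L) < ⊤ := by
    have := hs.2; rwa [eLpNorm_exponent_top] at this
  filter_upwards [ae_le_eLpNormEssSup (f := s) (μ := vol L)] with x hx
  rw [← ENNReal.toReal_le_toReal (by simp) h.ne] at hx
  simpa using hx

theorem primitive_lip (hL : 0 < L) (hs : BM L s) : Lip L (fun x => ∫ t in (-L)..x, s t) := by
  obtain ⟨C, -, hC⟩ := hs.exists_ae_le
  refine Lip.of_abs_le (K := C) fun x hx y hy => ?_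
  rw [primitive_sub hL hs hy hx]
  change ‖∫ t in y..x, s t‖ ≤ C * |x - y|
  refine intervalIntegral.norm_integral_le_of_norm_le_const_ae (f := s) ?_
  rw [vol, ae_restrict_iff' measurableSet_Ioc] at hC
  filter_upwards [hC] with t ht ht'
  refine ht ?_
  rw [uIoc] at ht'
  exact ⟨(le_min hy.1 hx.1).trans_lt ht'.1, ht'.2.trans (max_le hy.2 hx.2)⟩

theorem primitive_deriv (hL : 0 < L) (hs : BM L s) :
    deriv (fun x => ∫ t in (-L)..x, s t) =ᵐ[vol L] s := by
  have h := (hs.intervalIntegrable (left_mem_dom hL) (right_mem_dom hL)).ae_hasDerivAt_integral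
  filter_upwards [ae_restrict_of_ae h, ae_mem_Ioo] with x hx hx'
  refine (hx ?_ (-L) ?_).deriv
  · rw [uIcc_dom hL]; exact Ioo_subset_dom hx'
  · rw [uIcc_dom hL]; exact left_mem_dom hL

theorem primitive_hasDerivWithinAt (hL : 0 < L) (hs : ContinuousOn s (dom L)) {x : ℝ}
    (hx : x ∈ dom L) : HasDerivWithinAt (fun x => ∫ t in (-L)..x, s t) (s x) (dom L) x := by
  have hle : -L ≤ L := by linarith
  -- The constant continuous extension makes the two-sided fundamental theorem applicable at the end
  -- points as well.
  set s' := IccExtend hle (domRestrict (Icc (-L) L) s) with hs'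
  have hc : Continuous s' := (continuousOn_iff_continuous_domRestrict.1 hs).Icc_extend'
  have he : EqOn s' s (dom L) := fun y hy => IccExtend_of_mem hle (domRestrict (Icc (-L) L) s) hy
  have h1 : HasDerivAt (fun x => ∫ t in (-L)..x, s' t) (s' x) x :=
    intervalIntegral.integral_hasDerivAt_right (hc.intervalIntegrable _ _)
      (hc.stronglyMeasurableAtFilter _ _) hc.continuousAt
  rw [he hx] at h1
  refine h1.hasDerivWithinAt.congr (fun y hy => ?_) ?_
  · refine intervalIntegral.integral_congr fun t ht => ?_
    rw [uIcc_of_le hy.1] at ht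
    exact (he ⟨ht.1, ht.2.trans hy.2⟩).symm
  · refine intervalIntegral.integral_congr fun t ht => ?_
    rw [uIcc_of_le hx.1] at ht
    exact (he ⟨ht.1, ht.2.trans hx.2⟩).symm

/-! ### Smooth splines -/

/-- Splines of degree `k` and smoothness `k - 1` on the uniform grid. -/
def Sp (L : ℝ) (N : ℕ) : ℕ → Set (ℝ → ℝ)
  | 0 => {s | ∃ c : ℤ → ℝ, ∀ x ∈ Ico (-L) L, s x = c ⌊(x + L) / meshSize L N⌋}
  | k + 1 => {s | ∃ s' ∈ Sp L N k, ∃ c : ℝ, ∀ x ∈ dom L, s x = c + ∫ t in (-L)..x, s' t}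

theorem floor_of_mem_cell (hL : 0 < L) (hN : 1 ≤ N) {i : ℕ} {x : ℝ}
    (hx : x ∈ Ico (node L N i) (node L N (i + 1))) : ⌊(x + L) / meshSize L N⌋ = i := by
  have hh := meshSize_pos hL hN
  rw [Int.floor_eq_iff, le_div_iff₀ hh, div_lt_iff₀ hh]
  have h1 := hx.1
  have h2 := hx.2
  simp only [node] at h1 h2
  push_cast at h1 h2 ⊢
  constructor <;> linarith

theorem exists_antiderivative (p : Polynomial ℝ) :
    ∃ q : Polynomial ℝ, q.derivative = p ∧ q.natDegree ≤ p.natDegree + 1 := by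
  refine ⟨∑ n ∈ Finset.range (p.natDegree + 1),
    Polynomial.C (p.coeff n / (n + 1)) * Polynomial.X ^ (n + 1), ?_, ?_⟩
  · conv_rhs => rw [p.as_sum_range_C_mul_X_pow]
    rw [Polynomial.derivative_sum]
    refine Finset.sum_congr rfl fun n _ => ?_
    rw [Polynomial.derivative_C_mul_X_pow, Nat.add_sub_cancel]
    congr 2
    have : (n : ℝ) + 1 ≠ 0 := by positivity
    push_cast
    field_simp
  · refine Polynomial.natDegree_sum_le_of_forall_le _ _ fun n hn => ?_
    refine (Polynomial.natDegree_C_mul_X_pow_le _ _).trans ?_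
    have := Finset.mem_range.1 hn
    omega

theorem Sp.bm (hL : 0 < L) (hN : 1 ≤ N) : ∀ {k : ℕ} {s : ℝ → ℝ}, s ∈ Sp L N k → BM L s
  | 0, s, hs => by
    obtain ⟨c, hc⟩ := hs
    have hmeas : Measurable fun x : ℝ => c ⌊(x + L) / meshSize L N⌋ :=
      (measurable_from_top (f := c)).comp (Int.measurable_floor.comp (by fun_prop))
    refine BM.congr (f := fun x : ℝ => c ⌊(x + L) / meshSize L N⌋) ?_
      (ae_eq_of_Ioo fun x hx => (hc x (Ioo_subset_Ico_self hx)).symm)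
    refine BM.of_bound (C := ∑ i ∈ Finset.range N, |c i|) hmeas.aestronglyMeasurable ?_
    filter_upwards [ae_mem_Ioo] with x hx
    obtain ⟨i, hi, hxi⟩ := exists_cell hL hN (Ioo_subset_Ico_self hx)
    rw [floor_of_mem_cell hL hN hxi]
    exact Finset.single_le_sum (f := fun i : ℕ => |c i|) (fun j _ => abs_nonneg _)
      (Finset.mem_range.2 hi)
  | k + 1, s, hs => by
    obtain ⟨s', hs', c, hc⟩ := hs
    exact (((Lip.const c).add (primitive_lip hL (Sp.bm hL hN hs'))).congr
      fun x hx => (hc x hx).symm).bm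

theorem Sp.lip (hL : 0 < L) (hN : 1 ≤ N) {k : ℕ} (hs : s ∈ Sp L N (k + 1)) : Lip L s := by
  obtain ⟨s', hs', c, hc⟩ := hs
  exact ((Lip.const c).add (primitive_lip hL (Sp.bm hL hN hs'))).congr fun x hx => (hc x hx).symm

theorem Sp.add (hL : 0 < L) (hN : 1 ≤ N) : ∀ {k : ℕ} {s₁ s₂ : ℝ → ℝ}, s₁ ∈ Sp L N k →
    s₂ ∈ Sp L N k → (fun x => s₁ x + s₂ x) ∈ Sp L N k
  | 0, s₁, s₂, h₁, h₂ => by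
    obtain ⟨c₁, hc₁⟩ := h₁
    obtain ⟨c₂, hc₂⟩ := h₂
    exact ⟨fun i => c₁ i + c₂ i, fun x hx => by simp only [hc₁ x hx, hc₂ x hx]⟩
  | k + 1, s₁, s₂, h₁, h₂ => by
    obtain ⟨t₁, ht₁, c₁, hc₁⟩ := h₁
    obtain ⟨t₂, ht₂, c₂, hc₂⟩ := h₂
    refine ⟨_, Sp.add hL hN ht₁ ht₂, c₁ + c₂, fun x hx => ?_⟩
    rw [intervalIntegral.integral_add ((Sp.bm hL hN ht₁).intervalIntegrable (left_mem_dom hL) hx)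
      ((Sp.bm hL hN ht₂).intervalIntegrable (left_mem_dom hL) hx)]
    simp only [hc₁ x hx, hc₂ x hx]; ring

theorem Sp.smul (a : ℝ) : ∀ {k : ℕ} {s : ℝ → ℝ}, s ∈ Sp L N k →
    (fun x => a * s x) ∈ Sp L N k
  | 0, s, h => by
    obtain ⟨c, hc⟩ := h
    exact ⟨fun i => a * c i, fun x hx => by simp only [hc x hx]⟩
  | k + 1, s, h => by
    obtain ⟨t, ht, c, hc⟩ := h
    refine ⟨_, Sp.smul a ht, a * c, fun x hx => ?_⟩
    simp only [intervalIntegral.integral_const_mul, hc x hx]; ring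

theorem Sp.poly (hL : 0 < L) (hN : 1 ≤ N) : ∀ {k : ℕ} {s : ℝ → ℝ}, s ∈ Sp L N k → ∀ i < N,
    ∃ p : Polynomial ℝ, p.natDegree ≤ k ∧
      ∀ x ∈ Ico (node L N i) (node L N (i + 1)), s x = p.eval x
  | 0, s, h, i, hi => by
    obtain ⟨c, hc⟩ := h
    refine ⟨Polynomial.C (c i), by simp, fun x hx => ?_⟩
    have h1 := node_mem_dom hL hN hi.le
    have h2 := node_mem_dom hL hN (Nat.succ_le_of_lt hi)
    rw [hc x ⟨h1.1.trans hx.1, hx.2.trans_le h2.2⟩, floor_of_mem_cell hL hN hx, Polynomial.eval_C]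
  | k + 1, s, h, i, hi => by
    obtain ⟨t, ht, c, hc⟩ := h
    obtain ⟨p, hp, hpe⟩ := Sp.poly hL hN ht i hi
    obtain ⟨q, hq, hqd⟩ := exists_antiderivative p
    have hbm := Sp.bm hL hN ht
    have h1 := node_mem_dom hL hN hi.le
    have h2 := node_mem_dom hL hN (Nat.succ_le_of_lt hi)
    refine ⟨q + Polynomial.C (c + (∫ t' in (-L)..node L N i, t t') - q.eval (node L N i)),
      Polynomial.natDegree_add_le_of_degree_le (hqd.trans (by omega)) (by simp),
      fun x hx => ?_⟩
    have hxd : x ∈ dom L := ⟨h1.1.trans hx.1, hx.2.le.trans h2.2⟩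
    rw [hc x hxd, Polynomial.eval_add, Polynomial.eval_C]
    have e1 := primitive_sub hL hbm h1 hxd
    have e2 : ∫ t' in node L N i..x, t t' = ∫ t' in node L N i..x, p.eval t' := by
      refine intervalIntegral.integral_congr fun y hy => ?_
      rw [uIcc_of_le hx.1] at hy
      exact hpe y ⟨hy.1, hy.2.trans_lt hx.2⟩
    have e3 : ∫ t' in node L N i..x, p.eval t' = q.eval x - q.eval (node L N i) := by
      refine intervalIntegral.integral_eq_sub_of_hasDerivAt (f := fun y => q.eval y)
        (f' := fun y => p.eval y) (fun y _ => ?_) ((Polynomial.continuous p).intervalIntegrable _ _)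
      rw [← hq]; exact q.hasDerivAt y
    rw [e2, e3] at e1
    linarith

theorem uniqueDiffOn_dom (hL : 0 < L) : UniqueDiffOn ℝ (dom L) :=
  uniqueDiffOn_Icc (by linarith)

theorem Sp.contDiffOn (hL : 0 < L) (hN : 1 ≤ N) : ∀ {k : ℕ} {s : ℝ → ℝ}, s ∈ Sp L N (k + 1) →
    ContDiffOn ℝ k s (dom L)
  | 0, s, h => by
    rw [Nat.cast_zero, contDiffOn_zero]
    exact (Sp.lip hL hN h).continuousOn
  | k + 1, s, h => by
    obtain ⟨t, ht, c, hc⟩ := h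
    have ih := Sp.contDiffOn hL hN ht
    have hd : ∀ x ∈ dom L, HasDerivWithinAt s (t x) (dom L) x := fun x hx =>
      ((primitive_hasDerivWithinAt hL ih.continuousOn hx).const_add c).congr hc (hc x hx)
    have e : ((k + 1 : ℕ) : WithTop ℕ∞) = (k : WithTop ℕ∞) + 1 := by push_cast; rfl
    rw [e, contDiffOn_succ_iff_derivWithin (uniqueDiffOn_dom hL)]
    refine ⟨fun x hx => (hd x hx).differentiableWithinAt, fun h => by simp at h, ?_⟩
    exact ih.congr fun x hx => (hd x hx).derivWithin (uniqueDiffOn_dom hL x hx)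

/-- With `r = k + 2` the splines of maximal smoothness lie in `S_h` for every admissible `μ`, so it
suffices to approximate by them. Continuity extends the polynomial representation from the half-open
to the closed cell. -/
theorem Sp.mem_femSpace (hL : 0 < L) (hN : 1 ≤ N) {k : ℕ} (hμ : μ ≤ k) (hs : s ∈ Sp L N (k + 1)) :
    s ∈ femSpace L N μ (k + 2) := by
  refine ⟨(Sp.contDiffOn hL hN hs).of_le (by exact_mod_cast hμ), fun i hi => ?_⟩
  obtain ⟨p, hp, hpe⟩ := Sp.poly hL hN hs i hi
  refine ⟨p, hp, ?_⟩
  have hlt := node_lt_succ hL hN i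
  have hcl : closure (Ico (node L N i) (node L N (i + 1)))
      = Icc (node L N i) (node L N (i + 1)) := closure_Ico hlt.ne
  have hc : ContinuousOn s (Icc (node L N i) (node L N (i + 1))) :=
    (Sp.lip hL hN hs).continuousOn.mono (cell_subset_dom hL hN hi)
  intro x hx
  have : EqOn s (fun x => p.eval x) (Icc (node L N i) (node L N (i + 1))) :=
    Set.EqOn.of_subset_closure hpe hc (Polynomial.continuous _).continuousOn
      Ico_subset_Icc_self hcl.ge
  exact this hx

/-! ### Cardinal spline operators -/

/-- The cardinal spline `∑ j, c j * B_k (x - j)`, with `B_k` the B-spline of degree `k` with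
support `[0, k + 1]`. -/
def cardinalSpline : ℕ → (ℤ → ℝ) → ℝ → ℝ
  | 0, c, x => c ⌊x⌋
  | k + 1, c, x => ∫ y in (x - 1)..x, cardinalSpline k c y

/-- The value at `x` is an average of the coefficients with index from `⌊x⌋ - k` to `⌊x⌋`. Each
averaging over `[x - 1, x]` preserves the bound and reaches one index further to the left;
positivity and the partition of unity are thus never needed explicitly. -/
theorem cardinalSpline_abs_sub_le (k : ℕ) (c : ℤ → ℝ) {x m G : ℝ}
    (hi : ∀ k' < k, ∀ a b : ℝ, IntervalIntegrable (cardinalSpline k' c) volume a b)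
    (h : ∀ j : ℤ, ⌊x⌋ - k ≤ j → j ≤ ⌊x⌋ → |c j - m| ≤ G) : |cardinalSpline k c x - m| ≤ G := by
  induction k generalizing x with
  | zero => exact h _ (by simp) le_rfl
  | succ k ih =>
    have h1 : cardinalSpline (k + 1) c x - m = ∫ y in (x - 1)..x, (cardinalSpline k c y - m) := by
      rw [intervalIntegral.integral_sub (hi k (by omega) _ _) (by simp)]
      simp [cardinalSpline]
    rw [h1]
    have h2 := intervalIntegral.norm_integral_le_of_norm_le_const (a := x - 1) (b := x) (C := G)
      (f := fun y => cardinalSpline k c y - m) ?_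
    · simpa using h2
    · intro y hy
      rw [uIoc_of_le (by linarith)] at hy
      have f1 : ⌊x⌋ - 1 ≤ ⌊y⌋ := by
        have := Int.floor_mono hy.1.le
        rwa [Int.floor_sub_one] at this
      have f2 : ⌊y⌋ ≤ ⌊x⌋ := Int.floor_mono hy.2
      refine ih (fun k' hk' => hi k' (by omega)) fun j h1 h2 => h j ?_ ?_
      · push_cast; omega
      · omega

theorem cardinalSpline_intervalIntegrable (k : ℕ) (c : ℤ → ℝ) (a b : ℝ) :
    IntervalIntegrable (cardinalSpline k c) volume a b := by
  induction k generalizing a b with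
  | zero =>
    have hmeas : Measurable fun x : ℝ => c ⌊x⌋ :=
      (measurable_from_top (f := c)).comp Int.measurable_floor
    rw [intervalIntegrable_iff]
    refine IntegrableOn.of_bound (by simp [uIoc]) hmeas.aestronglyMeasurable
      (∑ j ∈ Finset.Icc ⌊min a b⌋ ⌊max a b⌋, |c j|) ?_
    refine (ae_restrict_iff' measurableSet_uIoc).2 (ae_of_all _ fun x hx => ?_)
    refine Finset.single_le_sum (f := fun j => |c j|) (fun j _ => abs_nonneg _)
      (Finset.mem_Icc.2 ⟨Int.floor_mono hx.1.le, Int.floor_mono hx.2⟩)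
  | succ k ih =>
    refine Continuous.intervalIntegrable ?_ _ _
    have hP : Continuous fun x : ℝ => ∫ y in (0 : ℝ)..x, cardinalSpline k c y :=
      intervalIntegral.continuous_primitive ih 0
    have : cardinalSpline (k + 1) c = fun x => (∫ y in (0 : ℝ)..x, cardinalSpline k c y)
        - ∫ y in (0 : ℝ)..(x - 1), cardinalSpline k c y := by
      funext x
      rw [intervalIntegral.integral_interval_sub_left (ih _ _) (ih _ _)]; rfl
    rw [this]
    exact hP.sub (hP.comp (by fun_prop))

theorem cardinalSpline_local (k : ℕ) (c : ℤ → ℝ) {x m G : ℝ}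
    (h : ∀ j : ℤ, ⌊x⌋ - k ≤ j → j ≤ ⌊x⌋ → |c j - m| ≤ G) : |cardinalSpline k c x - m| ≤ G :=
  cardinalSpline_abs_sub_le k c (fun k' _ => cardinalSpline_intervalIntegrable k' c) h

theorem cardinalSpline_sub (k : ℕ) (c : ℤ → ℝ) (x : ℝ) :
    cardinalSpline k c x - cardinalSpline k c (x - 1)
      = cardinalSpline k (fun j => c j - c (j - 1)) x := by
  induction k generalizing x with
  | zero => simp only [cardinalSpline, Int.floor_sub_one]
  | succ k ih =>
    simp only [cardinalSpline, ← ih]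
    rw [intervalIntegral.integral_sub (cardinalSpline_intervalIntegrable k c _ _),
      intervalIntegral.integral_comp_sub_right]
    have h := (cardinalSpline_intervalIntegrable k c (x - 1 - 1) (x - 1)).comp_sub_right 1
    simpa using h

/-- Differentiation lowers the degree and replaces the coefficients by their backward differences.
The integrated form avoids differentiability at the knots. -/
theorem cardinalSpline_succ (k : ℕ) (c : ℤ → ℝ) (x : ℝ) :
    cardinalSpline (k + 1) c x = cardinalSpline (k + 1) c 0
      + ∫ y in (0 : ℝ)..x, cardinalSpline k (fun j => c j - c (j - 1)) y := by
  have hI := cardinalSpline_intervalIntegrable k c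
  simp only [← cardinalSpline_sub]
  rw [intervalIntegral.integral_sub (hI _ _), intervalIntegral.integral_comp_sub_right]
  · simp only [cardinalSpline]
    have h1 := intervalIntegral.integral_add_adjacent_intervals (hI (0 - 1) 0) (hI 0 x)
    have h2 := intervalIntegral.integral_add_adjacent_intervals (hI (0 - 1) (x - 1)) (hI (x - 1) x)
    linarith
  · have h := (hI (0 - 1) (x - 1)).comp_sub_right 1
    simpa using h

theorem cardinalSpline_scaled_succ (k : ℕ) (c : ℤ → ℝ) (x : ℝ) :
    cardinalSpline (k + 1) c ((x + L) / meshSize L N) = cardinalSpline (k + 1) c 0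
      + ∫ y in (-L)..x, (meshSize L N)⁻¹ *
          cardinalSpline k (fun j => c j - c (j - 1)) ((y + L) / meshSize L N) := by
  rw [cardinalSpline_succ, intervalIntegral.integral_const_mul]
  congr 1
  have := intervalIntegral.inv_smul_integral_comp_div_add (a := -L) (b := x)
    (cardinalSpline k (fun j => c j - c (j - 1))) (meshSize L N) (L / meshSize L N)
  simp only [← add_div, neg_add_cancel, zero_div, smul_eq_mul] at this
  exact this.symm

theorem cardinalSpline_mem_Sp (k : ℕ) (c : ℤ → ℝ) :
    (fun x => cardinalSpline k c ((x + L) / meshSize L N)) ∈ Sp L N k := by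
  induction k generalizing c with
  | zero => exact ⟨c, fun x _ => rfl⟩
  | succ k ih => exact ⟨_, Sp.smul _ (ih _), _, fun x _ => cardinalSpline_scaled_succ k c x⟩

theorem cardinalSpline_deriv (hL : 0 < L) (hN : 1 ≤ N) (k : ℕ) (c : ℤ → ℝ) :
    deriv (fun x => cardinalSpline (k + 1) c ((x + L) / meshSize L N)) =ᵐ[vol L]
      fun x => (meshSize L N)⁻¹ *
        cardinalSpline k (fun j => c j - c (j - 1)) ((x + L) / meshSize L N) := by
  have h := primitive_deriv hL (Sp.bm hL hN (Sp.smul (meshSize L N)⁻¹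
    (cardinalSpline_mem_Sp k fun j => c j - c (j - 1))))
  filter_upwards [h] with x hx
  rw [← hx]
  have : (fun x => cardinalSpline (k + 1) c ((x + L) / meshSize L N)) = fun x =>
      cardinalSpline (k + 1) c 0 + ∫ y in (-L)..x, (meshSize L N)⁻¹ *
          cardinalSpline k (fun j => c j - c (j - 1)) ((y + L) / meshSize L N) := by
    funext x; exact cardinalSpline_scaled_succ k c x
  rw [this, deriv_const_add]

end

noncomputable section

open MeasureTheory
open scoped NNReal ENNReal

variable {L : ℝ} {f g v w s Y : ℝ → ℝ} {N μ r : ℕ} {δ : ℤ → ℝ}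

/-! ### Quasi-interpolation -/

/-- The value of `Y` at the node `j`, constant for `j ≤ 0` and for `j ≥ N`. -/
def nodeVal (L : ℝ) (N : ℕ) (Y : ℝ → ℝ) (j : ℤ) : ℝ := Y (node L N (min j.toNat N))

/-- `δ l` bounds the oscillation of `Y` over the cell `l`. -/
structure IsModulus (L : ℝ) (N : ℕ) (Y : ℝ → ℝ) (δ : ℤ → ℝ) : Prop where
  nonneg : ∀ l, 0 ≤ δ l
  osc : ∀ i : ℕ, i < N → ∀ x ∈ Icc (node L N i) (node L N (i + 1)),
    ∀ y ∈ Icc (node L N i) (node L N (i + 1)), |Y x - Y y| ≤ δ i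

/-- The sum of `δ` over the `2 K + 1` cells around the cell `i`. -/
def nearSum (K : ℕ) (δ : ℤ → ℝ) (i : ℤ) : ℝ := ∑ l ∈ Finset.Icc (i - K) (i + K), δ l

theorem nearSum_nonneg (hδ : ∀ l, 0 ≤ δ l) (K : ℕ) (i : ℤ) : 0 ≤ nearSum K δ i :=
  Finset.sum_nonneg fun l _ => hδ l

theorem nearSum_le_nearSum (hδ : ∀ l, 0 ≤ δ l) {K K' : ℕ} {i j : ℤ} (h₁ : i - K ≤ j - K')
    (h₂ : j + K' ≤ i + K) : nearSum K' δ j ≤ nearSum K δ i :=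
  Finset.sum_le_sum_of_subset_of_nonneg (Finset.Icc_subset_Icc h₁ h₂) fun l _ _ => hδ l

theorem IsModulus.nodeVal_succ (h : IsModulus L N Y δ) (hL : 0 < L) (hN : 1 ≤ N) (j : ℤ) :
    |nodeVal L N Y (j + 1) - nodeVal L N Y j| ≤ δ j := by
  rcases lt_or_ge j 0 with hj | hj
  · have e1 : (j + 1).toNat = 0 := by omega
    have e2 : j.toNat = 0 := by omega
    simp only [nodeVal, e1, e2, sub_self, abs_zero]
    exact h.nonneg j
  · lift j to ℕ using hj
    have e1 : ((j : ℤ) + 1).toNat = j + 1 := by omega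
    have e2 : (j : ℤ).toNat = j := by omega
    simp only [nodeVal, e1, e2]
    rcases lt_or_ge j N with hjN | hjN
    · rw [min_eq_left hjN.le, min_eq_left (Nat.succ_le_of_lt hjN)]
      have hlt := (node_lt_succ hL hN j).le
      exact h.osc j hjN _ ⟨hlt, le_rfl⟩ _ ⟨le_rfl, hlt⟩
    · rw [min_eq_right hjN, min_eq_right (by omega), sub_self, abs_zero]
      exact h.nonneg j

theorem IsModulus.nodeVal_le_sum (h : IsModulus L N Y δ) (hL : 0 < L) (hN : 1 ≤ N) {a b : ℤ}
    (hab : a ≤ b) : |nodeVal L N Y b - nodeVal L N Y a| ≤ ∑ l ∈ Finset.Ico a b, δ l := by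
  induction b, hab using Int.leInduction with
  | base => simp
  | succ b hab ih =>
    have e : Finset.Ico a (b + 1) = insert b (Finset.Ico a b) := by
      ext l; simp only [Finset.mem_Ico, Finset.mem_insert]; omega
    rw [e, Finset.sum_insert (by simp)]
    have h1 := h.nodeVal_succ hL hN b
    have h2 := abs_sub_le (nodeVal L N Y (b + 1)) (nodeVal L N Y b) (nodeVal L N Y a)
    linarith

theorem IsModulus.nodeVal_sub_le (h : IsModulus L N Y δ) (hL : 0 < L) (hN : 1 ≤ N) {a b i : ℤ}
    {K : ℕ} (ha : i - K ≤ a) (ha' : a ≤ i + K + 1) (hb : i - K ≤ b) (hb' : b ≤ i + K + 1) :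
    |nodeVal L N Y b - nodeVal L N Y a| ≤ nearSum K δ i := by
  wlog hab : a ≤ b generalizing a b
  · rw [abs_sub_comm]; exact this hb hb' ha ha' (le_of_not_ge hab)
  refine (h.nodeVal_le_sum hL hN hab).trans ?_
  refine Finset.sum_le_sum_of_subset_of_nonneg (fun l hl => ?_) fun l _ _ => h.nonneg l
  rw [Finset.mem_Ico] at hl
  rw [Finset.mem_Icc]
  constructor <;> omega

/-- The coefficients may differ from the nodal values by a local oscillation, which leaves room to
alter them near an end point. The factor 2 counts this deviation and the oscillation between the
nodes `j` and `i`. -/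
theorem IsModulus.coeff_sub_le (h : IsModulus L N Y δ) (hL : 0 < L) (hN : 1 ≤ N) {c : ℤ → ℝ}
    {K₀ k : ℕ} (hc : ∀ j, |c j - nodeVal L N Y j| ≤ nearSum K₀ δ j) {i j : ℤ}
    (h₁ : i - (k + 1) ≤ j) (h₂ : j ≤ i + (k + 1)) :
    |c j - nodeVal L N Y i| ≤ 2 * nearSum (K₀ + k + 1) δ i := by
  have e1 := (hc j).trans (nearSum_le_nearSum h.nonneg (K := K₀ + k + 1) (i := i)
    (by push_cast; omega) (by push_cast; omega))
  have e2 := h.nodeVal_sub_le hL hN (a := i) (b := j) (i := i) (K := K₀ + k + 1)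
    (by push_cast; omega) (by push_cast; omega) (by push_cast; omega) (by push_cast; omega)
  have := abs_sub_le (c j) (nodeVal L N Y j) (nodeVal L N Y i)
  linarith

/-- Averages reproduce constants, so on each cell the error is governed by the oscillation of `Y`
nearby: twice for the coefficients and once more for `Y` on the cell itself. -/
theorem IsModulus.abs_cardinalSpline_sub_le (h : IsModulus L N Y δ) (hL : 0 < L) (hN : 1 ≤ N)
    {c : ℤ → ℝ} {K₀ k : ℕ} (hc : ∀ j, |c j - nodeVal L N Y j| ≤ nearSum K₀ δ j) {i : ℕ}
    (hi : i < N) {x : ℝ} (hx : x ∈ Ico (node L N i) (node L N (i + 1))) :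
    |Y x - cardinalSpline k c ((x + L) / meshSize L N)| ≤ 3 * nearSum (K₀ + k + 1) δ i := by
  have e1 : |cardinalSpline k c ((x + L) / meshSize L N) - nodeVal L N Y i|
      ≤ 2 * nearSum (K₀ + k + 1) δ i := by
    refine cardinalSpline_local k c fun j h1 h2 => ?_
    rw [floor_of_mem_cell hL hN hx] at h1 h2
    exact h.coeff_sub_le hL hN hc (by omega) (by omega)
  have e2 : |Y x - nodeVal L N Y i| ≤ δ i := by
    have : nodeVal L N Y i = Y (node L N i) := by
      rw [nodeVal, Int.toNat_natCast, min_eq_left hi.le]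
    rw [this]
    exact h.osc i hi x (Ico_subset_Icc_self hx) _ ⟨le_rfl, (node_lt_succ hL hN i).le⟩
  have e3 : δ i ≤ nearSum (K₀ + k + 1) δ i :=
    Finset.single_le_sum (f := δ) (fun l _ => h.nonneg l)
      (Finset.mem_Icc.2 ⟨by push_cast; omega, by push_cast; omega⟩)
  have := abs_sub_le (Y x) (nodeVal L N Y i) (cardinalSpline k c ((x + L) / meshSize L N))
  rw [abs_sub_comm (nodeVal L N Y i)] at this
  linarith

theorem IsModulus.abs_cardinalSpline_diff_le (h : IsModulus L N Y δ) (hL : 0 < L) (hN : 1 ≤ N)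
    {c : ℤ → ℝ} {K₀ k : ℕ} (hc : ∀ j, |c j - nodeVal L N Y j| ≤ nearSum K₀ δ j) {i : ℕ}
    {x : ℝ} (hx : x ∈ Ico (node L N i) (node L N (i + 1))) :
    |cardinalSpline k (fun j => c j - c (j - 1)) ((x + L) / meshSize L N)|
      ≤ 4 * nearSum (K₀ + k + 1) δ i := by
  rw [← sub_zero (cardinalSpline _ _ _)]
  refine cardinalSpline_local k _ fun j h1 h2 => ?_
  rw [floor_of_mem_cell hL hN hx] at h1 h2
  have e1 := h.coeff_sub_le hL hN hc (i := i) (j := j) (k := k) (by omega) (by omega)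
  have e2 := h.coeff_sub_le hL hN hc (i := i) (j := j - 1) (k := k) (by omega) (by omega)
  have := abs_sub_le (c j) (nodeVal L N Y i) (c (j - 1))
  rw [abs_sub_comm (nodeVal L N Y i)] at this
  rw [sub_zero]
  linarith

/-- One factor `2 * K + 1` is Cauchy-Schwarz for the terms of `nearSum`. The other counts the
translates of the sum, each of which is at most the full sum because `δ` vanishes off the grid. -/
theorem sum_nearSum_sq_le (K N : ℕ) (hout : ∀ l : ℤ, l < 0 ∨ (N : ℤ) ≤ l → δ l = 0) :
    ∑ i ∈ Finset.range N, nearSum K δ i ^ 2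
      ≤ (2 * K + 1) ^ 2 * ∑ l ∈ Finset.range N, δ l ^ 2 := by
  have hcard : ∀ i : ℤ, ((Finset.Icc (i - K) (i + K)).card : ℝ) = 2 * K + 1 := fun i => by
    rw [Int.card_Icc]
    have : (i + K + 1 - (i - K)).toNat = 2 * K + 1 := by omega
    rw [this]; push_cast; ring
  have h1 : ∀ i : ℕ, nearSum K δ i ^ 2
      ≤ (2 * K + 1) * ∑ l ∈ Finset.Icc ((i : ℤ) - K) (i + K), δ l ^ 2 := fun i => by
    rw [← hcard i]; exact sq_sum_le_card_mul_sum_sq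
  have h2 : ∀ i : ℕ, ∑ l ∈ Finset.Icc ((i : ℤ) - K) (i + K), δ l ^ 2
      = ∑ t ∈ Finset.Icc (-K : ℤ) K, δ (i + t) ^ 2 := fun i => by
    refine Finset.sum_bij' (fun l _ => l - i) (fun t _ => i + t) ?_ ?_ ?_ ?_ ?_
    · intro l hl; rw [Finset.mem_Icc] at *; constructor <;> omega
    · intro l hl; rw [Finset.mem_Icc] at *; constructor <;> omega
    · intro l _; simp
    · intro l _; simp
    · intro l _; simp
  have h3 : ∀ t : ℤ, ∑ i ∈ Finset.range N, δ ((i : ℤ) + t) ^ 2 ≤ ∑ l ∈ Finset.range N, δ l ^ 2 := by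
    intro t
    have e1 : ∑ i ∈ Finset.range N, δ ((i : ℤ) + t) ^ 2
        = ∑ l ∈ Finset.Ico t (N + t), δ l ^ 2 := by
      refine Finset.sum_bij' (fun i _ => (i : ℤ) + t) (fun l _ => (l - t).toNat) ?_ ?_ ?_ ?_ ?_
      · intro l hl; rw [Finset.mem_range] at hl; rw [Finset.mem_Ico]; constructor <;> omega
      · intro l hl; rw [Finset.mem_Ico] at hl; rw [Finset.mem_range]; omega
      · intro l _; simp
      · intro l hl; rw [Finset.mem_Ico] at hl; omega
      · intro l _; rfl
    have e2 : ∑ l ∈ Finset.range N, δ (l : ℤ) ^ 2 = ∑ l ∈ Finset.Ico (0 : ℤ) N, δ l ^ 2 := by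
      refine Finset.sum_bij' (fun i _ => (i : ℤ)) (fun l _ => l.toNat) ?_ ?_ ?_ ?_ ?_
      · intro l hl; rw [Finset.mem_range] at hl; rw [Finset.mem_Ico]; constructor <;> omega
      · intro l hl; rw [Finset.mem_Ico] at hl; rw [Finset.mem_range]; omega
      · intro l _; simp
      · intro l hl; rw [Finset.mem_Ico] at hl; omega
      · intro l _; rfl
    rw [e1, e2, ← Finset.sum_filter_add_sum_filter_not (Finset.Ico t (N + t))
      (fun l => 0 ≤ l ∧ l < N)]
    have e3 : ∑ l ∈ Finset.Ico t (N + t) with ¬(0 ≤ l ∧ l < (N : ℤ)), δ l ^ 2 = 0 := by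
      refine Finset.sum_eq_zero fun l hl => ?_
      rw [hout l (by have := (Finset.mem_filter.1 hl).2; omega)]; simp
    rw [e3, add_zero]
    refine Finset.sum_le_sum_of_subset_of_nonneg (fun l hl => ?_) fun _ _ _ => sq_nonneg _
    have := (Finset.mem_filter.1 hl).2
    exact Finset.mem_Ico.2 this
  calc ∑ i ∈ Finset.range N, nearSum K δ i ^ 2
      ≤ ∑ i ∈ Finset.range N, (2 * K + 1) * ∑ t ∈ Finset.Icc (-K : ℤ) K, δ (i + t) ^ 2 :=
        Finset.sum_le_sum fun i _ => by rw [← h2]; exact h1 i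
    _ = (2 * K + 1) * ∑ t ∈ Finset.Icc (-K : ℤ) K, ∑ i ∈ Finset.range N, δ ((i : ℤ) + t) ^ 2 := by
        rw [← Finset.mul_sum, Finset.sum_comm]
    _ ≤ (2 * K + 1) * ∑ t ∈ Finset.Icc (-K : ℤ) K, ∑ l ∈ Finset.range N, δ l ^ 2 := by
        exact mul_le_mul_of_nonneg_left (Finset.sum_le_sum fun t _ => h3 t) (by positivity)
    _ = (2 * K + 1) ^ 2 * ∑ l ∈ Finset.range N, δ l ^ 2 := by
        have := hcard 0
        simp only [zero_sub, zero_add] at this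
        rw [Finset.sum_const, nsmul_eq_mul, this]; ring

theorem normL2_sq_le_of_nearSum (hL : 0 < L) (hN : 1 ≤ N) {K : ℕ} {A : ℝ} (hf : BM L f)
    (hout : ∀ l : ℤ, l < 0 ∨ (N : ℤ) ≤ l → δ l = 0)
    (h : ∀ i < N, ∀ᵐ x ∂vol L, x ∈ Ioo (node L N i) (node L N (i + 1)) →
      |f x| ≤ A * nearSum K δ i) :
    normL2 L f ^ 2
      ≤ (A * (2 * K + 1)) ^ 2 * (meshSize L N * ∑ l ∈ Finset.range N, δ l ^ 2) := by
  have hh := meshSize_pos hL hN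
  have h1 : normL2 L f ^ 2 ≤ ∑ i ∈ Finset.range N, meshSize L N * (A * nearSum K δ i) ^ 2 := by
    rw [normL2_sq hL, ip, integral_eq_sum_cells hL hN (hf.mul hf).integrable]
    refine Finset.sum_le_sum fun i hi => ?_
    have hi := Finset.mem_range.1 hi
    have hlt := node_lt_succ hL hN i
    have hsub := cell_subset_dom hL hN hi
    have e1 := (hf.mul hf).intervalIntegrable (hsub ⟨le_rfl, hlt.le⟩) (hsub ⟨hlt.le, le_rfl⟩)
    have e2 : ∫ x in node L N i..node L N (i + 1), f x * f x
        ≤ ∫ x in node L N i..node L N (i + 1), (A * nearSum K δ i) ^ 2 := by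
      rw [intervalIntegral.integral_of_le hlt.le, intervalIntegral.integral_of_le hlt.le,
        integral_Ioc_eq_integral_Ioo, integral_Ioc_eq_integral_Ioo]
      refine setIntegral_mono_ae_restrict (e1.1.mono_set Ioo_subset_Ioc_self)
        (integrableOn_const (by simp)) ?_
      have hsub' : Ioo (node L N i) (node L N (i + 1)) ⊆ Ioc (-L) L := fun x hx =>
        ⟨(hsub ⟨le_rfl, hlt.le⟩).1.trans_lt hx.1, hx.2.le.trans (hsub ⟨hlt.le, le_rfl⟩).2⟩
      have := ae_restrict_of_ae_restrict_of_subset hsub' (h i hi)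
      filter_upwards [this, ae_restrict_mem measurableSet_Ioo] with x hx hxI
      have := hx hxI
      rw [← sq, ← sq_abs]
      exact pow_le_pow_left₀ (abs_nonneg _) this 2
    rw [intervalIntegral.integral_const, node_succ, add_sub_cancel_left, smul_eq_mul,
      ← node_succ] at e2
    exact e2
  have h2 := sum_nearSum_sq_le K N hout
  calc _ ≤ _ := h1
    _ = meshSize L N * A ^ 2 * ∑ i ∈ Finset.range N, nearSum K δ i ^ 2 := by
        rw [Finset.mul_sum]; exact Finset.sum_congr rfl fun i _ => by ring
    _ ≤ meshSize L N * A ^ 2 * ((2 * K + 1) ^ 2 * ∑ l ∈ Finset.range N, δ l ^ 2) := by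
        gcongr
    _ = _ := by ring

/-- The Cauchy-Schwarz inequality on an interval. -/
theorem sq_integral_le {a b : ℝ} (hab : a ≤ b) (hf : IntervalIntegrable f volume a b)
    (hf2 : IntervalIntegrable (fun x => f x * f x) volume a b) :
    (∫ x in a..b, f x) ^ 2 ≤ (b - a) * ∫ x in a..b, f x * f x := by
  rcases hab.eq_or_lt with rfl | hlt
  · simp
  set I := ∫ x in a..b, f x with hI
  set Q := ∫ x in a..b, f x * f x with hQ
  have h0 : 0 ≤ ∫ x in a..b, ((b - a) * f x - I) * ((b - a) * f x - I) :=
    intervalIntegral.integral_nonneg hab fun x _ => mul_self_nonneg _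
  have h1 : ∫ x in a..b, ((b - a) * f x - I) * ((b - a) * f x - I)
      = (b - a) ^ 2 * Q - 2 * (b - a) * I * I + I ^ 2 * (b - a) := by
    have e : (fun x => ((b - a) * f x - I) * ((b - a) * f x - I))
        = fun x => (b - a) ^ 2 * (f x * f x) - 2 * (b - a) * I * f x + I ^ 2 := by
      funext x; ring
    rw [e, intervalIntegral.integral_add ((hf2.const_mul _).sub (hf.const_mul _)) (by simp),
      intervalIntegral.integral_sub (hf2.const_mul _) (hf.const_mul _),
      intervalIntegral.integral_const_mul, intervalIntegral.integral_const_mul,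
      intervalIntegral.integral_const, smul_eq_mul]
    ring
  rw [h1] at h0
  have h2 : 0 ≤ (b - a) * ((b - a) * Q - I ^ 2) := by nlinarith
  have := nonneg_of_mul_nonneg_right h2 (sub_pos.2 hlt)
  linarith

/-- The oscillation modulus coming from the `L²` norm of the derivative. -/
def derivModulus (L : ℝ) (N : ℕ) (Y : ℝ → ℝ) (l : ℤ) : ℝ :=
  if 0 ≤ l ∧ l < N then
    √(meshSize L N * ∫ x in node L N l.toNat..node L N (l.toNat + 1), deriv Y x * deriv Y x)
  else 0

theorem derivModulus_out (l : ℤ) (h : l < 0 ∨ (N : ℤ) ≤ l) : derivModulus L N Y l = 0 := by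
  rw [derivModulus, if_neg (by omega)]

/-- Cauchy-Schwarz for the integral of `Y'` over part of one cell. The squares of these moduli add
up to `h ‖Y'‖²`, which turns local oscillation bounds into global `L²` bounds. -/
theorem isModulus_derivModulus (hL : 0 < L) (hN : 1 ≤ N) (hY : Lip L Y) :
    IsModulus L N Y (derivModulus L N Y) where
  nonneg l := by
    unfold derivModulus; split_ifs
    · exact Real.sqrt_nonneg _
    · exact le_rfl
  osc i hi x hx y hy := by
    wlog hxy : x ≤ y generalizing x y
    · rw [abs_sub_comm]; exact this y hy x hx (le_of_not_ge hxy)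
    have hsub := cell_subset_dom hL hN hi
    rw [derivModulus, if_pos (by omega), Int.toNat_natCast]
    refine Real.le_sqrt_of_sq_le ?_
    rw [sq_abs, ← neg_sub, neg_sq]
    have hac : AbsolutelyContinuousOnInterval Y x y := (hY.ac hL).mono (by
      rw [uIcc_dom hL]; exact uIcc_subset_Icc (hsub hx) (hsub hy))
    rw [← hac.integral_deriv_eq_sub]
    have hbm := hY.bm_deriv
    refine (sq_integral_le hxy (hbm.intervalIntegrable (hsub hx) (hsub hy))
      ((hbm.mul hbm).intervalIntegrable (hsub hx) (hsub hy))).trans ?_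
    have hlt := node_lt_succ hL hN i
    have h1 : y - x ≤ meshSize L N := by
      have := node_succ (L := L) (N := N) i
      linarith [hx.1, hy.2]
    have h2 : ∫ t in x..y, deriv Y t * deriv Y t
        ≤ ∫ t in node L N i..node L N (i + 1), deriv Y t * deriv Y t :=
      intervalIntegral.integral_mono_interval hx.1 hxy hy.2
        (ae_of_all _ fun t => mul_self_nonneg _)
        ((hbm.mul hbm).intervalIntegrable (hsub ⟨le_rfl, hlt.le⟩) (hsub ⟨hlt.le, le_rfl⟩))
    exact mul_le_mul h1 h2 (intervalIntegral.integral_nonneg hxy fun t _ => mul_self_nonneg _)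
      (meshSize_pos hL hN).le

theorem sum_derivModulus_sq (hL : 0 < L) (hN : 1 ≤ N) (hY : Lip L Y) :
    ∑ l ∈ Finset.range N, derivModulus L N Y l ^ 2
      = meshSize L N * normL2 L (deriv Y) ^ 2 := by
  have hbm := hY.bm_deriv
  rw [normL2_sq hL, ip, integral_eq_sum_cells hL hN (hbm.mul hbm).integrable, Finset.mul_sum]
  refine Finset.sum_congr rfl fun i hi => ?_
  have hi := Finset.mem_range.1 hi
  rw [derivModulus, if_pos (by omega), Int.toNat_natCast, Real.sq_sqrt]
  exact mul_nonneg (meshSize_pos hL hN).le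
    (intervalIntegral.integral_nonneg (node_lt_succ hL hN i).le fun t _ => mul_self_nonneg _)

theorem normL2_le_of_derivModulus (hL : 0 < L) (hN : 1 ≤ N) (hY : Lip L Y) {K : ℕ} {A : ℝ}
    (hA : 0 ≤ A) (hf : BM L f)
    (h : ∀ i < N, ∀ᵐ x ∂vol L, x ∈ Ioo (node L N i) (node L N (i + 1)) →
      |f x| ≤ A * nearSum K (derivModulus L N Y) i) :
    normL2 L f ≤ A * (2 * K + 1) * (meshSize L N * normL2 L (deriv Y)) := by
  have h1 := normL2_sq_le_of_nearSum hL hN hf derivModulus_out h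
  rw [sum_derivModulus_sq hL hN hY] at h1
  have hh := meshSize_pos hL hN
  refine le_of_sq_le_sq (h1.trans (le_of_eq (by ring))) ?_
  have := normL2_nonneg (L := L) (v := deriv Y)
  positivity

/-- First order approximation in `L²`. -/
theorem exists_Sp_approx (k : ℕ) : ∃ C, 0 ≤ C ∧ ∀ (L : ℝ) (N : ℕ), 0 < L → 1 ≤ N →
    ∀ Y, Lip L Y → ∃ s ∈ Sp L N k,
      normL2 L (fun x => Y x - s x) ≤ C * (meshSize L N * normL2 L (deriv Y)) := by
  -- The nodal values themselves are the coefficients, so `K₀ = 0` and the error on a cell involves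
  -- `2 * (k + 1) + 1` cells.
  refine ⟨3 * (2 * ((0 + k + 1 : ℕ) : ℝ) + 1), by positivity, fun L N hL hN Y hY => ?_⟩
  have hmod := isModulus_derivModulus hL hN hY
  refine ⟨_, cardinalSpline_mem_Sp k (nodeVal L N Y), ?_⟩
  refine normL2_le_of_derivModulus hL hN hY (by norm_num)
    (hY.bm.sub (Sp.bm hL hN (cardinalSpline_mem_Sp k _))) fun i hi => ae_of_all _ fun x hx => ?_
  refine hmod.abs_cardinalSpline_sub_le hL hN (K₀ := 0) (fun j => ?_) hi (Ioo_subset_Ico_self hx)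
  rw [sub_self, abs_zero]
  exact nearSum_nonneg hmod.nonneg _ _

/-- Stable first order approximation of functions that vanish at `±L`. -/
theorem exists_Sp_approx_zero (k : ℕ) : ∃ C, 0 ≤ C ∧ ∀ (L : ℝ) (N : ℕ), 0 < L → 1 ≤ N →
    ∀ Y, Lip L Y → Y (-L) = 0 → Y L = 0 → ∃ W ∈ Sp L N (k + 1), W (-L) = 0 ∧ W L = 0 ∧
      normL2 L (fun x => Y x - W x) ≤ C * (meshSize L N * normL2 L (deriv Y)) ∧
      normL2 L (deriv W) ≤ C * normL2 L (deriv Y) := by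
  refine ⟨4 * (2 * ((k + 1 + (k + 1) + 1 : ℕ) : ℝ) + 1), by positivity,
    fun L N hL hN Y hY h0 h1 => ?_⟩
  have hh := meshSize_pos hL hN
  have hmod := isModulus_derivModulus hL hN hY
  have hneg : ∀ j : ℤ, j ≤ 0 → nodeVal L N Y j = 0 := fun j hj => by
    rw [nodeVal, Int.toNat_of_nonpos hj, Nat.zero_min, node_zero, h0]
  have hbig : ∀ j : ℤ, (N : ℤ) ≤ j → nodeVal L N Y j = 0 := fun j hj => by
    rw [nodeVal, min_eq_right (by omega), node_last hN, h1]
  -- At `x = L` only indices `j ≥ N - (k + 1)` contribute, and these coefficients are now zero. At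
  -- `x = -L` only `j ≤ 0` contributes, where the clamped nodal value is already `Y (-L) = 0`. The
  -- coefficients removed are small because `Y L = 0`.
  set c : ℤ → ℝ := fun j => if j + (k + 1) < N then nodeVal L N Y j else 0 with hc
  have hcN : ∀ j, |c j - nodeVal L N Y j| ≤ nearSum (k + 1) (derivModulus L N Y) j := by
    intro j
    simp only [hc]
    split_ifs with hj
    · rw [sub_self, abs_zero]; exact nearSum_nonneg hmod.nonneg _ _
    · rcases lt_or_ge j N with hjN | hjN
      · rw [← hbig N le_rfl]
        exact hmod.nodeVal_sub_le hL hN (by push_cast; omega) (by push_cast; omega)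
          (by push_cast; omega) (by push_cast; omega)
      · rw [hbig j hjN, sub_self, abs_zero]; exact nearSum_nonneg hmod.nonneg _ _
  have hn := normL2_nonneg (L := L) (v := deriv Y)
  refine ⟨_, cardinalSpline_mem_Sp (k + 1) c, ?_, ?_, ?_, ?_⟩
  · have := cardinalSpline_local (k + 1) c (x := (-L + L) / meshSize L N) (m := 0) (G := 0) ?_
    · simpa using this
    · intro j _ h2
      rw [neg_add_cancel, zero_div, Int.floor_zero] at h2
      simp only [hc, hneg j h2, ite_self, sub_zero, abs_zero, le_refl]
  · have := cardinalSpline_local (k + 1) c (x := (L + L) / meshSize L N) (m := 0) (G := 0) ?_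
    · simpa using this
    · intro j h2 _
      have e : (L + L) / meshSize L N = N := by
        rw [div_eq_iff hh.ne', mul_meshSize hN]; ring
      rw [e, Int.floor_natCast] at h2
      push_cast at h2
      simp only [hc]
      rw [if_neg (by omega)]; simp
  · refine (normL2_le_of_derivModulus hL hN hY (A := 3) (K := k + 1 + (k + 1) + 1) (by norm_num)
      (hY.bm.sub (Sp.bm hL hN (cardinalSpline_mem_Sp (k + 1) c)))
      fun i hi => ae_of_all _ fun x hx => ?_).trans ?_
    · exact hmod.abs_cardinalSpline_sub_le hL hN hcN hi (Ioo_subset_Ico_self hx)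
    · have : 0 ≤ meshSize L N * normL2 L (deriv Y) := by positivity
      gcongr; norm_num
  · have hd := cardinalSpline_deriv hL hN k c
    have hlip := Sp.lip hL hN (cardinalSpline_mem_Sp (k + 1) c)
    -- The `h⁻¹` from differentiating the scaled spline cancels the `h` of the oscillation bound; 4
    -- is twice the deviation bound of `coeff_sub_le`, once for each of two adjacent coefficients.
    have h2 := normL2_le_of_derivModulus hL hN hY (A := 4 * (meshSize L N)⁻¹)
      (K := k + 1 + (k + 1) + 1) (by positivity) hlip.bm_deriv fun i hi => ?_
    · refine h2.trans (le_of_eq ?_)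
      field_simp
    · filter_upwards [hd] with x hx hxi
      rw [hx, abs_mul, abs_of_pos (inv_pos.2 hh), mul_comm (4 : ℝ), mul_assoc]
      refine mul_le_mul_of_nonneg_left ?_ (inv_pos.2 hh).le
      refine (hmod.abs_cardinalSpline_diff_le hL hN hcN (Ioo_subset_Ico_self hxi)).trans ?_
      refine mul_le_mul_of_nonneg_left ?_ (by norm_num)
      exact nearSum_le_nearSum hmod.nonneg (by push_cast; omega) (by push_cast; omega)

/-- First order approximation in the supremum norm. -/
theorem exists_Sp_approx_sup (k : ℕ) : ∃ C, 0 ≤ C ∧ ∀ (L : ℝ) (N : ℕ), 0 < L → 1 ≤ N →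
    ∀ (Y : ℝ → ℝ) (M : ℝ), 0 ≤ M → (∀ x ∈ dom L, ∀ y ∈ dom L, |Y x - Y y| ≤ M * |x - y|) →
    ∃ s ∈ Sp L N k, ∀ x ∈ Ico (-L) L, |Y x - s x| ≤ C * meshSize L N * M := by
  refine ⟨3 * (2 * ((0 + k + 1 : ℕ) : ℝ) + 1), by positivity, fun L N hL hN Y M hM hY => ?_⟩
  have hh := meshSize_pos hL hN
  have hmod : IsModulus L N Y fun _ => meshSize L N * M := by
    refine ⟨fun _ => by positivity, fun i hi x hx y hy => ?_⟩
    have hsub := cell_subset_dom hL hN hi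
    refine (hY x (hsub hx) y (hsub hy)).trans ?_
    rw [mul_comm]
    refine mul_le_mul_of_nonneg_right ?_ hM
    have := node_succ (L := L) (N := N) i
    rw [abs_le]
    constructor <;> linarith [hx.1, hx.2, hy.1, hy.2]
  refine ⟨_, cardinalSpline_mem_Sp k (nodeVal L N Y), fun x hx => ?_⟩
  obtain ⟨i, hi, hxi⟩ := exists_cell hL hN hx
  have h1 := hmod.abs_cardinalSpline_sub_le hL hN (K₀ := 0) (k := k) (c := nodeVal L N Y)
    (fun j => by rw [sub_self, abs_zero]; exact nearSum_nonneg hmod.nonneg _ _) hi hxi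
  refine h1.trans (le_of_eq ?_)
  rw [nearSum, Finset.sum_const, Int.card_Icc, nsmul_eq_mul]
  have : ((i : ℤ) + ((0 + k + 1 : ℕ) : ℤ) + 1 - (i - ((0 + k + 1 : ℕ) : ℤ))).toNat
      = 2 * (0 + k + 1) + 1 := by omega
  rw [this]; push_cast; ring

end

noncomputable section

open MeasureTheory
open scoped NNReal ENNReal

variable {L : ℝ} {f g v w s Y : ℝ → ℝ} {N μ r : ℕ} {δ : ℤ → ℝ}

/-! ### Higher order approximation by splines -/

theorem abs_sub_le_of_derivWithin (hv : DifferentiableOn ℝ v (dom L)) {M : ℝ}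
    (h : ∀ x ∈ dom L, |derivWithin v (dom L) x| ≤ M) :
    ∀ x ∈ dom L, ∀ y ∈ dom L, |v x - v y| ≤ M * |x - y| := fun _ hx _ hy =>
  (convex_Icc (-L) L).norm_image_sub_le_of_norm_derivWithin_le hv h hy hx

theorem primitive_derivWithin (hL : 0 < L) (hv : ContDiffOn ℝ 1 v (dom L)) {x : ℝ}
    (hx : x ∈ dom L) : v x = v (-L) + ∫ t in (-L)..x, derivWithin v (dom L) t := by
  have hd : DifferentiableOn ℝ v (dom L) := hv.differentiableOn one_ne_zero
  have hc : ContinuousOn (derivWithin v (dom L)) (dom L) :=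
    hv.continuousOn_derivWithin (uniqueDiffOn_dom hL) le_rfl
  have hsub : Icc (-L) x ⊆ dom L := Icc_subset_Icc_right hx.2
  rw [intervalIntegral.integral_eq_sub_of_hasDerivAt_of_le hx.1 (hv.continuousOn.mono hsub)
    (fun y hy => ?_) ((hc.mono hsub).intervalIntegrable_of_Icc hx.1)]
  · ring
  · exact (hd y (hsub (Ioo_subset_Icc_self hy))).hasDerivWithinAt.hasDerivAt
      (dom_mem_nhds ⟨hy.1, hy.2.trans_le hx.2⟩)

/-- Each order is gained by integration. If `s` approximates `w'` to order `j + 1`, then `w` minus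
the primitive of `s` is Lipschitz with constant `O(h ^ (j + 1))`, and the first order result applied
to this remainder gains one more `h`, at the cost of one degree. -/
theorem exists_Sp_approx_smooth (j : ℕ) : ∀ k : ℕ, j ≤ k → ∃ C, 0 ≤ C ∧
    ∀ (L : ℝ) (N : ℕ), 0 < L → 1 ≤ N → ∀ (w : ℝ → ℝ) (M : ℝ), 0 ≤ M →
      ContDiffOn ℝ (j + 1 : ℕ) w (dom L) →
      (∀ x ∈ dom L, |iteratedDerivWithin (j + 1) w (dom L) x| ≤ M) →
      ∃ s ∈ Sp L N k, ∀ x ∈ Ico (-L) L, |w x - s x| ≤ C * meshSize L N ^ (j + 1) * M := by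
  induction j with
  | zero =>
    intro k _
    obtain ⟨C, hC0, hC⟩ := exists_Sp_approx_sup k
    refine ⟨C, hC0, fun L N hL hN w M hM hw hwM => ?_⟩
    obtain ⟨s, hs, hs'⟩ := hC L N hL hN w M hM (abs_sub_le_of_derivWithin
      (hw.differentiableOn (by simp)) fun x hx => by
        rw [← iteratedDerivWithin_one]; exact hwM x hx)
    exact ⟨s, hs, fun x hx => by simpa using hs' x hx⟩
  | succ j ih =>
    intro k hk
    obtain ⟨k, rfl⟩ : ∃ k', k = k' + 1 := ⟨k - 1, by omega⟩
    obtain ⟨C₁, hC₁0, hC₁⟩ := ih k (by omega)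
    obtain ⟨C₂, hC₂0, hC₂⟩ := exists_Sp_approx_sup (k + 1)
    refine ⟨C₂ * C₁, by positivity, fun L N hL hN w M hM hw hwM => ?_⟩
    have hh := meshSize_pos hL hN
    have e : ((j + 1 + 1 : ℕ) : WithTop ℕ∞) = ((j + 1 : ℕ) : WithTop ℕ∞) + 1 := by push_cast; rfl
    have hw1 : ContDiffOn ℝ 1 w (dom L) := hw.of_le (by rw [e]; exact le_add_self)
    have hw' : ContDiffOn ℝ (j + 1 : ℕ) (derivWithin w (dom L)) (dom L) :=
      hw.derivWithin (uniqueDiffOn_dom hL) (by rw [e])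
    obtain ⟨s, hs, hs'⟩ := hC₁ L N hL hN (derivWithin w (dom L)) M hM hw' fun x hx => by
      rw [← iteratedDerivWithin_succ']; exact hwM x hx
    have hsb := Sp.bm hL hN hs
    have hwb : BM L (derivWithin w (dom L)) := ContinuousOn.bm hw'.continuousOn
    have hP : ∀ x ∈ dom L, ∀ y ∈ dom L,
        |(w x - ∫ t in (-L)..x, s t) - (w y - ∫ t in (-L)..y, s t)|
          ≤ C₁ * meshSize L N ^ (j + 1) * M * |x - y| := by
      intro x hx y hy
      have e1 : (w x - ∫ t in (-L)..x, s t) - (w y - ∫ t in (-L)..y, s t)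
          = ∫ t in y..x, (derivWithin w (dom L) t - s t) := by
        rw [intervalIntegral.integral_sub (hwb.intervalIntegrable hy hx)
          (hsb.intervalIntegrable hy hx), ← primitive_sub hL hwb hy hx,
          ← primitive_sub hL hsb hy hx, primitive_derivWithin hL hw1 hx,
          primitive_derivWithin hL hw1 hy]
        ring
      rw [e1]
      refine intervalIntegral.norm_integral_le_of_norm_le_const_ae
        (f := fun t => derivWithin w (dom L) t - s t) ?_
      -- The pointwise bound for `s` omits the point `L`, which is a null set.
      have hne : ∀ᵐ t : ℝ, t ≠ L := by simp [ae_iff, measure_singleton]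
      filter_upwards [hne] with t htL ht
      rw [uIoc] at ht
      refine hs' t ⟨(le_min hy.1 hx.1).trans ht.1.le, lt_of_le_of_ne ?_ htL⟩
      exact ht.2.trans (max_le hy.2 hx.2)
    obtain ⟨s₂, hs₂, hs₂'⟩ := hC₂ L N hL hN (fun x => w x - ∫ t in (-L)..x, s t)
      (C₁ * meshSize L N ^ (j + 1) * M) (by positivity) hP
    have hS : (fun x => ∫ t in (-L)..x, s t) ∈ Sp L N (k + 1) :=
      ⟨s, hs, 0, fun x _ => by rw [zero_add]⟩
    refine ⟨_, Sp.add hL hN hS hs₂, fun x hx => ?_⟩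
    have := hs₂' x hx
    rw [sub_sub] at this
    refine this.trans (le_of_eq ?_)
    ring

theorem affine_abs_le (hL : 0 < L) {α β A : ℝ} (hα : |α| ≤ A) (hβ : |β| ≤ A) {x : ℝ}
    (hx : x ∈ dom L) : |(α + β) / 2 + (β - α) / (2 * L) * x| ≤ A := by
  have e : (α + β) / 2 + (β - α) / (2 * L) * x
      = (L - x) / (2 * L) * α + (x + L) / (2 * L) * β := by field_simp; ring
  have h1 : 0 ≤ (L - x) / (2 * L) := div_nonneg (by linarith [hx.2]) (by linarith)
  have h2 : 0 ≤ (x + L) / (2 * L) := div_nonneg (by linarith [hx.1]) (by linarith)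
  rw [e]
  refine (abs_add_le _ _).trans ?_
  rw [abs_mul, abs_mul, abs_of_nonneg h1, abs_of_nonneg h2]
  have h3 : (L - x) / (2 * L) + (x + L) / (2 * L) = 1 := by field_simp; ring
  have h4 := mul_le_mul_of_nonneg_left hα h1
  have h5 := mul_le_mul_of_nonneg_left hβ h2
  calc _ ≤ ((L - x) / (2 * L) + (x + L) / (2 * L)) * A := by linarith
    _ = A := by rw [h3, one_mul]

/-- Subtracting the linear interpolant of the end point values. -/
theorem femSpace.sub_affine (hL : 0 < L) (hN : 1 ≤ N) (hr : 2 ≤ r) (hf : f ∈ femSpace L N μ r) :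
    (fun x => f x - ((f (-L) + f L) / 2 + (f L - f (-L)) / (2 * L) * x)) ∈ femSpaceZero L N μ r := by
  refine ⟨(isFE_femSpace hL hN hr).sub hf (femSpace.affine hr _ _), ?_, ?_⟩
  · field_simp; ring
  · field_simp; ring

/-- `L²` approximation in `S_h^0` of functions that vanish at `±L`. -/
theorem exists_femSpaceZero_approx_L2 (hL : 0 < L) (m : ℕ) : ∃ C, 0 ≤ C ∧ ∀ (N μ : ℕ), 1 ≤ N →
    μ ≤ m → ∀ (w : ℝ → ℝ) (M : ℝ), 0 ≤ M → ContDiffOn ℝ (m + 1 : ℕ) w (dom L) →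
      (∀ x ∈ dom L, |iteratedDerivWithin (m + 1) w (dom L) x| ≤ M) → w (-L) = 0 → w L = 0 →
      ∃ ψ ∈ femSpaceZero L N μ (m + 2),
        normL2 L (fun x => w x - ψ x) ≤ C * meshSize L N ^ (m + 1) * M := by
  obtain ⟨C, hC0, hC⟩ := exists_Sp_approx_smooth m (m + 1) (by omega)
  refine ⟨√(2 * L) * (2 * C), by positivity, fun N μ hN hμ w M hM hw hwM h0 h1 => ?_⟩
  have hh := meshSize_pos hL hN
  obtain ⟨s, hs, hsw⟩ := hC L N hL hN w M hM hw hwM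
  have hslip := Sp.lip hL hN hs
  set A := C * meshSize L N ^ (m + 1) * M with hA
  have hA0 : 0 ≤ A := by positivity
  -- Continuity extends the bound to `x = L`. The end point values of `s` are then at most `A`,
  -- since `w` vanishes there, and subtracting their linear interpolant costs at most another `A`.
  have hle : ∀ x ∈ dom L, |w x - s x| ≤ A := by
    have hcl : closure (Ico (-L) L) = dom L := closure_Ico (by linarith)
    have hc : ContinuousOn (fun x => |w x - s x|) (closure (Ico (-L) L)) := by
      rw [hcl]; exact (hw.continuousOn.sub hslip.continuousOn).abs
    intro x hx
    rw [← hcl] at hx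
    exact closure_minimal (s := Ico (-L) L) (t := closure (Ico (-L) L) ∩ {x | |w x - s x| ≤ A})
      (fun y hy => ⟨subset_closure hy, hsw y hy⟩)
      (hc.preimage_isClosed_of_isClosed isClosed_closure isClosed_Iic) hx |>.2
  have e0 := hle _ (left_mem_dom hL)
  have e1 := hle _ (right_mem_dom hL)
  rw [h0, zero_sub, abs_neg] at e0
  rw [h1, zero_sub, abs_neg] at e1
  have hmem := femSpace.sub_affine hL hN (by omega) (Sp.mem_femSpace hL hN (μ := μ) (by omega) hs)
  refine ⟨_, hmem, ?_⟩
  have hfin := normL2_le_of_abs_le hL (v := fun x =>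
    w x - (s x - ((s (-L) + s L) / 2 + (s L - s (-L)) / (2 * L) * x))) (C := 2 * A)
    ((ContinuousOn.bm hw.continuousOn).sub (femSpace.lip hL hN hmem.1).bm) (by positivity)
    fun x hx => by
      have t1 := hle x (Ioo_subset_dom hx)
      have t2 := affine_abs_le hL e0 e1 (Ioo_subset_dom hx)
      have t3 := abs_add_le (w x - s x) ((s (-L) + s L) / 2 + (s L - s (-L)) / (2 * L) * x)
      have t4 : w x - (s x - ((s (-L) + s L) / 2 + (s L - s (-L)) / (2 * L) * x))
        = w x - s x + ((s (-L) + s L) / 2 + (s L - s (-L)) / (2 * L) * x) := by ring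
      rw [t4]; linarith
  refine hfin.trans (le_of_eq ?_)
  rw [hA]; ring

/-- `H¹` approximation in `S_h`. -/
theorem exists_femSpace_approx (hL : 0 < L) (m : ℕ) : ∃ C, 0 ≤ C ∧ ∀ (N μ : ℕ), 1 ≤ N →
    μ ≤ m → ∀ (v : ℝ → ℝ) (M : ℝ), 0 ≤ M → ContDiffOn ℝ (m + 2 : ℕ) v (dom L) →
      (∀ x ∈ dom L, |iteratedDerivWithin (m + 2) v (dom L) x| ≤ M) →
      ∃ ψ ∈ femSpace L N μ (m + 2), ψ (-L) = v (-L) ∧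
        (∀ x ∈ dom L, |v x - ψ x| ≤ C * meshSize L N ^ (m + 1) * M) ∧
        normL2 L (deriv fun x => v x - ψ x) ≤ C * meshSize L N ^ (m + 1) * M := by
  obtain ⟨C, hC0, hC⟩ := exists_Sp_approx_smooth m m le_rfl
  refine ⟨(2 * L + √(2 * L)) * C, by positivity, fun N μ hN hμ v M hM hv hvM => ?_⟩
  have hh := meshSize_pos hL hN
  have e : ((m + 2 : ℕ) : WithTop ℕ∞) = ((m + 1 : ℕ) : WithTop ℕ∞) + 1 := by push_cast; rfl
  have hv1 : ContDiffOn ℝ 1 v (dom L) := hv.of_le (by rw [e]; exact le_add_self)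
  have hv' : ContDiffOn ℝ (m + 1 : ℕ) (derivWithin v (dom L)) (dom L) :=
    hv.derivWithin (uniqueDiffOn_dom hL) (by rw [e])
  -- The derivative is approximated and then integrated from the exact value at `-L`, so the sup
  -- error of `s` controls both `v - ψ` and its derivative.
  obtain ⟨s, hs, hsv⟩ := hC L N hL hN (derivWithin v (dom L)) M hM hv' fun x hx => by
    rw [← iteratedDerivWithin_succ']; exact hvM x hx
  have hsb := Sp.bm hL hN hs
  have hvb : BM L (derivWithin v (dom L)) := ContinuousOn.bm hv'.continuousOn
  set A := C * meshSize L N ^ (m + 1) * M with hA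
  have hA0 : 0 ≤ A := by positivity
  have hS : (fun x => v (-L) + ∫ t in (-L)..x, s t) ∈ Sp L N (m + 1) :=
    ⟨s, hs, _, fun x _ => rfl⟩
  have hmem := Sp.mem_femSpace hL hN (μ := μ) hμ hS
  have hlip := Sp.lip hL hN hS
  have hvlip : Lip L v := ContDiffOn.lip one_ne_zero hv1
  have hne : ∀ᵐ t : ℝ, t ≠ L := by simp [ae_iff, measure_singleton]
  refine ⟨_, hmem, by simp, fun x hx => ?_, ?_⟩
  · have e1 : v x - (v (-L) + ∫ t in (-L)..x, s t)
        = ∫ t in (-L)..x, (derivWithin v (dom L) t - s t) := by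
      rw [intervalIntegral.integral_sub (hvb.intervalIntegrable (left_mem_dom hL) hx)
        (hsb.intervalIntegrable (left_mem_dom hL) hx), primitive_derivWithin hL hv1 hx]
      ring
    have e2 : ‖∫ t in (-L)..x, (derivWithin v (dom L) t - s t)‖ ≤ A * |x - -L| := by
      refine intervalIntegral.norm_integral_le_of_norm_le_const_ae
        (f := fun t => derivWithin v (dom L) t - s t) ?_
      filter_upwards [hne] with t htL ht
      rw [uIoc_of_le hx.1] at ht
      exact hsv t ⟨ht.1.le, lt_of_le_of_ne (ht.2.trans hx.2) htL⟩
    rw [e1]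
    refine e2.trans ?_
    have h1 : |x - -L| ≤ 2 * L := by
      rw [abs_le]; constructor <;> linarith [hx.1, hx.2]
    calc A * |x - -L| ≤ A * (2 * L) := mul_le_mul_of_nonneg_left h1 hA0
      _ ≤ A * (2 * L + √(2 * L)) :=
        mul_le_mul_of_nonneg_left (le_add_of_nonneg_right (Real.sqrt_nonneg _)) hA0
      _ = _ := by rw [hA]; ring
  · have h1 : normL2 L (deriv fun x => v x - (v (-L) + ∫ t in (-L)..x, s t)) ≤ √(2 * L) * A := by
      rw [normL2_congr hL (hvlip.deriv_sub hL hlip)]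
      have h2 : (fun x => deriv v x - deriv (fun x => v (-L) + ∫ t in (-L)..x, s t) x)
          =ᵐ[vol L] fun x => derivWithin v (dom L) x - s x := by
        filter_upwards [primitive_deriv hL hsb, ae_mem_Ioo] with x hx hxI
        rw [deriv_const_add, hx, derivWithin_of_mem_nhds (dom_mem_nhds hxI)]
      rw [normL2_congr hL h2]
      exact normL2_le_of_abs_le hL (hvb.sub hsb) hA0 fun x hx => hsv x (Ioo_subset_Ico_self hx)
    refine h1.trans ?_
    calc √(2 * L) * A ≤ (2 * L + √(2 * L)) * A :=
          mul_le_mul_of_nonneg_right (by linarith) hA0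
      _ = _ := by rw [hA]; ring

/-- `H¹` approximation in `S_h^0` of functions that vanish at `±L`. -/
theorem exists_femSpaceZero_approx (hL : 0 < L) (m : ℕ) : ∃ C, 0 ≤ C ∧ ∀ (N μ : ℕ), 1 ≤ N →
    μ ≤ m → ∀ (v : ℝ → ℝ) (M : ℝ), 0 ≤ M → ContDiffOn ℝ (m + 2 : ℕ) v (dom L) →
      (∀ x ∈ dom L, |iteratedDerivWithin (m + 2) v (dom L) x| ≤ M) → v (-L) = 0 → v L = 0 →
      ∃ ψ ∈ femSpaceZero L N μ (m + 2),
        (∀ x ∈ dom L, |v x - ψ x| ≤ C * meshSize L N ^ (m + 1) * M) ∧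
        normL2 L (deriv fun x => v x - ψ x) ≤ C * meshSize L N ^ (m + 1) * M := by
  obtain ⟨C, hC0, hC⟩ := exists_femSpace_approx hL m
  refine ⟨(2 + √(2 * L) / L) * C, by positivity, fun N μ hN hμ v M hM hv hvM h0 h1 => ?_⟩
  have hh := meshSize_pos hL hN
  obtain ⟨ψ, hψ, -, hψv, hψd⟩ := hC N μ hN hμ v M hM hv hvM
  set A := C * meshSize L N ^ (m + 1) * M with hA
  have hA0 : 0 ≤ A := by positivity
  have e0 := hψv _ (left_mem_dom hL)
  have e1 := hψv _ (right_mem_dom hL)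
  rw [h0, zero_sub, abs_neg] at e0
  rw [h1, zero_sub, abs_neg] at e1
  have hψl := femSpace.lip hL hN hψ
  have hvl : Lip L v := ContDiffOn.lip (by simp) hv
  have hmem := femSpace.sub_affine hL hN (by omega) hψ
  have hq0 : 0 ≤ √(2 * L) / L := by positivity
  refine ⟨_, hmem, fun x hx => ?_, ?_⟩
  · have t1 := hψv x hx
    have t2 := affine_abs_le hL e0 e1 hx
    have t3 := abs_add_le (v x - ψ x) ((ψ (-L) + ψ L) / 2 + (ψ L - ψ (-L)) / (2 * L) * x)
    have t4 : v x - (ψ x - ((ψ (-L) + ψ L) / 2 + (ψ L - ψ (-L)) / (2 * L) * x))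
        = v x - ψ x + ((ψ (-L) + ψ L) / 2 + (ψ L - ψ (-L)) / (2 * L) * x) := by ring
    rw [t4]
    have : (2 + √(2 * L) / L) * C * meshSize L N ^ (m + 1) * M = 2 * A + √(2 * L) / L * A := by
      rw [hA]; ring
    rw [this]
    have := mul_nonneg hq0 hA0
    linarith
  · have hal : Lip L fun x => (ψ (-L) + ψ L) / 2 + (ψ L - ψ (-L)) / (2 * L) * x :=
      (Lip.const _).add (Lip.id.const_mul _)
    have t1 : (fun x => v x - (ψ x - ((ψ (-L) + ψ L) / 2 + (ψ L - ψ (-L)) / (2 * L) * x)))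
        = fun x => (v x - ψ x) + ((ψ (-L) + ψ L) / 2 + (ψ L - ψ (-L)) / (2 * L) * x) := by
      funext x; ring
    have t2 : deriv (fun x => (ψ (-L) + ψ L) / 2 + (ψ L - ψ (-L)) / (2 * L) * x)
        = fun _ => (ψ L - ψ (-L)) / (2 * L) := by
      funext x
      rw [deriv_const_add, deriv_const_mul_field, deriv_id'', mul_one]
    rw [t1, normL2_congr hL ((hvl.sub hψl).deriv_add hL hal)]
    refine (normL2_add_le hL (hvl.sub hψl).bm_deriv hal.bm_deriv).trans ?_
    rw [t2, normL2_const hL]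
    have t3 : |(ψ L - ψ (-L)) / (2 * L)| ≤ A / L := by
      rw [abs_div, abs_of_pos (by linarith : (0 : ℝ) < 2 * L), div_le_div_iff₀ (by linarith) hL]
      have := abs_sub (ψ L) (ψ (-L))
      nlinarith
    have t4 := mul_le_mul_of_nonneg_right t3 (Real.sqrt_nonneg (2 * L))
    have t5 : (2 + √(2 * L) / L) * C * meshSize L N ^ (m + 1) * M
        = 2 * A + A / L * √(2 * L) := by
      rw [hA]; field_simp
    rw [t5]; linarith

end

noncomputable section

open MeasureTheory
open scoped NNReal ENNReal

variable {L q : ℝ} {f g v w s Y : ℝ → ℝ} {N μ r n : ℕ} {S : Set (ℝ → ℝ)} {e : Fin n → ℝ → ℝ}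

/-! ### Expansions in an orthonormal basis -/

/-- The function with coordinates `y`. -/
def comb (e : Fin n → ℝ → ℝ) (y : Fin n → ℝ) (x : ℝ) : ℝ := ∑ i, y i * e i x

theorem IsONB.comb_mem (he : IsONB L q S e) (hS : IsFE L N r S) (y : Fin n → ℝ) :
    comb e y ∈ S := hS.sum _ fun i _ => hS.smul _ _ (he.mem i)

theorem ip_comb_right (hL : 0 < L) (he : ∀ i, Lip L (e i)) (hv : BM L v) (y : Fin n → ℝ) :
    ip L v (comb e y) = ∑ i, y i * ip L v (e i) := by
  change ip L v (fun x => ∑ i, y i * e i x) = _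
  rw [ip_sum_right hL _ (fun i _ => ((he i).const_mul (y i)).bm) hv]
  simp only [ip_smul_right hL]

theorem ip_deriv_comb_right (hL : 0 < L) (he : ∀ i, Lip L (e i)) (hv : BM L v) (y : Fin n → ℝ) :
    ip L v (deriv (comb e y)) = ∑ i, y i * ip L v (deriv (e i)) := by
  change ip L v (deriv fun x => ∑ i, y i * e i x) = _
  rw [ip_congr hL (EventuallyEq.refl _ _) (Lip.deriv_sum hL fun i => (he i).const_mul (y i)),
    ip_sum_right hL _ (fun i _ => ((he i).const_mul (y i)).bm_deriv) hv]
  simp only [deriv_smul_eq, ip_smul_right hL]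

theorem bilin_comb_left (hL : 0 < L) (he : ∀ i, Lip L (e i)) (q : ℝ) (hv : Lip L v)
    (y : Fin n → ℝ) : bilin L q (comb e y) v = ∑ i, y i * bilin L q (e i) v := by
  change bilin L q (fun x => ∑ i, y i * e i x) v = _
  rw [bilin_sum_left hL q (fun i => (he i).const_mul (y i)) hv]
  simp only [bilin_smul_left hL]

theorem IsONB.lip (he : IsONB L q S e) (hS : IsFE L N r S) (i : Fin n) : Lip L (e i) :=
  hS.lip _ (he.mem i)

theorem IsONB.eqOn_comb (he : IsONB L q S e) {φ : ℝ → ℝ} (hφ : φ ∈ S) :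
    EqOn φ (comb e fun i => bilin L q φ (e i)) (dom L) := fun x hx => he.expand φ hφ x hx

theorem IsONB.bilin_comb (he : IsONB L q S e) (hL : 0 < L) (hS : IsFE L N r S) (y : Fin n → ℝ)
    (i : Fin n) : bilin L q (comb e y) (e i) = y i := by
  rw [bilin_comb_left hL (he.lip hS) q (he.lip hS i)]
  simp [he.orth]

theorem IsONB.ip_right (he : IsONB L q S e) (hL : 0 < L) (hS : IsFE L N r S) (hv : BM L v)
    {φ : ℝ → ℝ} (hφ : φ ∈ S) : ip L v φ = ∑ i, bilin L q φ (e i) * ip L v (e i) := by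
  rw [ip_congr hL (EventuallyEq.refl _ v) (ae_eq_of_dom (he.eqOn_comb hφ)),
    ip_comb_right hL (he.lip hS) hv]

theorem IsONB.ip_deriv_right (he : IsONB L q S e) (hL : 0 < L) (hS : IsFE L N r S) (hv : BM L v)
    {φ : ℝ → ℝ} (hφ : φ ∈ S) :
    ip L v (deriv φ) = ∑ i, bilin L q φ (e i) * ip L v (deriv (e i)) := by
  rw [ip_congr hL (EventuallyEq.refl _ v) (ae_eq_of_Ioo (deriv_eqOn_of_dom (he.eqOn_comb hφ))),
    ip_deriv_comb_right hL (he.lip hS) hv]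

theorem IsONB.bilin_right (he : IsONB L q S e) (hL : 0 < L) (hS : IsFE L N r S) (hv : Lip L v)
    {φ : ℝ → ℝ} (hφ : φ ∈ S) :
    bilin L q v φ = ∑ i, bilin L q φ (e i) * bilin L q v (e i) := by
  rw [bilin_comm, bilin_congr hL q (he.eqOn_comb hφ) (eqOn_refl v _),
    bilin_comb_left hL (he.lip hS) q hv]
  simp only [bilin_comm q (e _) v]

/-- The solution `χ` of `A_q(χ, φ) = ℓ(φ)`, when `ℓ` is given by its values on the basis. -/
theorem IsONB.bilin_comb_right (he : IsONB L q S e) (hL : 0 < L) (hS : IsFE L N r S)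
    (y : Fin n → ℝ) {φ : ℝ → ℝ} (hφ : φ ∈ S) :
    bilin L q (comb e y) φ = ∑ i, bilin L q φ (e i) * y i := by
  rw [he.bilin_right hL hS (hS.lip _ (he.comb_mem hS y)) hφ]
  simp only [he.bilin_comb hL hS]

/-- The coordinates of the elliptic projection. -/
theorem IsONB.isProjection (he : IsONB L q S e) (hL : 0 < L) (hS : IsFE L N r S) (hv : Lip L v)
    {φ : ℝ → ℝ} (hφ : φ ∈ S) :
    bilin L q (comb e fun i => bilin L q v (e i)) φ = bilin L q v φ := by
  rw [he.bilin_comb_right hL hS _ hφ, he.bilin_right hL hS hv hφ]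

/-- The solution of `A_q(χ, φ) = (f, φ)`. -/
theorem IsONB.isRiesz (he : IsONB L q S e) (hL : 0 < L) (hS : IsFE L N r S) (hf : BM L f)
    {φ : ℝ → ℝ} (hφ : φ ∈ S) :
    bilin L q (comb e fun i => ip L f (e i)) φ = ip L f φ := by
  rw [he.bilin_comb_right hL hS _ hφ, he.ip_right hL hS hf hφ]

/-! ### Galerkin projections -/

/-- `R` is the `A_q`-orthogonal projection of `v` onto `S`. -/
structure IsGalerkin (L q : ℝ) (S : Set (ℝ → ℝ)) (v R : ℝ → ℝ) : Prop where
  mem : R ∈ S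
  orth : ∀ φ ∈ S, bilin L q R φ = bilin L q v φ

theorem bilin_self_nonneg (hL : 0 < L) (hq : 0 ≤ q) (v : ℝ → ℝ) : 0 ≤ bilin L q v v := by
  rw [bilin_self hL]
  have := mul_nonneg hq (sq_nonneg (normL2 L (deriv v)))
  positivity

/-- Pythagoras: `v - ψ` is the `A_q`-orthogonal sum of `v - R` and `R - ψ`. -/
theorem IsGalerkin.best (hL : 0 < L) (hS : IsFE L N r S) (hq : 0 ≤ q) {R ψ : ℝ → ℝ}
    (hv : Lip L v) (hR : IsGalerkin L q S v R) (hψ : ψ ∈ S) :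
    bilin L q (fun x => v x - R x) (fun x => v x - R x)
      ≤ bilin L q (fun x => v x - ψ x) (fun x => v x - ψ x) := by
  have hRl := hS.lip _ hR.mem
  have hψl := hS.lip _ hψ
  have hd := hS.sub hR.mem hψ
  have hdl := hS.lip _ hd
  have hρ := hv.sub hRl
  have e0 : (fun x => v x - ψ x) = fun x => (v x - R x) + (R x - ψ x) := by funext x; ring
  have o : bilin L q (fun x => v x - R x) (fun x => R x - ψ x) = 0 := by
    rw [bilin_sub_left hL q hv hRl hdl, hR.orth _ hd, sub_self]
  have h1 : bilin L q (fun x => (v x - R x) + (R x - ψ x)) (fun x => (v x - R x) + (R x - ψ x))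
      = bilin L q (fun x => v x - R x) (fun x => v x - R x)
        + bilin L q (fun x => R x - ψ x) (fun x => R x - ψ x) := by
    rw [bilin_add_left hL q hρ hdl (hρ.add hdl), bilin_comm q (fun x => v x - R x),
      bilin_comm q (fun x => R x - ψ x), bilin_add_left hL q hρ hdl hρ,
      bilin_add_left hL q hρ hdl hdl, bilin_comm q (fun x => R x - ψ x) (fun x => v x - R x), o]
    ring
  rw [e0, h1]
  linarith [bilin_self_nonneg hL hq fun x => R x - ψ x]

theorem IsGalerkin.deriv_le (hL : 0 < L) (hS : IsFE L N r S) (hq : 0 < q) {R ψ : ℝ → ℝ}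
    (hv : Lip L v) (hR : IsGalerkin L q S v R) (hψ : ψ ∈ S) {A : ℝ}
    (h0 : normL2 L (fun x => v x - ψ x) ≤ A) (h1 : normL2 L (deriv fun x => v x - ψ x) ≤ A) :
    normL2 L (deriv fun x => v x - R x) ≤ √((1 + q) / q) * A := by
  have hA : 0 ≤ A := normL2_nonneg.trans h0
  have hb := hR.best hL hS hq.le hv hψ
  rw [bilin_self hL, bilin_self hL] at hb
  have t0 := pow_le_pow_left₀ normL2_nonneg h0 2
  have t1 := pow_le_pow_left₀ normL2_nonneg h1 2
  have t2 := mul_le_mul_of_nonneg_left t1 hq.le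
  have t3 := sq_nonneg (normL2 L fun x => v x - R x)
  refine le_of_sq_le_sq ?_ (by positivity)
  rw [mul_pow, Real.sq_sqrt (by positivity), div_mul_eq_mul_div, le_div_iff₀ hq]
  nlinarith

/-! ### Duality -/

/-- The equation tested with `χ` itself gives the energy bound. -/
theorem normL2_riesz_le (hL : 0 < L) (hS : IsFE L N r S) (hq : 0 < q) (hf : BM L f)
    {χ : ℝ → ℝ} (hχ : χ ∈ S) (h : bilin L q χ χ = ip L f χ) :
    normL2 L χ ≤ normL2 L f ∧ normL2 L (deriv χ) ≤ (√q)⁻¹ * normL2 L f := by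
  rw [bilin_self hL] at h
  have h1 := ip_le hL hf (hS.lip _ hχ).bm
  have n1 := normL2_nonneg (L := L) (v := χ)
  have n2 := normL2_nonneg (L := L) (v := f)
  have n3 := mul_nonneg hq.le (sq_nonneg (normL2 L (deriv χ)))
  have h2 : normL2 L χ ≤ normL2 L f := by
    by_contra! hc
    nlinarith
  refine ⟨h2, le_of_sq_le_sq ?_ (by positivity)⟩
  rw [mul_pow, inv_pow, Real.sq_sqrt hq.le, inv_mul_eq_div, le_div_iff₀ hq]
  nlinarith

/-- Data attached to the discrete solution `χ` of `A_q(χ, φ) = (f, φ)`: a function `Y` close to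
`χ'` such that `f = χ - q Y'`. -/
structure IsDual (L q : ℝ) (S : Set (ℝ → ℝ)) (f χ Y : ℝ → ℝ) (D : ℝ) : Prop where
  mem : χ ∈ S
  riesz : ∀ φ ∈ S, bilin L q χ φ = ip L f φ
  lip : Lip L Y
  deriv_eq : deriv Y =ᵐ[vol L] fun x => q⁻¹ * (χ x - f x)
  close : normL2 L (fun x => deriv χ x - Y x) ≤ D

theorem IsDual.norm_deriv_le (hL : 0 < L) (hS : IsFE L N r S) (hq : 0 < q) {χ : ℝ → ℝ} {D : ℝ}
    (hf : BM L f) (h : IsDual L q S f χ Y D) : normL2 L (deriv Y) ≤ 2 * q⁻¹ * normL2 L f := by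
  have hχ := (hS.lip _ h.mem).bm
  rw [normL2_congr hL h.deriv_eq, normL2_smul hL, abs_of_pos (inv_pos.2 hq)]
  have h1 := normL2_sub_le hL hχ hf
  have h2 := (normL2_riesz_le hL hS hq hf h.mem (h.riesz _ h.mem)).1
  have := inv_pos.2 hq
  nlinarith

/-- Closeness of `χ'` and `Y` from their Galerkin orthogonality. -/
theorem normL2_sub_le_of_orth (hL : 0 < L) {d Y s : ℝ → ℝ} (hd : BM L d) (hY : BM L Y)
    (hs : BM L s) (h : ip L (fun x => d x - Y x) d = ip L (fun x => d x - Y x) s) :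
    normL2 L (fun x => d x - Y x) ≤ normL2 L (fun x => Y x - s x) := by
  have h1 : normL2 L (fun x => d x - Y x) ^ 2
      ≤ normL2 L (fun x => d x - Y x) * normL2 L (fun x => Y x - s x) := by
    rw [normL2_sq hL]
    rw [ip_sub_right hL (hd.sub hY) hd hY, h, ← ip_sub_right hL (hd.sub hY) hs hY,
      normL2_sub_comm hL Y s]
    exact ip_le hL (hd.sub hY) (hs.sub hY)
  have n1 := normL2_nonneg (L := L) (v := fun x => d x - Y x)
  by_contra! hc
  nlinarith [normL2_nonneg (L := L) (v := fun x => Y x - s x)]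

theorem scaled_primitive (hL : 0 < L) (hs : BM L s) (q c : ℝ) :
    Lip L (fun x => q * ((∫ t in (-L)..x, s t) - c)) ∧
      deriv (fun x => q * ((∫ t in (-L)..x, s t) - c)) =ᵐ[vol L] fun x => q * s x := by
  refine ⟨((primitive_lip hL hs).sub (Lip.const c)).const_mul q, ?_⟩
  rw [deriv_smul_eq]
  filter_upwards [primitive_deriv hL hs] with x hx
  rw [deriv_sub_const, hx]

/-- `Y` is the primitive of `q⁻¹ (χ - f)`. Integration by parts turns the equation for `χ` into `(χ'
- Y, φ') = 0` for all `φ` in `S_h`, so `χ'` is the `L²`-best approximation of `Y` by derivatives.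
These include all splines in `Sp L N m`, and first order approximation of `Y` gives the factor `h`.
-/
theorem exists_dual_femSpace (hq : 0 < q) (m : ℕ) : ∃ C, 0 ≤ C ∧ ∀ (L : ℝ)
    (N μ : ℕ), 0 < L → 1 ≤ N → μ ≤ m → ∀ (n : ℕ) (e : Fin n → ℝ → ℝ),
      IsONB L q (femSpace L N μ (m + 2)) e →
      ∀ f, Lip L f → ∃ Y, Y (-L) = 0 ∧ Y L = 0 ∧
        IsDual L q (femSpace L N μ (m + 2)) f (comb e fun i => ip L f (e i)) Y
          (C * (meshSize L N * normL2 L f)) := by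
  obtain ⟨C, hC0, hC⟩ := exists_Sp_approx m
  refine ⟨C * (2 * q⁻¹), by positivity, fun L N μ hL hN hμ n e he f hf => ?_⟩
  have hS := isFE_femSpace (μ := μ) hL hN (by omega : 2 ≤ m + 2)
  set χ := comb e fun i => ip L f (e i) with hχ
  have hmem : χ ∈ femSpace L N μ (m + 2) := he.comb_mem hS _
  have hriesz : ∀ φ ∈ femSpace L N μ (m + 2), bilin L q χ φ = ip L f φ := fun φ hφ =>
    he.isRiesz hL hS hf.bm hφ
  have hχl := hS.lip _ hmem
  have hd := hχl.sub hf
  obtain ⟨hYl, hYd⟩ := scaled_primitive hL hd.bm q⁻¹ 0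
  set Y := fun x => q⁻¹ * ((∫ t in (-L)..x, (χ t - f t)) - 0) with hY
  have hY0 : Y (-L) = 0 := by simp [hY]
  -- Constants belong to `S_h`; testing with 1 shows that `χ - f` has mean zero.
  have hYL : Y L = 0 := by
    have h1 := hriesz _ (femSpace.const (by omega) 1)
    have e1 : ∫ t in (-L)..L, (χ t - f t) = ip L (fun t => χ t - f t) (fun _ => 1) := by
      simp [ip]
    rw [bilin, deriv_const', show ip L (deriv χ) (fun _ => (0 : ℝ)) = 0 by simp [ip]] at h1
    simp only [hY, sub_zero]
    rw [e1, ip_sub_left hL hχl.bm hf.bm (BM.const 1)]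
    simp only [mul_zero, add_zero] at h1
    rw [h1, sub_self, mul_zero]
  have horth : ∀ φ ∈ femSpace L N μ (m + 2), ip L (fun x => deriv χ x - Y x) (deriv φ) = 0 := by
    intro φ hφ
    have hφl := hS.lip _ hφ
    have h1 := ip_deriv_left_of_zero hL hYl hφl hY0 hYL
    rw [ip_congr hL hYd (EventuallyEq.refl _ φ), ip_smul_left hL,
      ip_sub_left hL hχl.bm hf.bm hφl.bm, ← hriesz φ hφ, bilin] at h1
    rw [ip_sub_left hL hχl.bm_deriv hYl.bm hφl.bm_deriv]
    have h2 : q⁻¹ * (ip L χ φ - (ip L χ φ + q * ip L (deriv χ) (deriv φ)))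
        = -ip L (deriv χ) (deriv φ) := by field_simp; ring
    linarith
  refine ⟨Y, hY0, hYL, ⟨hmem, hriesz, hYl, hYd, ?_⟩⟩
  obtain ⟨s, hs, hsY⟩ := hC L N hL hN Y hYl
  have hψ : (fun x => ∫ t in (-L)..x, s t) ∈ Sp L N (m + 1) := ⟨s, hs, 0, fun x _ => by
    rw [zero_add]⟩
  have hsb := Sp.bm hL hN hs
  have h1 : normL2 L (fun x => deriv χ x - Y x) ≤ normL2 L (fun x => Y x - s x) := by
    refine normL2_sub_le_of_orth hL hχl.bm_deriv hYl.bm hsb ?_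
    rw [horth _ hmem, ← ip_congr hL (EventuallyEq.refl _ _) (primitive_deriv hL hsb),
      horth _ (Sp.mem_femSpace hL hN hμ hψ)]
  have hY' : normL2 L (deriv Y) ≤ 2 * q⁻¹ * normL2 L f :=
    IsDual.norm_deriv_le hL hS hq hf.bm ⟨hmem, hriesz, hYl, hYd, h1⟩
  have hh := meshSize_pos hL hN
  calc _ ≤ C * (meshSize L N * normL2 L (deriv Y)) := h1.trans hsY
    _ ≤ C * (meshSize L N * (2 * q⁻¹ * normL2 L f)) := by gcongr
    _ = _ := by ring

/-- As for `S_h`, except that constants are not available as test functions, so `Y` need not vanish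
at `±L`. Instead its additive constant is free and is chosen to give `Y` mean zero. -/
theorem exists_dual_femSpaceZero (hq : 0 < q) (m : ℕ) : ∃ C, 0 ≤ C ∧ ∀ (L : ℝ)
    (N μ : ℕ), 0 < L → 1 ≤ N → μ ≤ m → ∀ (n : ℕ) (e : Fin n → ℝ → ℝ),
      IsONB L q (femSpaceZero L N μ (m + 2)) e →
      ∀ f, Lip L f → ∃ Y,
        IsDual L q (femSpaceZero L N μ (m + 2)) f (comb e fun i => ip L f (e i)) Y
          (C * (meshSize L N * normL2 L f)) := by
  obtain ⟨C, hC0, hC⟩ := exists_Sp_approx m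
  refine ⟨C * (2 * q⁻¹), by positivity, fun L N μ hL hN hμ n e he f hf => ?_⟩
  have hS := isFE_femSpaceZero (μ := μ) hL hN (by omega : 2 ≤ m + 2)
  set χ := comb e fun i => ip L f (e i) with hχ
  have hmem : χ ∈ femSpaceZero L N μ (m + 2) := he.comb_mem hS _
  have hriesz : ∀ φ ∈ femSpaceZero L N μ (m + 2), bilin L q χ φ = ip L f φ := fun φ hφ =>
    he.isRiesz hL hS hf.bm hφ
  have hχl := hS.lip _ hmem
  have hd := hχl.sub hf
  set c := (2 * L)⁻¹ * ∫ x in (-L)..L, ∫ t in (-L)..x, (χ t - f t) with hc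
  obtain ⟨hYl, hYd⟩ := scaled_primitive hL hd.bm q⁻¹ c
  set Y := fun x => q⁻¹ * ((∫ t in (-L)..x, (χ t - f t)) - c) with hY
  have hYmean : ip L Y (fun _ => 1) = 0 := by
    have hp := primitive_lip hL hd.bm
    have e1 : ip L (fun x => ∫ t in (-L)..x, (χ t - f t)) (fun _ => 1) = 2 * L * c := by
      rw [hc, ← mul_assoc, mul_inv_cancel₀ (by positivity), one_mul]; simp [ip]
    have e2 : ip L (fun _ => c) (fun _ => 1) = 2 * L * c := by
      simp only [ip, mul_one, intervalIntegral.integral_const, smul_eq_mul]; ring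
    rw [hY, ip_smul_left hL, ip_sub_left hL hp.bm (BM.const c) (BM.const 1), e1, e2, sub_self,
      mul_zero]
  have hχmean : ip L (deriv χ) (fun _ => 1) = 0 := by
    rw [ip_deriv_left hL hχl (Lip.const 1), hmem.2.1, hmem.2.2, deriv_const']; simp [ip]
  -- Only the primitive of `s` minus its linear interpolant lies in `S_h^0`. The interpolant
  -- contributes a constant derivative, to which `χ' - Y` is orthogonal by this line.
  have hmean : ip L (fun x => deriv χ x - Y x) (fun _ => 1) = 0 := by
    rw [ip_sub_left hL hχl.bm_deriv hYl.bm (BM.const 1), hYmean, hχmean, sub_self]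
  have horth : ∀ φ ∈ femSpaceZero L N μ (m + 2),
      ip L (fun x => deriv χ x - Y x) (deriv φ) = 0 := by
    intro φ hφ
    have hφl := hS.lip _ hφ
    have h1 := ip_deriv_left_of_zero hL hφl hYl hφ.2.1 hφ.2.2
    rw [ip_congr hL (EventuallyEq.refl _ φ) hYd,
      ip_smul_right hL q⁻¹ φ fun x => χ x - f x,
      ip_sub_right hL hφl.bm hχl.bm hf.bm, ip_comm φ f, ← hriesz φ hφ, bilin, ip_comm φ χ,
      ip_comm (deriv φ) Y] at h1
    rw [ip_sub_left hL hχl.bm_deriv hYl.bm hφl.bm_deriv]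
    have h2 : q⁻¹ * (ip L χ φ - (ip L χ φ + q * ip L (deriv χ) (deriv φ)))
        = -ip L (deriv χ) (deriv φ) := by field_simp; ring
    linarith
  refine ⟨Y, ⟨hmem, hriesz, hYl, hYd, ?_⟩⟩
  obtain ⟨s, hs, hsY⟩ := hC L N hL hN Y hYl
  have hψ : (fun x => ∫ t in (-L)..x, s t) ∈ Sp L N (m + 1) := ⟨s, hs, 0, fun x _ => by
    rw [zero_add]⟩
  have hsb := Sp.bm hL hN hs
  have hψl := primitive_lip hL hsb
  have hψ0 := femSpace.sub_affine hL hN (by omega) (Sp.mem_femSpace hL hN hμ hψ)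
  have h1 : normL2 L (fun x => deriv χ x - Y x) ≤ normL2 L (fun x => Y x - s x) := by
    refine normL2_sub_le_of_orth hL hχl.bm_deriv hYl.bm hsb ?_
    have h3 := horth _ hψ0
    set α := ((∫ t in (-L)..(-L), s t) + ∫ t in (-L)..L, s t) / 2 with hα
    set β := ((∫ t in (-L)..L, s t) - ∫ t in (-L)..(-L), s t) / (2 * L) with hβ
    have hal : Lip L fun x => α + β * x := (Lip.const _).add (Lip.id.const_mul _)
    have t2 : deriv (fun x => α + β * x) = fun _ => β * 1 := by
      funext x
      rw [deriv_const_add, deriv_const_mul_field, deriv_id'']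
    rw [ip_congr hL (EventuallyEq.refl _ _) (hψl.deriv_sub hL hal),
      ip_sub_right hL (hχl.bm_deriv.sub hYl.bm) hψl.bm_deriv hal.bm_deriv, t2, ip_smul_right hL,
      hmean, mul_zero, sub_zero, ip_congr hL (EventuallyEq.refl _ _) (primitive_deriv hL hsb)] at h3
    rw [horth _ hmem, h3]
  have hY' : normL2 L (deriv Y) ≤ 2 * q⁻¹ * normL2 L f :=
    IsDual.norm_deriv_le hL hS hq hf.bm ⟨hmem, hriesz, hYl, hYd, h1⟩
  have hh := meshSize_pos hL hN
  calc _ ≤ C * (meshSize L N * normL2 L (deriv Y)) := h1.trans hsY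
    _ ≤ C * (meshSize L N * (2 * q⁻¹ * normL2 L f)) := by gcongr
    _ = _ := by ring

/-- The Aubin-Nitsche argument: the boundary terms vanish by hypothesis. -/
theorem IsDual.normL2_le (hL : 0 < L) (hS : IsFE L N r S) (hq : 0 < q) {ρ χ Y : ℝ → ℝ} {D : ℝ}
    (hD : 0 ≤ D) (hρ : Lip L ρ) (h : IsDual L q S ρ χ Y (D * normL2 L ρ)) (horth : bilin L q ρ χ = 0)
    (hbd : Y L * ρ L - Y (-L) * ρ (-L) = 0) :
    normL2 L ρ ≤ q * D * normL2 L (deriv ρ) := by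
  have hχl := hS.lip _ h.mem
  have h1 := ip_deriv_left hL h.lip hρ
  rw [hbd, zero_sub, ip_congr hL h.deriv_eq (EventuallyEq.refl _ ρ), ip_smul_left hL,
    ip_sub_left hL hχl.bm hρ.bm hρ.bm] at h1
  rw [bilin_comm, bilin] at horth
  -- Here `ρ = χ - q Y'`: orthogonality replaces `(χ, ρ)` by `-q (χ', ρ')`, and integration by parts
  -- moves the derivative from `Y` to `ρ`.
  have h2 : ip L ρ ρ = -(q * ip L (fun x => deriv χ x - Y x) (deriv ρ)) := by
    rw [ip_sub_left hL hχl.bm_deriv h.lip.bm hρ.bm_deriv]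
    have : ip L χ ρ - ip L ρ ρ = q * -ip L Y (deriv ρ) := by
      rw [← h1, ← mul_assoc, mul_inv_cancel₀ hq.ne', one_mul]
    linarith
  have h3 := abs_ip_le hL (hχl.bm_deriv.sub h.lip.bm) hρ.bm_deriv
  have h4 := mul_le_mul_of_nonneg_right h.close (normL2_nonneg (L := L) (v := deriv ρ))
  have h5 := neg_abs_le (ip L (fun x => deriv χ x - Y x) (deriv ρ))
  have h6 : normL2 L ρ ^ 2 ≤ normL2 L ρ * (q * D * normL2 L (deriv ρ)) := by
    rw [normL2_sq hL, h2]
    nlinarith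
  by_contra! hc
  have h7 : 0 ≤ q * D * normL2 L (deriv ρ) :=
    mul_nonneg (mul_nonneg hq.le hD) normL2_nonneg
  nlinarith

end

noncomputable section

open MeasureTheory
open scoped NNReal ENNReal

variable {L q : ℝ} {f g v w s Y : ℝ → ℝ} {N μ r n : ℕ} {S : Set (ℝ → ℝ)} {e : Fin n → ℝ → ℝ}

/-! ### Error estimates for the elliptic projections -/

theorem IsGalerkin.orth_sub (hL : 0 < L) (hS : IsFE L N r S) {R φ : ℝ → ℝ} (hv : Lip L v)
    (hR : IsGalerkin L q S v R) (hφ : φ ∈ S) : bilin L q (fun x => v x - R x) φ = 0 := by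
  rw [bilin_sub_left hL q hv (hS.lip _ hR.mem) (hS.lip _ hφ), hR.orth _ hφ, sub_self]

/-- Best approximation gives the order `m + 1 = r - 1` in `H¹`. Duality with the error itself as
datum gains one power of `h` in `L²`; its boundary terms vanish because `Y` does at `±L`. -/
theorem exists_projection_femSpace (hL : 0 < L) (hq : 0 < q) (m : ℕ) : ∃ C, 0 ≤ C ∧
    ∀ (N μ : ℕ), 1 ≤ N → μ ≤ m → ∀ (v : ℝ → ℝ) (M : ℝ), 0 ≤ M →
      ContDiffOn ℝ (m + 2 : ℕ) v (dom L) →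
      (∀ x ∈ dom L, |iteratedDerivWithin (m + 2) v (dom L) x| ≤ M) →
      ∀ R, IsGalerkin L q (femSpace L N μ (m + 2)) v R →
        normL2 L (fun x => v x - R x) ≤ C * meshSize L N ^ (m + 2) * M ∧
        normL2 L (deriv fun x => v x - R x) ≤ C * meshSize L N ^ (m + 1) * M := by
  obtain ⟨C₁, hC₁0, hC₁⟩ := exists_femSpace_approx hL m
  obtain ⟨C₂, hC₂0, hC₂⟩ := exists_dual_femSpace hq m
  set B := √((1 + q) / q) * ((√(2 * L) + 1) * C₁) with hB
  have hB0 : 0 ≤ B := by positivity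
  refine ⟨q * C₂ * B + B, by positivity, fun N μ hN hμ v M hM hv hvM R hR => ?_⟩
  have hh := meshSize_pos hL hN
  have hS := isFE_femSpace (μ := μ) hL hN (by omega : 2 ≤ m + 2)
  have hvl : Lip L v := ContDiffOn.lip (by simp) hv
  obtain ⟨ψ, hψ, -, hψv, hψd⟩ := hC₁ N μ hN hμ v M hM hv hvM
  set A := C₁ * meshSize L N ^ (m + 1) * M with hA
  have hA0 : 0 ≤ A := by positivity
  have hψ0 := normL2_le_of_abs_le hL (hvl.sub (hS.lip _ hψ)).bm hA0
    fun x hx => hψv x (Ioo_subset_dom hx)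
  have hd := hR.deriv_le hL hS hq hvl hψ (A := (√(2 * L) + 1) * A) (by linarith)
    (by nlinarith [Real.sqrt_nonneg (2 * L)])
  have e1 : √((1 + q) / q) * ((√(2 * L) + 1) * A) = B * meshSize L N ^ (m + 1) * M := by
    rw [hA, hB]; ring
  rw [e1] at hd
  have hρ := hvl.sub (hS.lip _ hR.mem)
  obtain ⟨n, e, he⟩ := exists_isONB hL hN (by omega) hS hq.le
  obtain ⟨Y, hY0, hYL, hdual⟩ := hC₂ L N μ hL hN hμ n e he _ hρ
  rw [← mul_assoc] at hdual
  have h2 := hdual.normL2_le hL hS hq (by positivity) hρ (hR.orth_sub hL hS hvl hdual.mem)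
    (by rw [hY0, hYL]; ring)
  have hM' : 0 ≤ meshSize L N ^ (m + 1) * M := by positivity
  have hM'' : 0 ≤ meshSize L N ^ (m + 2) * M := by positivity
  constructor
  · calc _ ≤ q * (C₂ * meshSize L N) * (B * meshSize L N ^ (m + 1) * M) :=
          h2.trans (mul_le_mul_of_nonneg_left hd (by positivity))
      _ = q * C₂ * B * (meshSize L N ^ (m + 2) * M) := by ring
      _ ≤ (q * C₂ * B + B) * (meshSize L N ^ (m + 2) * M) :=
          mul_le_mul_of_nonneg_right (by linarith) hM''
      _ = _ := by ring
  · calc _ ≤ B * (meshSize L N ^ (m + 1) * M) := hd.trans (le_of_eq (by ring))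
      _ ≤ (q * C₂ * B + B) * (meshSize L N ^ (m + 1) * M) :=
          mul_le_mul_of_nonneg_right (le_add_of_nonneg_left (by positivity)) hM'
      _ = _ := by ring

/-- In contrast to `S_h`, the boundary terms of the duality argument vanish because the error `v -
R` is zero at `±L`. -/
theorem exists_projection_femSpaceZero (hL : 0 < L) (hq : 0 < q) (m : ℕ) : ∃ C, 0 ≤ C ∧
    ∀ (N μ : ℕ), 1 ≤ N → μ ≤ m → ∀ (v : ℝ → ℝ) (M : ℝ), 0 ≤ M →
      ContDiffOn ℝ (m + 2 : ℕ) v (dom L) →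
      (∀ x ∈ dom L, |iteratedDerivWithin (m + 2) v (dom L) x| ≤ M) → v (-L) = 0 → v L = 0 →
      ∀ R, IsGalerkin L q (femSpaceZero L N μ (m + 2)) v R →
        normL2 L (fun x => v x - R x) ≤ C * meshSize L N ^ (m + 2) * M ∧
        normL2 L (deriv fun x => v x - R x) ≤ C * meshSize L N ^ (m + 1) * M := by
  obtain ⟨C₁, hC₁0, hC₁⟩ := exists_femSpaceZero_approx hL m
  obtain ⟨C₂, hC₂0, hC₂⟩ := exists_dual_femSpaceZero hq m
  set B := √((1 + q) / q) * ((√(2 * L) + 1) * C₁) with hB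
  have hB0 : 0 ≤ B := by positivity
  refine ⟨q * C₂ * B + B, by positivity, fun N μ hN hμ v M hM hv hvM h0 h1 R hR => ?_⟩
  have hh := meshSize_pos hL hN
  have hS := isFE_femSpaceZero (μ := μ) hL hN (by omega : 2 ≤ m + 2)
  have hvl : Lip L v := ContDiffOn.lip (by simp) hv
  obtain ⟨ψ, hψ, hψv, hψd⟩ := hC₁ N μ hN hμ v M hM hv hvM h0 h1
  set A := C₁ * meshSize L N ^ (m + 1) * M with hA
  have hA0 : 0 ≤ A := by positivity
  have hψ0 := normL2_le_of_abs_le hL (hvl.sub (hS.lip _ hψ)).bm hA0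
    fun x hx => hψv x (Ioo_subset_dom hx)
  have hd := hR.deriv_le hL hS hq hvl hψ (A := (√(2 * L) + 1) * A) (by linarith)
    (by nlinarith [Real.sqrt_nonneg (2 * L)])
  have e1 : √((1 + q) / q) * ((√(2 * L) + 1) * A) = B * meshSize L N ^ (m + 1) * M := by
    rw [hA, hB]; ring
  rw [e1] at hd
  have hρ := hvl.sub (hS.lip _ hR.mem)
  obtain ⟨n, e, he⟩ := exists_isONB hL hN (by omega) hS hq.le
  obtain ⟨Y, hdual⟩ := hC₂ L N μ hL hN hμ n e he _ hρ
  rw [← mul_assoc] at hdual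
  have h2 := hdual.normL2_le hL hS hq (by positivity) hρ (hR.orth_sub hL hS hvl hdual.mem)
    (by rw [h0, h1, hR.mem.2.1, hR.mem.2.2]; ring)
  have hM' : 0 ≤ meshSize L N ^ (m + 1) * M := by positivity
  have hM'' : 0 ≤ meshSize L N ^ (m + 2) * M := by positivity
  constructor
  · calc _ ≤ q * (C₂ * meshSize L N) * (B * meshSize L N ^ (m + 1) * M) :=
          h2.trans (mul_le_mul_of_nonneg_left hd (by positivity))
      _ = q * C₂ * B * (meshSize L N ^ (m + 2) * M) := by ring
      _ ≤ (q * C₂ * B + B) * (meshSize L N ^ (m + 2) * M) :=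
          mul_le_mul_of_nonneg_right (by linarith) hM''
      _ = _ := by ring
  · calc _ ≤ B * (meshSize L N ^ (m + 1) * M) := hd.trans (le_of_eq (by ring))
      _ ≤ (q * C₂ * B + B) * (meshSize L N ^ (m + 1) * M) :=
          mul_le_mul_of_nonneg_right (le_add_of_nonneg_left (by positivity)) hM'
      _ = _ := by ring

/-- The derivative of the discrete solution `χ` of `A_q(χ, ψ) = (f, ψ)` in `S_h` is close to an
element `W` of `S_h^0`. -/
theorem exists_dual_close (hq : 0 < q) (m : ℕ) : ∃ C, 0 ≤ C ∧ ∀ (L : ℝ)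
    (N μ : ℕ), 0 < L → 1 ≤ N → μ ≤ m → ∀ (n : ℕ) (e : Fin n → ℝ → ℝ),
      IsONB L q (femSpace L N μ (m + 2)) e → ∀ f, Lip L f →
      normL2 L (deriv (comb e fun i => ip L f (e i))) ≤ C * normL2 L f ∧
      ∃ W ∈ femSpaceZero L N μ (m + 2),
        normL2 L (fun x => deriv (comb e fun i => ip L f (e i)) x - W x)
          ≤ C * (meshSize L N * normL2 L f) ∧
        normL2 L (deriv W) ≤ C * normL2 L f := by
  obtain ⟨C₁, hC₁0, hC₁⟩ := exists_dual_femSpace hq m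
  obtain ⟨C₂, hC₂0, hC₂⟩ := exists_Sp_approx_zero m
  refine ⟨C₁ + C₂ * (2 * q⁻¹) + (√q)⁻¹, by positivity, fun L N μ hL hN hμ n e he f hf => ?_⟩
  have hh := meshSize_pos hL hN
  have hS := isFE_femSpace (μ := μ) hL hN (by omega : 2 ≤ m + 2)
  obtain ⟨Y, hY0, hYL, hdual⟩ := hC₁ L N μ hL hN hμ n e he f hf
  have hχl := hS.lip _ hdual.mem
  have hχd := (normL2_riesz_le hL hS hq hf.bm hdual.mem (hdual.riesz _ hdual.mem)).2
  have hY' := hdual.norm_deriv_le hL hS hq hf.bm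
  have hn := normL2_nonneg (L := L) (v := f)
  have t1 : 0 ≤ C₂ * (2 * q⁻¹) * normL2 L f := by positivity
  have t2 : 0 ≤ (√q)⁻¹ * normL2 L f := by positivity
  have t3 : 0 ≤ C₁ * normL2 L f := by positivity
  refine ⟨by linarith, ?_⟩
  -- `χ'` is in general discontinuous, but `Y` is Lipschitz and vanishes at `±L`; its stable spline
  -- approximation is the required `W`.
  obtain ⟨W, hW, hW0, hWL, hWY, hWd⟩ := hC₂ L N hL hN Y hdual.lip hY0 hYL
  have hWl := Sp.lip hL hN hW
  refine ⟨W, ⟨Sp.mem_femSpace hL hN hμ hW, hW0, hWL⟩, ?_, ?_⟩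
  · have h1 := normL2_sub_trans hL hχl.bm_deriv hdual.lip.bm hWl.bm
    have h2 := hdual.close
    have h3 : C₂ * (meshSize L N * normL2 L (deriv Y))
        ≤ meshSize L N * (C₂ * (2 * q⁻¹) * normL2 L f) := by
      have := mul_le_mul_of_nonneg_left hY' (by positivity : 0 ≤ C₂ * meshSize L N)
      linarith
    have h4 := mul_nonneg hh.le t2
    linarith
  · have := mul_le_mul_of_nonneg_left hY' hC₂0
    linarith

/-! ### The discrete Laplacian -/

/-- The definition tested with `z` gives `‖z‖² ≤ ‖ξ'‖ ‖z'‖`, and the inverse inequality bounds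
`‖z'‖` by `‖z‖ / h`. -/
theorem exists_laplacian_inverse (r : ℕ) : ∃ C, 0 ≤ C ∧ ∀ (L : ℝ) (N μ : ℕ), 0 < L → 1 ≤ N →
    ∀ ξ z : ℝ → ℝ, Lip L ξ → IsDiscreteLaplacian L (femSpaceZero L N μ r) ξ z →
      meshSize L N * normL2 L z ≤ C * normL2 L (deriv ξ) := by
  obtain ⟨C, hC0, hC⟩ := exists_inverse_inequality r
  refine ⟨C, hC0, fun L N μ hL hN ξ z hξ hz => ?_⟩
  have hh := meshSize_pos hL hN
  have hzl := femSpace.lip hL hN hz.1.1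
  have h1 := hC L N μ hL hN z hz.1.1
  have h2 := hz.2 z hz.1
  have h3 := abs_ip_le hL hξ.bm_deriv hzl.bm_deriv
  have h4 := neg_abs_le (ip L (deriv ξ) (deriv z))
  rw [← normL2_sq hL] at h2
  have n1 := normL2_nonneg (L := L) (v := z)
  have n2 := normL2_nonneg (L := L) (v := deriv ξ)
  have h5 : normL2 L z ^ 2 ≤ normL2 L (deriv ξ) * normL2 L (deriv z) := by linarith
  have h6 : meshSize L N * normL2 L z ^ 2 ≤ C * normL2 L (deriv ξ) * normL2 L z := by
    have := mul_le_mul_of_nonneg_left h1 n2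
    have := mul_le_mul_of_nonneg_left h5 hh.le
    nlinarith
  by_contra! hc
  have h7 : 0 ≤ C * normL2 L (deriv ξ) := by positivity
  have h8 : 0 < normL2 L z := by
    by_contra! h0
    have : normL2 L z = 0 := le_antisymm h0 n1
    rw [this, mul_zero] at hc; linarith
  nlinarith

/-- Because `R` is the `A_d`-projection, `(w - z, φ) = d⁻¹ (v - R, φ)` on `S_h^0`, so no derivative
of the projection error appears. It remains to compare `w` with an approximant `ψ` in `S_h^0` and to
take `φ = ψ - z`. -/
theorem exists_laplacian_consistency (hL : 0 < L) {d : ℝ} (hd : 0 < d) (m : ℕ) : ∃ C, 0 ≤ C ∧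
    ∀ (N μ : ℕ), 1 ≤ N → μ ≤ m → ∀ (v w R z : ℝ → ℝ) (M : ℝ), 0 ≤ M → Lip L v →
      ContDiffOn ℝ (m + 1 : ℕ) w (dom L) →
      (∀ x ∈ dom L, |iteratedDerivWithin (m + 1) w (dom L) x| ≤ M) → w (-L) = 0 → w L = 0 →
      (∀ φ, Lip L φ → φ (-L) = 0 → φ L = 0 → ip L (deriv v) (deriv φ) = -ip L w φ) →
      IsGalerkin L d (femSpaceZero L N μ (m + 2)) v R →
      IsDiscreteLaplacian L (femSpaceZero L N μ (m + 2)) R z →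
      normL2 L (fun x => w x - z x)
        ≤ C * (meshSize L N ^ (m + 1) * M + normL2 L fun x => v x - R x) := by
  obtain ⟨C, hC0, hC⟩ := exists_femSpaceZero_approx_L2 hL m
  refine ⟨2 * C + d⁻¹, by positivity,
    fun N μ hN hμ v w R z M hM hv hw hwM h0 h1 hvw hR hz => ?_⟩
  have hh := meshSize_pos hL hN
  have hS := isFE_femSpaceZero (μ := μ) hL hN (by omega : 2 ≤ m + 2)
  obtain ⟨ψ, hψ, hψw⟩ := hC N μ hN hμ w M hM hw hwM h0 h1
  have hwb := ContinuousOn.bm hw.continuousOn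
  have hψl := hS.lip _ hψ
  have hzl := hS.lip _ hz.1
  have hRl := hS.lip _ hR.mem
  have hφ := hS.sub hψ hz.1
  have hφl := hS.lip _ hφ
  have e1 := hz.2 _ hφ
  have e2 := hR.orth _ hφ
  have e3 := hvw _ hφl hφ.2.1 hφ.2.2
  have e4 : ip L (fun x => ψ x - z x) (fun x => ψ x - z x)
      = -ip L (fun x => w x - ψ x) (fun x => ψ x - z x)
        + d⁻¹ * ip L (fun x => v x - R x) (fun x => ψ x - z x) := by
    rw [ip_sub_left hL hψl.bm hzl.bm hφl.bm, ip_sub_left hL hwb hψl.bm hφl.bm,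
      ip_sub_left hL hv.bm hRl.bm hφl.bm, e1]
    rw [bilin, bilin, e3] at e2
    have : ip L v (fun x => ψ x - z x) - ip L R (fun x => ψ x - z x)
      = d * (ip L (deriv R) (deriv fun x => ψ x - z x) + ip L w fun x => ψ x - z x) := by linarith
    rw [this]
    field_simp
    ring
  have n1 := normL2_nonneg (L := L) (v := fun x => ψ x - z x)
  have n2 := normL2_nonneg (L := L) (v := fun x => v x - R x)
  have n3 := normL2_nonneg (L := L) (v := fun x => w x - ψ x)
  have hdi := inv_pos.2 hd
  have e5 : normL2 L (fun x => ψ x - z x)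
      ≤ normL2 L (fun x => w x - ψ x) + d⁻¹ * normL2 L (fun x => v x - R x) := by
    have a1 := abs_ip_le hL (hwb.sub hψl.bm) hφl.bm
    have a2 := ip_le hL (hv.sub hRl).bm hφl.bm
    have a3 := neg_abs_le (ip L (fun x => w x - ψ x) (fun x => ψ x - z x))
    rw [← normL2_sq hL] at e4
    by_contra! hc
    have := mul_le_mul_of_nonneg_left a2 hdi.le
    have h9 : 0 ≤ normL2 L (fun x => w x - ψ x) + d⁻¹ * normL2 L (fun x => v x - R x) := by
      positivity
    nlinarith
  have e6 := normL2_sub_trans hL hwb hψl.bm hzl.bm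
  have t1 : 0 ≤ C * normL2 L (fun x => v x - R x) := by positivity
  have t2 : 0 ≤ d⁻¹ * (meshSize L N ^ (m + 1) * M) := by positivity
  nlinarith

end

noncomputable section

open MeasureTheory
open scoped NNReal ENNReal

variable {T : ℝ} {ι : Type*} [Fintype ι]

/-! ### Truncation -/

/-- The truncation of `s` to `[-R, R]`. -/
def clip (R s : ℝ) : ℝ := max (-R) (min s R)

theorem abs_clip_le {R : ℝ} (hR : 0 ≤ R) (s : ℝ) : |clip R s| ≤ R :=
  abs_le.2 ⟨le_max_left _ _, max_le (by linarith) (min_le_right _ _)⟩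

theorem clip_eq {R s : ℝ} (h : |s| ≤ R) : clip R s = s := by
  rw [abs_le] at h
  rw [clip, min_eq_left h.2, max_eq_right h.1]

theorem abs_clip_sub_le (R s t : ℝ) : |clip R s - clip R t| ≤ |s - t| := by
  have h1 := abs_max_sub_max_le_abs (min s R) (min t R) (-R)
  have h2 := abs_min_sub_min_le_max s R t R
  rw [clip, clip, max_comm, max_comm (-R)]
  refine h1.trans (h2.trans ?_)
  simp

theorem abs_clip_le_abs {R : ℝ} (hR : 0 ≤ R) (s : ℝ) : |clip R s| ≤ |s| := by
  have h := abs_clip_sub_le R s 0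
  rwa [clip_eq (s := 0) (by simpa using hR), sub_zero, sub_zero] at h

/-! ### Ordinary differential equations -/

/-- The Gronwall inequality. -/
theorem le_exp_of_deriv_le {E E' : ℝ → ℝ} {K ε : ℝ} (hc : ContinuousOn E (Icc 0 T))
    (hd : ∀ t ∈ Ioo 0 T, HasDerivAt E (E' t) t) (hle : ∀ t ∈ Ioo 0 T, E' t ≤ K * (E t + ε)) :
    ∀ t ∈ Icc 0 T, E t + ε ≤ Real.exp (K * t) * (E 0 + ε) := by
  have hF : ∀ t ∈ Ioo 0 T, HasDerivAt (fun t => Real.exp (-K * t) * (E t + ε))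
      (Real.exp (-K * t) * (-K * 1) * (E t + ε) + Real.exp (-K * t) * E' t) t := fun t ht =>
    (((hasDerivAt_id t).const_mul (-K)).exp).mul ((hd t ht).add_const ε)
  have hanti : AntitoneOn (fun t => Real.exp (-K * t) * (E t + ε)) (Icc 0 T) := by
    refine antitoneOn_of_deriv_nonpos (convex_Icc 0 T) ?_ ?_ ?_
    · exact (Continuous.continuousOn (by fun_prop)).mul (hc.add continuousOn_const)
    · rw [interior_Icc]
      exact fun t ht => (hF t ht).differentiableAt.differentiableWithinAt
    · rw [interior_Icc]
      intro t ht
      rw [(hF t ht).deriv]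
      have := hle t ht
      have he := Real.exp_pos (-K * t)
      nlinarith
  intro t ht
  have h := hanti ⟨le_rfl, ht.1.trans ht.2⟩ ht ht.1
  simp only [mul_zero, Real.exp_zero, one_mul] at h
  have h2 := mul_le_mul_of_nonneg_left h (Real.exp_pos (K * t)).le
  rwa [← mul_assoc, ← Real.exp_add, show K * t + -K * t = 0 by ring, Real.exp_zero, one_mul] at h2

theorem lipschitz_clip (R : ℝ) : LipschitzWith 1 fun (x : ι → ℝ) i => clip R (x i) := by
  refine LipschitzWith.of_dist_le_mul fun x y => ?_
  rw [NNReal.coe_one, one_mul, dist_pi_le_iff dist_nonneg]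
  intro i
  rw [Real.dist_eq]
  refine (abs_clip_sub_le _ _ _).trans ?_
  rw [← Real.dist_eq]
  exact dist_le_pi_dist x y i

theorem LipschitzWith.norm_le_add {G : (ι → ℝ) → ι → ℝ} {K : ℝ≥0} (hG : LipschitzWith K G)
    (x : ι → ℝ) : ‖G x‖ ≤ K * ‖x‖ + ‖G 0‖ := by
  have h := hG.dist_le_mul x 0
  rw [dist_zero_right, dist_eq_norm] at h
  linarith [norm_sub_norm_le (G x) (G 0)]

/-- With speed at most `B` no trajectory leaves the ball of radius `B * T` before time `T`, so one
application of Picard-Lindelöf covers the whole interval. -/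
theorem exists_ode_solution_of_bounded (hT : 0 ≤ T) {G : (ι → ℝ) → ι → ℝ} {K B : ℝ≥0}
    (hG : LipschitzWith K G) (hB : ∀ x, ‖G x‖ ≤ B) (x₀ : ι → ℝ) : ∃ α : ℝ → ι → ℝ, α 0 = x₀ ∧
      ∀ t ∈ Icc 0 T, HasDerivWithinAt α (G (α t)) (Icc 0 T) t := by
  have h : IsPicardLindelof (fun _ => G) (⟨0, le_rfl, hT⟩ : Icc (0 : ℝ) T) x₀
      (B * ⟨T, hT⟩) 0 B K := by
    refine IsPicardLindelof.of_time_independent (fun x _ => hB x) hG.lipschitzOnWith ?_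
    simp only [sub_zero, sub_self, NNReal.coe_zero, max_eq_left hT]
    exact le_rfl
  exact h.exists_eq_forall_mem_Icc_hasDerivWithinAt₀

/-- Global existence for a globally Lipschitz right hand side. -/
theorem exists_ode_solution (hT : 0 ≤ T) {G : (ι → ℝ) → ι → ℝ} {K : ℝ≥0}
    (hG : LipschitzWith K G) (x₀ : ι → ℝ) : ∃ α : ℝ → ι → ℝ, α 0 = x₀ ∧
      ∀ t ∈ Icc 0 T, HasDerivWithinAt α (G (α t)) (Icc 0 T) t := by
  -- `R` is the a priori bound at time `T`. The field composed with clipping at `R` is bounded and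
  -- obeys the same linear growth bound, so its solution stays below `R` and the clipping never
  -- acts.
  set R := max (gronwallBound ‖x₀‖ K ‖G 0‖ T) 0 with hR
  have hR0 : 0 ≤ R := le_max_right _ _
  have hc : LipschitzWith K fun x : ι → ℝ => G fun i => clip R (x i) := by
    have h := hG.comp (lipschitz_clip (ι := ι) R)
    rwa [mul_one] at h
  have hn : ∀ x : ι → ℝ, ‖fun i => clip R (x i)‖ ≤ R ∧ ‖fun i => clip R (x i)‖ ≤ ‖x‖ := fun x =>
    ⟨(pi_norm_le_iff_of_nonneg hR0).2 fun i => abs_clip_le hR0 _,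
      (pi_norm_le_iff_of_nonneg (norm_nonneg x)).2 fun i =>
        (abs_clip_le_abs hR0 _).trans (norm_le_pi_norm x i)⟩
  obtain ⟨α, h0, hα⟩ := exists_ode_solution_of_bounded hT hc
    (B := K * ⟨R, hR0⟩ + ‖G 0‖₊) (fun x => (LipschitzWith.norm_le_add hG _).trans (by
      have := (hn x).1
      have hK := K.2
      change _ ≤ (K : ℝ) * R + ‖G 0‖
      gcongr)) x₀
  have hb := norm_le_gronwallBound_of_norm_deriv_right_le (f := α)
    (f' := fun t => G fun i => clip R (α t i)) (δ := ‖x₀‖) (K := K) (ε := ‖G 0‖) (a := 0) (b := T)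
    (fun t ht => (hα t ht).continuousWithinAt)
    (fun t ht => ((hα t ⟨ht.1, ht.2.le⟩).mono_of_mem_nhdsWithin (Icc_mem_nhdsGE_of_mem ht)))
    (by rw [h0]) fun t _ => (LipschitzWith.norm_le_add hG _).trans (by
      have := (hn (α t)).2
      have hK := K.2
      gcongr)
  refine ⟨α, h0, fun t ht => ?_⟩
  have h1 : ∀ i, clip R (α t i) = α t i := fun i => clip_eq <| by
    refine (norm_le_pi_norm (α t) i).trans ((hb t ht).trans (le_trans ?_ (le_max_left _ _)))
    rw [sub_zero]
    exact gronwallBound_mono (norm_nonneg _) (norm_nonneg _) K.2 ht.2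
  have h2 := hα t ht
  simp only [h1] at h2
  exact h2

/-- Gronwall for the sum of squared coordinate differences. Only continuity is required at `t = 0`,
as semidiscrete solutions need not be differentiable there. The cardinality enters because each of
the summands of the derivative is bounded by means of the sup norm. -/
theorem ode_solution_unique {G : (ι → ℝ) → ι → ℝ} {K : ℝ≥0} (hG : LipschitzWith K G)
    {α β : ℝ → ι → ℝ} (hα : ∀ i, ContinuousOn (fun t => α t i) (Icc 0 T))
    (hβ : ∀ i, ContinuousOn (fun t => β t i) (Icc 0 T))
    (hα' : ∀ t ∈ Ioo 0 T, ∀ i, HasDerivAt (fun t => α t i) (G (α t) i) t)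
    (hβ' : ∀ t ∈ Ioo 0 T, ∀ i, HasDerivAt (fun t => β t i) (G (β t) i) t) (h0 : α 0 = β 0) :
    ∀ t ∈ Icc 0 T, α t = β t := by
  have h := le_exp_of_deriv_le (T := T) (E := fun t => ∑ i, (α t i - β t i) ^ 2)
    (E' := fun t => ∑ i, (2 : ℕ) * (α t i - β t i) ^ (2 - 1) * (G (α t) i - G (β t) i))
    (K := Fintype.card ι * (2 * K)) (ε := 0)
    (continuousOn_finsetSum _ fun i _ => ((hα i).sub (hβ i)).pow 2)
    (fun t ht => HasDerivAt.fun_sum fun i _ => ((hα' t ht i).sub (hβ' t ht i)).pow 2)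
    (by
      intro t _
      rw [add_zero, mul_assoc, ← nsmul_eq_mul]
      refine Finset.sum_le_card_nsmul _ _ _ fun i _ => ?_
      have h1 : |G (α t) i - G (β t) i| ≤ K * ‖α t - β t‖ := by
        rw [← dist_eq_norm]
        exact (dist_le_pi_dist (G (α t)) (G (β t)) i).trans (hG.dist_le_mul _ _)
      have h2 : |α t i - β t i| ≤ ‖α t - β t‖ := norm_le_pi_norm (α t - β t) i
      have h3 : ‖α t - β t‖ ^ 2 ≤ ∑ i, (α t i - β t i) ^ 2 := by
        refine (Real.sqrt_le_sqrt_iff (by positivity)).1 ?_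
        rw [Real.sqrt_sq (norm_nonneg _)]
        refine (pi_norm_le_iff_of_nonneg (Real.sqrt_nonneg _)).2 fun i => ?_
        rw [Real.norm_eq_abs, ← Real.sqrt_sq_eq_abs]
        exact Real.sqrt_le_sqrt (Finset.single_le_sum (f := fun i => (α t i - β t i) ^ 2)
          (fun i _ => sq_nonneg _) (Finset.mem_univ i))
      have hK := K.2
      calc _ ≤ |(2 : ℕ) * (α t i - β t i) ^ (2 - 1) * (G (α t) i - G (β t) i)| := le_abs_self _
        _ = 2 * (|α t i - β t i| * |G (α t) i - G (β t) i|) := by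
          rw [abs_mul, abs_mul]; norm_num; ring
        _ ≤ 2 * (‖α t - β t‖ * (K * ‖α t - β t‖)) := by gcongr
        _ = 2 * K * ‖α t - β t‖ ^ 2 := by ring
        _ ≤ 2 * K * ∑ i, (α t i - β t i) ^ 2 := by gcongr)
  intro t ht
  have h1 := h t ht
  simp only [h0, sub_self, ne_eq, OfNat.ofNat_ne_zero, not_false_eq_true, zero_pow,
    Finset.sum_const_zero, add_zero, mul_zero] at h1
  funext i
  have h2 := (Finset.single_le_sum (f := fun i => (α t i - β t i) ^ 2)
    (fun i _ => sq_nonneg _) (Finset.mem_univ i)).trans h1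
  exact sub_eq_zero.1 (pow_eq_zero_iff two_ne_zero |>.1 (le_antisymm h2 (sq_nonneg _)))

end

noncomputable section

open MeasureTheory
open scoped NNReal ENNReal

variable {L T q : ℝ} {v w φ χ : ℝ → ℝ} {f g f' g' : ℝ → ℝ → ℝ} {η₀ u₀ : ℝ → ℝ} {η u : ℝ → ℝ → ℝ}
  {a b d : ℝ} {r : ℕ}

/-! ### Spatial derivatives -/

theorem dx_zero (L : ℝ) (v : ℝ → ℝ) : dx L 0 v = v := by
  funext x; simp [dx]

theorem dx_succ (L : ℝ) (j : ℕ) (v : ℝ → ℝ) : dx L (j + 1) v = derivWithin (dx L j v) (dom L) :=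
  iteratedDerivWithin_succ (𝕜 := ℝ) (n := j) (f := v) (s := dom L)

theorem dx_add (L : ℝ) (k j : ℕ) (v : ℝ → ℝ) : dx L k (dx L j v) = dx L (k + j) v := by
  induction k with
  | zero => rw [dx_zero, zero_add]
  | succ k ih => rw [dx_succ, ih, Nat.add_right_comm, dx_succ]

theorem contDiffOn_dx (hL : 0 < L) : ∀ {j k : ℕ}, ContDiffOn ℝ (k + j : ℕ) v (dom L) →
    ContDiffOn ℝ k (dx L j v) (dom L)
  | 0, k, h => by rw [dx_zero]; exact h
  | j + 1, k, h => by
    have h1 : ContDiffOn ℝ (k + 1 : ℕ) (dx L j v) (dom L) :=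
      contDiffOn_dx hL (by rwa [Nat.add_right_comm])
    rw [dx_succ]
    rw [Nat.cast_add, Nat.cast_one] at h1
    exact ((contDiffOn_succ_iff_derivWithin (uniqueDiffOn_dom hL)).1 h1).2.2

theorem deriv_eqOn_dx (v : ℝ → ℝ) : EqOn (deriv v) (dx L 1 v) (Ioo (-L) L) := fun x hx => by
  rw [dx_succ, dx_zero, derivWithin_of_mem_nhds (dom_mem_nhds hx)]

theorem hasDerivWithinAt_dx (hL : 0 < L) {j : ℕ} (hv : ContDiffOn ℝ (j + 1 : ℕ) v (dom L)) {x : ℝ}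
    (hx : x ∈ dom L) : HasDerivWithinAt (dx L j v) (dx L (j + 1) v x) (dom L) x := by
  rw [dx_succ]
  have h1 : ContDiffOn ℝ (1 : ℕ) (dx L j v) (dom L) := contDiffOn_dx hL (by rwa [add_comm])
  exact (h1.differentiableOn (by simp) x hx).hasDerivWithinAt

theorem ip_dx_left (hL : 0 < L) (hv : ContDiffOn ℝ 1 v (dom L)) (hφ : Lip L φ) :
    ip L (dx L 1 v) φ = v L * φ L - v (-L) * φ (-L) - ip L v (deriv φ) := by
  rw [← ip_deriv_left hL (ContDiffOn.lip one_ne_zero hv) hφ]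
  exact ip_congr hL (ae_eq_of_Ioo (deriv_eqOn_dx v).symm) (EventuallyEq.refl _ φ)

/-! ### Time derivatives of families of functions -/

theorem isCompact_rect (T L : ℝ) : IsCompact (Icc (0 : ℝ) T ×ˢ dom L) :=
  isCompact_Icc.prod isCompact_Icc

theorem exists_unif_cont (hg : ContinuousOn (fun p : ℝ × ℝ => g p.1 p.2) (Icc 0 T ×ˢ dom L)) {ε : ℝ}
    (hε : 0 < ε) : ∃ δ > 0, ∀ s ∈ Icc 0 T, ∀ t ∈ Icc 0 T, ∀ x ∈ dom L, ∀ y ∈ dom L,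
      |s - t| < δ → |x - y| < δ → |g s x - g t y| < ε := by
  obtain ⟨δ, hδ, h⟩ := Metric.uniformContinuousOn_iff.1
    ((isCompact_rect T L).uniformContinuousOn_of_continuous hg) ε hε
  refine ⟨δ, hδ, fun s hs t ht x hx y hy h1 h2 => h (s, x) ⟨hs, hx⟩ (t, y) ⟨ht, hy⟩ ?_⟩
  rw [Prod.dist_eq]
  exact max_lt h1 h2

theorem exists_bound_rect (hg : ContinuousOn (fun p : ℝ × ℝ => g p.1 p.2) (Icc 0 T ×ˢ dom L)) :
    ∃ M, 0 ≤ M ∧ ∀ t ∈ Icc 0 T, ∀ x ∈ dom L, |g t x| ≤ M := by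
  obtain ⟨C, hC⟩ := (isCompact_rect T L).exists_bound_of_continuousOn hg
  exact ⟨max C 0, le_max_right _ _, fun t ht x hx =>
    (hC (t, x) ⟨ht, hx⟩).trans (le_max_left _ _)⟩

theorem continuousOn_slice (hg : ContinuousOn (fun p : ℝ × ℝ => g p.1 p.2) (Icc 0 T ×ˢ dom L))
    {t : ℝ} (ht : t ∈ Icc 0 T) : ContinuousOn (g t) (dom L) :=
  hg.comp (f := fun x => (t, x)) (Continuous.continuousOn (by fun_prop)) fun _ hx => ⟨ht, hx⟩

/-- `g` is the time derivative of `f` at interior times. -/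
def IsTimeDeriv (L T : ℝ) (f g : ℝ → ℝ → ℝ) : Prop :=
  ∀ t ∈ Ioo 0 T, ∀ x ∈ dom L, HasDerivAt (fun s => f s x) (g t x) t

theorem abs_sub_sub_le_of_hasDerivWithinAt {p p' : ℝ → ℝ} {s : Set ℝ} (hs : Convex ℝ s)
    (h : ∀ x ∈ s, HasDerivWithinAt p (p' x) s x) {c ε : ℝ} (hc : ∀ x ∈ s, |p' x - c| ≤ ε) {x y : ℝ}
    (hx : x ∈ s) (hy : y ∈ s) : |p y - p x - c * (y - x)| ≤ ε * |y - x| := by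
  have h1 := hs.norm_image_sub_le_of_norm_hasDerivWithin_le (f := fun z => p z - c * z)
    (f' := fun z => p' z - c * 1) (C := ε)
    (fun z hz => (h z hz).sub ((hasDerivWithinAt_id z s).const_mul c))
    (fun z hz => by rw [mul_one]; exact hc z hz) hx hy
  rw [Real.norm_eq_abs, Real.norm_eq_abs] at h1
  rwa [show p y - p x - c * (y - x) = p y - c * y - (p x - c * x) by ring]

/-- Interchange of `∂_t` and `∂_x`: the difference quotients of `f` in `x` have as time derivatives
those of `g`, which converge uniformly in time because `g'` is uniformly continuous. The punctured
filter within `[-L, L]` covers the end points. -/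
theorem IsTimeDeriv.deriv_space (hL : 0 < L) (h : IsTimeDeriv L T f g)
    (hf : ∀ t ∈ Ioo 0 T, ∀ x ∈ dom L, HasDerivWithinAt (f t) (f' t x) (dom L) x)
    (hg : ∀ t ∈ Ioo 0 T, ∀ x ∈ dom L, HasDerivWithinAt (g t) (g' t x) (dom L) x)
    (hg' : ContinuousOn (fun p : ℝ × ℝ => g' p.1 p.2) (Icc 0 T ×ˢ dom L)) :
    IsTimeDeriv L T f' g' := by
  intro t ht x hx
  have hne : NeBot (𝓝[dom L \ {x}] x) := by
    have := (uniqueDiffOn_dom hL x hx)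
    rwa [uniqueDiffWithinAt_iff_accPt, accPt_principal_iff_nhdsWithin] at this
  refine hasDerivAt_of_tendstoUniformlyOn (l := 𝓝[dom L \ {x}] x)
    (f := fun y s => (y - x)⁻¹ * (f s y - f s x)) (f' := fun y s => (y - x)⁻¹ * (g s y - g s x))
    (g := fun s => f' s x) (g' := fun s => g' s x) isOpen_Ioo ?_ ?_ ?_ ht
  · rw [Metric.tendstoUniformlyOn_iff]
    intro ε hε
    obtain ⟨δ, hδ, hu⟩ := exists_unif_cont hg' (half_pos hε)
    have h1 : ∀ᶠ y in 𝓝[dom L \ {x}] x, |y - x| < δ :=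
      nhdsWithin_le_nhds (Metric.ball_mem_nhds x hδ)
    filter_upwards [h1, self_mem_nhdsWithin] with y hy hyx s hs
    have hs' := Ioo_subset_Icc_self hs
    have hsub : uIcc x y ⊆ dom L := OrdConnected.uIcc_subset ordConnected_Icc hx hyx.1
    have h2 := abs_sub_sub_le_of_hasDerivWithinAt (convex_uIcc x y) (c := g' s x) (ε := ε / 2)
      (fun z hz => (hg s hs z (hsub hz)).mono hsub)
      (fun z hz => (hu s hs' s hs' z (hsub hz) x hx (by simpa using hδ)
        ((abs_sub_left_of_mem_uIcc hz).trans_lt hy)).le) left_mem_uIcc right_mem_uIcc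
    have hne : y - x ≠ 0 := sub_ne_zero.2 hyx.2
    rw [dist_comm, Real.dist_eq]
    have h3 : (y - x)⁻¹ * (g s y - g s x) - g' s x
        = (y - x)⁻¹ * (g s y - g s x - g' s x * (y - x)) := by field_simp
    rw [h3, abs_mul, abs_inv]
    have h4 := abs_pos.2 hne
    calc _ ≤ |y - x|⁻¹ * (ε / 2 * |y - x|) := by gcongr
      _ = ε / 2 := by field_simp
      _ < ε := half_lt_self hε
  · filter_upwards [self_mem_nhdsWithin] with y hy s hs
    exact ((h s hs y hy.1).sub (h s hs x hx)).const_mul _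
  · intro s hs
    have := hasDerivWithinAt_iff_tendsto_slope.1 (hf s hs x hx)
    exact this

/-- The inner product with a bounded function, differentiated in time. -/
theorem IsTimeDeriv.ip_left (hL : 0 < L) (h : IsTimeDeriv L T f g)
    (hf : ContinuousOn (fun p : ℝ × ℝ => f p.1 p.2) (Icc 0 T ×ˢ dom L))
    (hg : ContinuousOn (fun p : ℝ × ℝ => g p.1 p.2) (Icc 0 T ×ˢ dom L)) (hw : BM L w) {t : ℝ}
    (ht : t ∈ Ioo 0 T) : HasDerivAt (fun s => ip L (f s) w) (ip L (g t) w) t := by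
  rw [hasDerivAt_iff_isLittleO, Asymptotics.isLittleO_iff]
  intro c hc
  set B := √(2 * L) * (normL2 L w + 1) with hB
  have n1 := normL2_nonneg (L := L) (v := w)
  have hB0 : 0 < B := by positivity
  obtain ⟨δ, hδ, hu⟩ := exists_unif_cont hg (div_pos hc hB0)
  have ht' := Ioo_subset_Icc_self ht
  filter_upwards [Metric.ball_mem_nhds t hδ, Ioo_mem_nhds ht.1 ht.2] with s hs hs'
  have hs0 := Ioo_subset_Icc_self hs'
  have hsub : uIcc t s ⊆ Ioo 0 T := OrdConnected.uIcc_subset ordConnected_Ioo ht hs'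
  have b1 : BM L (f s) := ContinuousOn.bm (continuousOn_slice hf hs0)
  have b2 : BM L (f t) := ContinuousOn.bm (continuousOn_slice hf ht')
  have b3 : BM L (g t) := ContinuousOn.bm (continuousOn_slice hg ht')
  have e1 : ip L (f s) w - ip L (f t) w - (s - t) • ip L (g t) w
      = ip L (fun x => f s x - f t x - (s - t) * g t x) w := by
    rw [ip_sub_left hL (b1.sub b2) (b3.const_mul _) hw, ip_sub_left hL b1 b2 hw,
      ip_smul_left hL, smul_eq_mul]
  rw [e1]
  refine (abs_ip_le hL ((b1.sub b2).sub (b3.const_mul _)) hw).trans ?_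
  have h1 : normL2 L (fun x => f s x - f t x - (s - t) * g t x)
      ≤ √(2 * L) * (c / B * |s - t|) := by
    refine normL2_le_of_abs_le hL ((b1.sub b2).sub (b3.const_mul _)) (by positivity)
      fun x hx => ?_
    have hx' := Ioo_subset_dom hx
    rw [mul_comm (s - t)]
    exact abs_sub_sub_le_of_hasDerivWithinAt (convex_uIcc t s)
      (fun z hz => (h z (hsub hz) x hx').hasDerivWithinAt)
      (fun z hz => (hu z (Ioo_subset_Icc_self (hsub hz)) t ht' x hx' x hx'
        ((abs_sub_left_of_mem_uIcc hz).trans_lt hs) (by simpa using hδ)).le)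
      left_mem_uIcc right_mem_uIcc
  rw [Real.norm_eq_abs]
  calc _ ≤ √(2 * L) * (c / B * |s - t|) * (normL2 L w + 1) := by gcongr; linarith
    _ = c * |s - t| := by rw [hB]; field_simp

theorem continuousOn_ip_left (hL : 0 < L)
    (hf : ContinuousOn (fun p : ℝ × ℝ => f p.1 p.2) (Icc 0 T ×ˢ dom L)) (hw : BM L w) :
    ContinuousOn (fun s => ip L (f s) w) (Icc 0 T) := by
  rw [Metric.continuousOn_iff]
  intro t ht ε hε
  have n1 := normL2_nonneg (L := L) (v := w)
  set B := √(2 * L) * (normL2 L w + 1) with hB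
  have hB0 : 0 < B := by positivity
  obtain ⟨δ, hδ, hu⟩ := exists_unif_cont hf (div_pos (half_pos hε) hB0)
  refine ⟨δ, hδ, fun s hs hst => ?_⟩
  have b1 : BM L (f s) := ContinuousOn.bm (continuousOn_slice hf hs)
  have b2 : BM L (f t) := ContinuousOn.bm (continuousOn_slice hf ht)
  rw [Real.dist_eq, ← ip_sub_left hL b1 b2 hw]
  refine (abs_ip_le hL (b1.sub b2) hw).trans_lt ?_
  have h1 : normL2 L (fun x => f s x - f t x) ≤ √(2 * L) * (ε / 2 / B) := by
    refine normL2_le_of_abs_le hL (b1.sub b2) (by positivity) fun x hx => ?_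
    have hx' := Ioo_subset_dom hx
    exact (hu s hs t ht x hx' x hx' hst (by simpa using hδ)).le
  calc _ ≤ √(2 * L) * (ε / 2 / B) * (normL2 L w + 1) := by gcongr; linarith
    _ = ε / 2 := by rw [hB]; field_simp
    _ < ε := half_lt_self hε

end

noncomputable section

open MeasureTheory
open scoped NNReal ENNReal

variable {L T q : ℝ} {v w φ χ : ℝ → ℝ} {f g f' g' : ℝ → ℝ → ℝ} {η₀ u₀ : ℝ → ℝ} {η u : ℝ → ℝ → ℝ}
  {a b d : ℝ} {r : ℕ}

/-! ### The classical solution -/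

theorem hasDerivWithinAt_dx_one (hL : 0 < L) (hv : ContDiffOn ℝ 1 v (dom L)) {x : ℝ}
    (hx : x ∈ dom L) : HasDerivWithinAt v (dx L 1 v x) (dom L) x := by
  have h := hasDerivWithinAt_dx (j := 0) hL (by simpa using hv) hx
  rwa [dx_zero] at h

theorem bilin_eq_dx (hL : 0 < L) (q : ℝ) (v φ : ℝ → ℝ) :
    bilin L q v φ = ip L v φ + q * ip L (dx L 1 v) (deriv φ) := by
  rw [bilin, ip_congr hL (ae_eq_of_Ioo (deriv_eqOn_dx v)) (EventuallyEq.refl _ _)]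

theorem eqOn_dom_of_eqOn_Ioo (hL : 0 < L) {v w : ℝ → ℝ} (hv : ContinuousOn v (dom L))
    (hw : ContinuousOn w (dom L)) (h : EqOn v w (Ioo (-L) L)) : EqOn v w (dom L) :=
  h.of_subset_closure hv hw Ioo_subset_dom (by rw [closure_Ioo (by linarith)]; rfl)

theorem ContinuousInto.continuousOn_zero (h : ContinuousInto L T r f) :
    ContinuousOn (fun p : ℝ × ℝ => f p.1 p.2) (Icc 0 T ×ˢ dom L) := by
  have := h.2 0 (Nat.zero_le _)
  simpa only [dx_zero] using this

namespace IsClassicalSolution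

theorem isTimeDeriv_of (h : TimeDifferentiable L T f) : IsTimeDeriv L T f (dt T f) :=
  fun t ht x hx => ((h x hx t (Ioo_subset_Icc_self ht)).hasDerivWithinAt).hasDerivAt
    (Icc_mem_nhds ht.1 ht.2)

theorem isTimeDeriv_dx_one (hL : 0 < L) {k : ℕ} (hk : 1 ≤ k) (h : ContinuousInto L T k f)
    (hd : TimeDifferentiable L T f) (ht : ContinuousInto L T 2 (dt T f)) :
    IsTimeDeriv L T (fun t => dx L 1 (f t)) (fun t => dx L 1 (dt T f t)) :=
  (isTimeDeriv_of hd).deriv_space hL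
    (fun t ht x hx => hasDerivWithinAt_dx_one hL
      ((h.1 t (Ioo_subset_Icc_self ht)).of_le (by exact_mod_cast hk)) hx)
    (fun s hs x hx => hasDerivWithinAt_dx_one hL
      ((ht.1 s (Ioo_subset_Icc_self hs)).of_le (by norm_num)) hx)
    (ht.2 1 (by norm_num))

theorem isTimeDeriv_dx_two (hL : 0 < L) {k : ℕ} (hk : 2 ≤ k) (h : ContinuousInto L T k f)
    (hd : TimeDifferentiable L T f) (ht : ContinuousInto L T 2 (dt T f)) :
    IsTimeDeriv L T (fun t => dx L 2 (f t)) (fun t => dx L 2 (dt T f t)) :=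
  (isTimeDeriv_dx_one hL (by omega) h hd ht).deriv_space hL
    (fun t ht _ hx => hasDerivWithinAt_dx hL
      ((h.1 t (Ioo_subset_Icc_self ht)).of_le (by exact_mod_cast hk)) hx)
    (fun s hs _ hx => hasDerivWithinAt_dx hL (ht.1 s (Ioo_subset_Icc_self hs)) hx)
    (ht.2 2 le_rfl)

theorem isTimeDeriv_eq_zero (h : IsTimeDeriv L T f g) {x : ℝ} (hx : x ∈ dom L)
    (h0 : ∀ t ∈ Ioo 0 T, f t x = 0) : ∀ t ∈ Ioo 0 T, g t x = 0 := fun t ht => by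
  refine (h t ht x hx).unique ((hasDerivAt_const t (0 : ℝ)).congr_of_eventuallyEq ?_)
  filter_upwards [Ioo_mem_nhds ht.1 ht.2] with s hs using h0 s hs

theorem momentum_dom (h : IsClassicalSolution L T a b d r η₀ u₀ η u)
    (hL : 0 < L) (hr : 2 ≤ r) : ∀ t ∈ Ioo 0 T, ∀ x ∈ dom L,
    dt T u t x + dx L 1 (η t) x + u t x * dx L 1 (u t) x - d * dx L 2 (dt T u t) x = 0 := by
  intro t ht
  have ht' := Ioo_subset_Icc_self ht
  have c1 := continuousOn_slice h.regular_u_t.continuousOn_zero ht'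
  have c2 := continuousOn_slice (g := fun t => dx L 1 (η t)) (h.regular_η.2 1 (by omega)) ht'
  have c3 := continuousOn_slice h.regular_u.continuousOn_zero ht'
  have c4 := continuousOn_slice (g := fun t => dx L 1 (u t)) (h.regular_u.2 1 (by omega)) ht'
  have c5 := continuousOn_slice (g := fun t => dx L 2 (dt T u t)) (h.regular_u_t.2 2 le_rfl) ht'
  exact eqOn_dom_of_eqOn_Ioo hL (((c1.add c2).add (c3.mul c4)).sub (c5.const_mul d))
    continuousOn_const (h.momentum t ht)

/-- This hidden boundary condition removes the boundary terms of `b η_xxt`. At `x = ±L` both `u` and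
`u_xx` vanish for all times, hence so do `u_t` and `u_xxt`; the momentum equation, continued to the
boundary, leaves `η_x = 0`, which is then differentiated in time. -/
theorem dx_one_dt_boundary (h : IsClassicalSolution L T a b d r η₀ u₀ η u)
    (hL : 0 < L) (hr : 2 ≤ r) : ∀ t ∈ Ioo 0 T,
    dx L 1 (dt T η t) (-L) = 0 ∧ dx L 1 (dt T η t) L = 0 := by
  have key : ∀ x ∈ dom L, (∀ t ∈ Ioo 0 T, u t x = 0 ∧ dx L 2 (u t) x = 0) →
      ∀ t ∈ Ioo 0 T, dx L 1 (dt T η t) x = 0 := by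
    intro x hx h0
    have h1 := isTimeDeriv_eq_zero (isTimeDeriv_of h.differentiable_u) hx fun t ht => (h0 t ht).1
    have h2 := isTimeDeriv_eq_zero (isTimeDeriv_dx_two hL (by omega) h.regular_u h.differentiable_u
      h.regular_u_t) hx fun t ht => (h0 t ht).2
    refine isTimeDeriv_eq_zero (isTimeDeriv_dx_one hL (by omega) h.regular_η h.differentiable_η
      h.regular_η_t) hx fun t ht => ?_
    have h3 := h.momentum_dom hL hr t ht x hx
    have h4 : dx L 2 (dt T u t) x = 0 := h2 t ht
    rw [h1 t ht, (h0 t ht).1, h4] at h3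
    linarith
  intro t ht
  exact ⟨key _ (left_mem_dom hL) (fun s hs => ⟨(h.boundary s (Ioo_subset_Icc_self hs)).1,
      (h.boundary_xx s (Ioo_subset_Icc_self hs)).1⟩) t ht,
    key _ (right_mem_dom hL) (fun s hs => ⟨(h.boundary s (Ioo_subset_Icc_self hs)).2,
      (h.boundary_xx s (Ioo_subset_Icc_self hs)).2⟩) t ht⟩

/-- The test function need not vanish at `±L`. The flux vanishes there by the conditions on `u` and
`u_xx`, and `η_xt` does by `dx_one_dt_boundary`. -/
theorem weak_mass (h : IsClassicalSolution L T a b d r η₀ u₀ η u)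
    (hL : 0 < L) (hr : 2 ≤ r) {t : ℝ} (ht : t ∈ Ioo 0 T) (hχ : Lip L χ) :
    bilin L b (dt T η t) χ
      = ip L (fun x => u t x + η t x * u t x + a * dx L 2 (u t) x) (deriv χ) := by
  have ht' := Ioo_subset_Icc_self ht
  have r1 : ContDiffOn ℝ 2 (dt T η t) (dom L) := h.regular_η_t.1 t ht'
  have r2 : ContDiffOn ℝ (1 : ℕ) (η t) (dom L) :=
    (h.regular_η.1 t ht').of_le (by exact_mod_cast (by omega : 1 ≤ r))
  have r3 : ContDiffOn ℝ (1 : ℕ) (u t) (dom L) :=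
    (h.regular_u.1 t ht').of_le (by exact_mod_cast (by omega : 1 ≤ r + 1))
  have r4 : ContDiffOn ℝ (1 : ℕ) (dx L 2 (u t)) (dom L) :=
    contDiffOn_dx hL ((h.regular_u.1 t ht').of_le (by exact_mod_cast (by omega : 3 ≤ r + 1)))
  have r5 : ContDiffOn ℝ (1 : ℕ) (dx L 1 (dt T η t)) (dom L) := contDiffOn_dx hL r1
  rw [Nat.cast_one] at r2 r3 r4 r5
  set F := fun x => u t x + η t x * u t x + a * dx L 2 (u t) x with hF
  have rF : ContDiffOn ℝ 1 F (dom L) := (r3.add (r2.mul r3)).add (contDiffOn_const.mul r4)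
  have hF' : EqOn (deriv F) (fun x => b * dx L 1 (dx L 1 (dt T η t)) x - dt T η t x)
      (Ioo (-L) L) := by
    intro x hx
    have hx' := Ioo_subset_dom hx
    have hm := h.mass t ht x hx
    have d1 := (hasDerivWithinAt_dx_one hL r3 hx').hasDerivAt (dom_mem_nhds hx)
    have d2 := (hasDerivWithinAt_dx_one hL (r2.mul r3) hx').hasDerivAt (dom_mem_nhds hx)
    have d3 := (hasDerivWithinAt_dx_one hL r4 hx').hasDerivAt (dom_mem_nhds hx)
    rw [dx_add] at d3
    have d4 := ((d1.add d2).add (d3.const_mul a)).deriv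
    change deriv F x = _ at d4
    rw [d4, dx_add]
    change _ + dx L 1 (fun y => η t y * u t y) x + _ = _
    norm_num at hm ⊢
    linarith
  have b1 : BM L (dx L 1 (dx L 1 (dt T η t))) := by
    rw [dx_add]
    exact ContinuousOn.bm (continuousOn_slice (g := fun t => dx L 2 (dt T η t))
      (h.regular_η_t.2 2 le_rfl) ht')
  have b2 : BM L (dt T η t) := ContinuousOn.bm r1.continuousOn
  obtain ⟨n1, n2⟩ := h.dx_one_dt_boundary hL hr t ht
  obtain ⟨o1, o2⟩ := h.boundary t ht'
  obtain ⟨p1, p2⟩ := h.boundary_xx t ht'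
  have i1 := ip_dx_left hL r5 hχ
  have i2 := ip_deriv_left_of_zero hL (ContDiffOn.lip one_ne_zero rF) hχ (by simp [hF, o1, p1])
    (by simp [hF, o2, p2])
  rw [ip_congr hL (ae_eq_of_Ioo hF') (EventuallyEq.refl _ _),
    ip_sub_left hL (b1.const_mul b) b2 hχ.bm, ip_smul_left hL, i1, n1, n2] at i2
  rw [bilin_eq_dx hL]
  linarith

theorem weak_momentum (h : IsClassicalSolution L T a b d r η₀ u₀ η u)
    (hL : 0 < L) (hr : 2 ≤ r) {t : ℝ} (ht : t ∈ Ioo 0 T) (hφ : Lip L φ)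
    (h0 : φ (-L) = 0) (h1 : φ L = 0) :
    bilin L d (dt T u t) φ = ip L (fun x => η t x + u t x ^ 2 / 2) (deriv φ) := by
  have ht' := Ioo_subset_Icc_self ht
  have r1 : ContDiffOn ℝ 2 (dt T u t) (dom L) := h.regular_u_t.1 t ht'
  have r2 : ContDiffOn ℝ (1 : ℕ) (η t) (dom L) :=
    (h.regular_η.1 t ht').of_le (by exact_mod_cast (by omega : 1 ≤ r))
  have r3 : ContDiffOn ℝ (1 : ℕ) (u t) (dom L) :=
    (h.regular_u.1 t ht').of_le (by exact_mod_cast (by omega : 1 ≤ r + 1))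
  have r5 : ContDiffOn ℝ (1 : ℕ) (dx L 1 (dt T u t)) (dom L) := contDiffOn_dx hL r1
  rw [Nat.cast_one] at r2 r3 r5
  set G := fun x => η t x + u t x ^ 2 / 2 with hG
  have rG : ContDiffOn ℝ 1 G (dom L) := r2.add ((r3.pow 2).div_const 2)
  have hG' : EqOn (deriv G) (fun x => d * dx L 1 (dx L 1 (dt T u t)) x - dt T u t x)
      (Ioo (-L) L) := by
    intro x hx
    have hx' := Ioo_subset_dom hx
    have hm := h.momentum t ht x hx
    have d1 := (hasDerivWithinAt_dx_one hL r2 hx').hasDerivAt (dom_mem_nhds hx)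
    have d2 := (hasDerivWithinAt_dx_one hL r3 hx').hasDerivAt (dom_mem_nhds hx)
    have d4 := (d1.add ((d2.pow 2).div_const 2)).deriv
    change deriv G x = _ at d4
    rw [d4, dx_add]
    norm_num at hm ⊢
    linarith
  have b1 : BM L (dx L 1 (dx L 1 (dt T u t))) := by
    rw [dx_add]
    exact ContinuousOn.bm (continuousOn_slice (g := fun t => dx L 2 (dt T u t))
      (h.regular_u_t.2 2 le_rfl) ht')
  have b2 : BM L (dt T u t) := ContinuousOn.bm r1.continuousOn
  have i1 := ip_dx_left hL r5 hφ
  have i2 := ip_deriv_left hL (ContDiffOn.lip one_ne_zero rG) hφ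
  rw [ip_congr hL (ae_eq_of_Ioo hG') (EventuallyEq.refl _ _),
    ip_sub_left hL (b1.const_mul d) b2 hφ.bm, ip_smul_left hL, i1, h0, h1] at i2
  rw [bilin_eq_dx hL]
  linarith

theorem continuousOn_bilin (hL : 0 < L) {k : ℕ} (hk : 1 ≤ k) (hf : ContinuousInto L T k f)
    (q : ℝ) (hχ : Lip L χ) : ContinuousOn (fun t => bilin L q (f t) χ) (Icc 0 T) := by
  simp only [bilin_eq_dx hL]
  exact (continuousOn_ip_left hL hf.continuousOn_zero hχ.bm).add
    ((continuousOn_ip_left hL (f := fun t => dx L 1 (f t)) (hf.2 1 hk) hχ.bm_deriv).const_mul q)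

theorem hasDerivAt_bilin (hL : 0 < L) {k : ℕ} (hk : 1 ≤ k) (hf : ContinuousInto L T k f)
    (hd : TimeDifferentiable L T f) (hf' : ContinuousInto L T 2 (dt T f)) (q : ℝ) (hχ : Lip L χ)
    {t : ℝ} (ht : t ∈ Ioo 0 T) :
    HasDerivAt (fun t => bilin L q (f t) χ) (bilin L q (dt T f t) χ) t := by
  simp only [bilin_eq_dx hL]
  exact ((isTimeDeriv_of hd).ip_left hL hf.continuousOn_zero hf'.continuousOn_zero hχ.bm ht).add
    (((isTimeDeriv_dx_one hL hk hf hd hf').ip_left hL (hf.2 1 hk) (hf'.2 1 (by norm_num))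
      hχ.bm_deriv ht).const_mul q)

end IsClassicalSolution

/-- The properties of the classical solution that enter the error analysis; `w` stands for `u_xx`
and `M` bounds the solution and its spatial derivatives of highest order. -/
structure IsWeakSolution (L T a b d : ℝ) (m : ℕ) (M : ℝ) (η u w : ℝ → ℝ → ℝ) : Prop where
  M_nonneg : 0 ≤ M
  contDiff_η : ∀ t ∈ Icc 0 T, ContDiffOn ℝ (m + 2 : ℕ) (η t) (dom L)
  contDiff_u : ∀ t ∈ Icc 0 T, ContDiffOn ℝ (m + 2 : ℕ) (u t) (dom L)
  contDiff_w : ∀ t ∈ Icc 0 T, ContDiffOn ℝ (m + 1 : ℕ) (w t) (dom L)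
  η_le : ∀ t ∈ Icc 0 T, ∀ x ∈ dom L, |η t x| ≤ M
  u_le : ∀ t ∈ Icc 0 T, ∀ x ∈ dom L, |u t x| ≤ M
  top_η_le : ∀ t ∈ Icc 0 T, ∀ x ∈ dom L, |iteratedDerivWithin (m + 2) (η t) (dom L) x| ≤ M
  top_u_le : ∀ t ∈ Icc 0 T, ∀ x ∈ dom L, |iteratedDerivWithin (m + 2) (u t) (dom L) x| ≤ M
  top_w_le : ∀ t ∈ Icc 0 T, ∀ x ∈ dom L, |iteratedDerivWithin (m + 1) (w t) (dom L) x| ≤ M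
  boundary : ∀ t ∈ Icc 0 T, u t (-L) = 0 ∧ u t L = 0
  boundary_w : ∀ t ∈ Icc 0 T, w t (-L) = 0 ∧ w t L = 0
  weak_w : ∀ t ∈ Icc 0 T, ∀ φ, Lip L φ → φ (-L) = 0 → φ L = 0 →
    ip L (deriv (u t)) (deriv φ) = -ip L (w t) φ
  continuous_η : ∀ χ, Lip L χ → ContinuousOn (fun t => bilin L b (η t) χ) (Icc 0 T)
  continuous_u : ∀ χ, Lip L χ → ContinuousOn (fun t => bilin L d (u t) χ) (Icc 0 T)
  mass : ∀ t ∈ Ioo 0 T, ∀ χ, Lip L χ → HasDerivAt (fun t => bilin L b (η t) χ)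
    (ip L (fun x => u t x + η t x * u t x + a * w t x) (deriv χ)) t
  momentum : ∀ t ∈ Ioo 0 T, ∀ φ, Lip L φ → φ (-L) = 0 → φ L = 0 →
    HasDerivAt (fun t => bilin L d (u t) φ) (ip L (fun x => η t x + u t x ^ 2 / 2) (deriv φ)) t

theorem IsClassicalSolution.exists_isWeakSolution {m : ℕ} (hL : 0 < L)
    (h : IsClassicalSolution L T a b d (m + 2) η₀ u₀ η u) :
    ∃ M, IsWeakSolution L T a b d m M η u fun t => dx L 2 (u t) := by
  obtain ⟨M₁, p1, k1⟩ := exists_bound_rect h.regular_η.continuousOn_zero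
  obtain ⟨M₂, p2, k2⟩ := exists_bound_rect h.regular_u.continuousOn_zero
  obtain ⟨M₃, p3, k3⟩ := exists_bound_rect (g := fun t => dx L (m + 2) (η t))
    (h.regular_η.2 _ le_rfl)
  obtain ⟨M₄, p4, k4⟩ := exists_bound_rect (g := fun t => dx L (m + 2) (u t))
    (h.regular_u.2 (m + 2) (by omega))
  obtain ⟨M₅, p5, k5⟩ := exists_bound_rect (g := fun t => dx L (m + 1 + 2) (u t))
    (h.regular_u.2 _ (by omega))
  have s : ∀ t ∈ Icc 0 T, ContDiffOn ℝ (m + 1 + 2 : ℕ) (u t) (dom L) := h.regular_u.1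
  refine ⟨M₁ + M₂ + M₃ + M₄ + M₅, by positivity, h.regular_η.1,
    fun t ht => (s t ht).of_le (by exact_mod_cast (by omega : m + 2 ≤ m + 1 + 2)),
    fun t ht => contDiffOn_dx hL (s t ht),
    fun t ht x hx => (k1 t ht x hx).trans (by linarith),
    fun t ht x hx => (k2 t ht x hx).trans (by linarith),
    fun t ht x hx => (k3 t ht x hx).trans (by linarith),
    fun t ht x hx => (k4 t ht x hx).trans (by linarith),
    fun t ht x hx => ?_, h.boundary, h.boundary_xx, ?_,
    fun χ hχ => continuousOn_bilin hL (by omega) h.regular_η b hχ,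
    fun χ hχ => continuousOn_bilin hL (by omega) h.regular_u d hχ, ?_, ?_⟩
  · have h1 := k5 t ht x hx
    rw [← dx_add] at h1
    exact h1.trans (by linarith)
  · intro t ht φ hφ h0 h1
    have r1 : ContDiffOn ℝ (1 : ℕ) (dx L 1 (u t)) (dom L) :=
      contDiffOn_dx hL ((s t ht).of_le (by exact_mod_cast (by omega : 1 + 1 ≤ m + 1 + 2)))
    rw [Nat.cast_one] at r1
    have h2 := ip_dx_left hL r1 hφ
    rw [dx_add, h0, h1] at h2
    rw [ip_congr hL (ae_eq_of_Ioo (deriv_eqOn_dx (u t))) (EventuallyEq.refl _ _)]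
    norm_num at h2
    linarith
  · intro t ht χ hχ
    rw [← h.weak_mass hL (by omega) ht hχ]
    exact hasDerivAt_bilin hL (by omega) h.regular_η h.differentiable_η h.regular_η_t b hχ ht
  · intro t ht φ hφ h0 h1
    rw [← h.weak_momentum hL (by omega) ht hφ h0 h1]
    exact hasDerivAt_bilin hL (by omega) h.regular_u h.differentiable_u h.regular_u_t d hφ ht

end

/-! ### Truncated fluxes and the discrete Laplacian in coordinates -/

noncomputable section

open MeasureTheory
open scoped NNReal ENNReal

variable {L T : ℝ} {a b d M : ℝ} {N μ r n k l : ℕ} {v w φ : ℝ → ℝ}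
  {e : Fin n → ℝ → ℝ} {g : Fin k → ℝ → ℝ} {f : Fin l → ℝ → ℝ} {η₀ u₀ : ℝ → ℝ}

/-- Orthonormal bases of `S_h` for `A_b`, of `S_h^0` for `A_d`, and of `S_h^0` in `L²`. -/
structure IsBases (L b d : ℝ) (N μ r : ℕ) (e : Fin n → ℝ → ℝ) (g : Fin k → ℝ → ℝ)
    (f : Fin l → ℝ → ℝ) : Prop where
  e_onb : IsONB L b (femSpace L N μ r) e
  g_onb : IsONB L d (femSpaceZero L N μ r) g
  f_onb : IsONB L 0 (femSpaceZero L N μ r) f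
  fe : IsFE L N r (femSpace L N μ r)
  fe_zero : IsFE L N r (femSpaceZero L N μ r)

/-- The discrete Laplacian in terms of an `L²`-orthonormal basis. -/
def lap (L : ℝ) (f : Fin l → ℝ → ℝ) (v : ℝ → ℝ) : ℝ → ℝ :=
  comb f fun j => -ip L (deriv v) (deriv (f j))

theorem bilin_zero (L : ℝ) (v w : ℝ → ℝ) : bilin L 0 v w = ip L v w := by simp [bilin]

theorem isDiscreteLaplacian_lap (hL : 0 < L) {S : Set (ℝ → ℝ)} (hS : IsFE L N r S)
    (hf : IsONB L 0 S f) (hv : Lip L v) : IsDiscreteLaplacian L S v (lap L f v) := by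
  refine ⟨hf.comb_mem hS _, fun φ hφ => ?_⟩
  rw [← bilin_zero, lap, hf.bilin_comb_right hL hS _ hφ, hf.ip_deriv_right hL hS hv.bm_deriv hφ,
    ← Finset.sum_neg_distrib]
  simp

/-- Identifies the discrete Laplacian supplied by a semidiscrete solution with the explicit `lap`;
the difference of two candidates is tested with itself. -/
theorem IsDiscreteLaplacian.eqOn (hL : 0 < L) {S : Set (ℝ → ℝ)} (hS : IsFE L N r S)
    {v v' z z' : ℝ → ℝ} (hv : EqOn v v' (dom L)) (h : IsDiscreteLaplacian L S v z)
    (h' : IsDiscreteLaplacian L S v' z') : EqOn z z' (dom L) := by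
  have hm := hS.sub h.1 h'.1
  have hl := hS.lip _ hm
  have h1 : ip L (fun x => z x - z' x) (fun x => z x - z' x) = 0 := by
    rw [ip_sub_left hL (hS.lip _ h.1).bm (hS.lip _ h'.1).bm hl.bm, h.2 _ hm, h'.2 _ hm,
      ip_congr hL (ae_eq_of_Ioo (deriv_eqOn_of_dom hv)) (EventuallyEq.refl _ _), sub_self]
  exact fun x hx => sub_eq_zero.1 (ip_self_eq_zero hL hl.continuousOn h1 x hx)

/-- The flux `u + η u + a ∂_h² u`, with the product truncated. -/
def massFlux (L a M : ℝ) (f : Fin l → ℝ → ℝ) (Y U : ℝ → ℝ) (x : ℝ) : ℝ :=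
  U x + clip M (Y x) * clip M (U x) + a * lap L f U x

/-- The flux `η + u² / 2`, with the square truncated. -/
def momentumFlux (M : ℝ) (Y U : ℝ → ℝ) (x : ℝ) : ℝ := Y x + clip M (U x) ^ 2 / 2

theorem continuous_clip (M : ℝ) : Continuous (clip M) := by
  unfold clip; fun_prop

theorem bm_clip (hv : Lip L v) : BM L fun x => clip M (v x) :=
  ContinuousOn.bm ((continuous_clip M).comp_continuousOn hv.continuousOn)

theorem lip_comb (he : ∀ i, Lip L (e i)) (y : Fin n → ℝ) : Lip L (comb e y) :=
  Lip.sum _ fun i _ => (he i).const_mul (y i)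

theorem bm_massFlux (hf : ∀ i, Lip L (f i)) {Y U : ℝ → ℝ} (hY : Lip L Y) (hU : Lip L U) :
    BM L (massFlux L a M f Y U) :=
  (hU.bm.add ((bm_clip hY).mul (bm_clip hU))).add ((lip_comb hf _).bm.const_mul a)

theorem momentumFlux_eq (M : ℝ) (Y U : ℝ → ℝ) :
    momentumFlux M Y U = fun x => Y x + 1 / 2 * (clip M (U x) * clip M (U x)) := by
  funext x
  simp only [momentumFlux]
  ring

theorem bm_momentumFlux {Y U : ℝ → ℝ} (hY : Lip L Y) (hU : Lip L U) :
    BM L (momentumFlux M Y U) := by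
  rw [momentumFlux_eq]
  exact hY.bm.add (((bm_clip (M := M) hU).mul (bm_clip (M := M) hU)).const_mul (1 / 2))

/-! ### Functions depending on parameters in a Lipschitz manner -/

section Param

variable {ι : Type*} [Fintype ι]

/-- `F x` depends on `x` in a Lipschitz manner, uniformly on `[-L, L]`. -/
def PLip (L : ℝ) (F : (ι → ℝ) → ℝ → ℝ) : Prop :=
  ∃ K, 0 ≤ K ∧ ∀ x y, ∀ s ∈ dom L, |F x s - F y s| ≤ K * ‖x - y‖

variable {F G : (ι → ℝ) → ℝ → ℝ}

theorem PLip.coord (L : ℝ) (i : ι) : PLip L fun (x : ι → ℝ) _ => x i :=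
  ⟨1, zero_le_one, fun x y s _ => by
    rw [one_mul]
    exact norm_le_pi_norm (x - y) i⟩

theorem PLip.add (hF : PLip L F) (hG : PLip L G) : PLip L fun x s => F x s + G x s := by
  obtain ⟨K, hK, h⟩ := hF
  obtain ⟨K', hK', h'⟩ := hG
  refine ⟨K + K', by positivity, fun x y s hs => ?_⟩
  rw [show F x s + G x s - (F y s + G y s) = (F x s - F y s) + (G x s - G y s) by ring, add_mul]
  exact (abs_add_le _ _).trans (add_le_add (h x y s hs) (h' x y s hs))

theorem PLip.mul (hF : PLip L F) (hG : PLip L G) {A B : ℝ} (hA : ∀ x, ∀ s ∈ dom L, |F x s| ≤ A)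
    (hB : ∀ x, ∀ s ∈ dom L, |G x s| ≤ B) : PLip L fun x s => F x s * G x s := by
  obtain ⟨K, hK, h⟩ := hF
  obtain ⟨K', hK', h'⟩ := hG
  refine ⟨K * max B 0 + max A 0 * K', by positivity, fun x y s hs => ?_⟩
  rw [show F x s * G x s - F y s * G y s = (F x s - F y s) * G x s + F y s * (G x s - G y s) by
    ring]
  refine (abs_add_le _ _).trans ?_
  rw [abs_mul, abs_mul]
  have h1 := h x y s hs
  have h2 := h' x y s hs
  have h3 := (hB x s hs).trans (le_max_left B 0)
  have h4 := (hA y s hs).trans (le_max_left A 0)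
  calc _ ≤ K * ‖x - y‖ * max B 0 + max A 0 * (K' * ‖x - y‖) := by gcongr
    _ = _ := by ring

theorem PLip.mul_fixed (hF : PLip L F) (hv : Lip L v) : PLip L fun x s => F x s * v s := by
  obtain ⟨K, hK, h⟩ := hF
  obtain ⟨C, hC, hC'⟩ := ContinuousOn.exists_bound_dom hv.continuousOn
  refine ⟨K * C, by positivity, fun x y s hs => ?_⟩
  rw [← sub_mul, abs_mul]
  have h1 := h x y s hs
  have h2 := hC' s hs
  calc _ ≤ K * ‖x - y‖ * C := by gcongr
    _ = _ := by ring

theorem PLip.const_mul (c : ℝ) (hF : PLip L F) : PLip L fun x s => c * F x s := by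
  simpa only [mul_comm c] using hF.mul_fixed (Lip.const c)

theorem PLip.sum {κ : Type*} (s : Finset κ) {F : κ → (ι → ℝ) → ℝ → ℝ} (h : ∀ i, PLip L (F i)) :
    PLip L fun x t => ∑ i ∈ s, F i x t := by
  classical
  induction s using Finset.induction_on with
  | empty => exact ⟨0, le_rfl, fun x y t _ => by simp⟩
  | insert i s hi ih =>
    simp only [Finset.sum_insert hi]
    exact (h i).add ih

theorem PLip.clip (hF : PLip L F) : PLip L fun x s => clip M (F x s) := by
  obtain ⟨K, hK, h⟩ := hF
  exact ⟨K, hK, fun x y s hs => (abs_clip_sub_le _ _ _).trans (h x y s hs)⟩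

theorem PLip.comb (he : ∀ i, Lip L (e i)) {c : (ι → ℝ) → Fin n → ℝ}
    (hc : ∀ i, PLip L fun x _ => c x i) : PLip L fun x => comb e (c x) :=
  PLip.sum _ fun i => (hc i).mul_fixed (he i)

theorem PLip.ip (hL : 0 < L) (hF : PLip L F) (hb : ∀ x, BM L (F x)) (hw : BM L w) :
    PLip L fun x _ => ip L (F x) w := by
  obtain ⟨K, hK, h⟩ := hF
  refine ⟨√(2 * L) * K * normL2 L w, mul_nonneg (by positivity) normL2_nonneg,
    fun x y s _ => ?_⟩
  rw [← ip_sub_left hL (hb x) (hb y) hw]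
  refine (abs_ip_le hL ((hb x).sub (hb y)) hw).trans ?_
  have h1 := normL2_le_of_abs_le hL ((hb x).sub (hb y)) (mul_nonneg hK (norm_nonneg (x - y)))
    fun s hs => h x y s (Ioo_subset_dom hs)
  have h2 := mul_le_mul_of_nonneg_right h1 (normL2_nonneg (L := L) (v := w))
  refine h2.trans (le_of_eq ?_)
  ring

theorem exists_lipschitzWith (hL : 0 < L) {κ : Type*} [Fintype κ] {G : (ι → ℝ) → κ → ℝ}
    (h : ∀ i, PLip L fun x _ => G x i) : ∃ K, LipschitzWith K G := by
  choose K hK h using h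
  refine ⟨⟨∑ i, K i, Finset.sum_nonneg fun i _ => hK i⟩,
    LipschitzWith.of_dist_le_mul fun x y => ?_⟩
  refine (dist_pi_le_iff (mul_nonneg (NNReal.coe_nonneg _) dist_nonneg)).2 fun i => ?_
  rw [Real.dist_eq, dist_eq_norm]
  -- The components do not depend on the spatial variable, so any point of `[-L, L]` may be
  -- inserted.
  refine (h i x y L (right_mem_dom hL)).trans ?_
  gcongr
  exact Finset.single_le_sum (f := K) (fun i _ => hK i) (Finset.mem_univ i)

end Param

/-! ### The truncated system of ordinary differential equations -/

/-- The right hand side of the truncated system of ordinary differential equations. -/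
def truncRhs (L a M : ℝ) (e : Fin n → ℝ → ℝ) (g : Fin k → ℝ → ℝ) (f : Fin l → ℝ → ℝ)
    (x : Fin n ⊕ Fin k → ℝ) : Fin n ⊕ Fin k → ℝ :=
  Sum.elim
    (fun i => ip L (massFlux L a M f (comb e fun i => x (.inl i)) (comb g fun j => x (.inr j)))
      (deriv (e i)))
    (fun j => ip L (momentumFlux M (comb e fun i => x (.inl i)) (comb g fun j => x (.inr j)))
      (deriv (g j)))

theorem exists_lipschitz_truncRhs (hL : 0 < L) (hM : 0 ≤ M) (a : ℝ) (he : ∀ i, Lip L (e i))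
    (hg : ∀ i, Lip L (g i)) (hf : ∀ i, Lip L (f i)) :
    ∃ K, LipschitzWith K (truncRhs L a M e g f) := by
  have hY : PLip L fun x : Fin n ⊕ Fin k → ℝ => comb e fun i => x (.inl i) :=
    PLip.comb he fun i => PLip.coord L (Sum.inl i)
  have hU : PLip L fun x : Fin n ⊕ Fin k → ℝ => comb g fun i => x (.inr i) :=
    PLip.comb hg fun i => PLip.coord L (Sum.inr i)
  have hlap : PLip L fun x : Fin n ⊕ Fin k → ℝ => lap L f (comb g fun i => x (.inr i)) := by
    refine PLip.comb hf fun j => ?_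
    simp only [ip_comm (deriv (comb g _)), ip_deriv_comb_right hL hg (hf j).bm_deriv]
    have h1 : PLip L fun (x : Fin n ⊕ Fin k → ℝ) (_ : ℝ) =>
        (-1) * ∑ i, x (.inr i) * ip L (deriv (f j)) (deriv (g i)) :=
      PLip.const_mul _ (PLip.sum _ fun i => (PLip.coord L (Sum.inr i)).mul_fixed (Lip.const _))
    simpa only [neg_one_mul] using h1
  have hcl : ∀ s, |clip M s| ≤ M := abs_clip_le hM
  have hYU := (hY.clip (M := M)).mul (hU.clip (M := M)) (fun _ _ _ => hcl _) fun _ _ _ => hcl _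
  have hUU := (hU.clip (M := M)).mul (hU.clip (M := M)) (fun _ _ _ => hcl _) fun _ _ _ => hcl _
  have h1 : PLip L fun x : Fin n ⊕ Fin k → ℝ => massFlux L a M f (comb e fun i => x (.inl i))
      (comb g fun j => x (.inr j)) := (hU.add hYU).add (hlap.const_mul a)
  have h2 : PLip L fun x : Fin n ⊕ Fin k → ℝ => momentumFlux M (comb e fun i => x (.inl i))
      (comb g fun j => x (.inr j)) := by
    simp only [momentumFlux_eq]
    exact hY.add (hUU.const_mul (1 / 2))
  refine exists_lipschitzWith hL fun i => ?_
  rcases i with i | j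
  · exact PLip.ip hL h1 (fun x => bm_massFlux hf (lip_comb he _) (lip_comb hg _)) (he i).bm_deriv
  · exact PLip.ip hL h2 (fun x => bm_momentumFlux (lip_comb he _) (lip_comb hg _))
      (hg j).bm_deriv

/-- `(y, w)` are the coordinates of a solution of the truncated semidiscrete problem. -/
structure IsTruncated (L T a b d M : ℝ) (e : Fin n → ℝ → ℝ) (g : Fin k → ℝ → ℝ)
    (f : Fin l → ℝ → ℝ) (η₀ u₀ : ℝ → ℝ) (y : ℝ → Fin n → ℝ) (w : ℝ → Fin k → ℝ) : Prop where
  continuous_y : ∀ i, ContinuousOn (fun t => y t i) (Icc 0 T)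
  continuous_w : ∀ i, ContinuousOn (fun t => w t i) (Icc 0 T)
  deriv_y : ∀ t ∈ Ioo 0 T, ∀ i, HasDerivAt (fun t => y t i)
    (ip L (massFlux L a M f (comb e (y t)) (comb g (w t))) (deriv (e i))) t
  deriv_w : ∀ t ∈ Ioo 0 T, ∀ i, HasDerivAt (fun t => w t i)
    (ip L (momentumFlux M (comb e (y t)) (comb g (w t))) (deriv (g i))) t
  init_y : ∀ i, y 0 i = bilin L b η₀ (e i)
  init_w : ∀ i, w 0 i = bilin L d u₀ (g i)

theorem IsTruncated.unique (hL : 0 < L) (hM : 0 ≤ M) (he : ∀ i, Lip L (e i))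
    (hg : ∀ i, Lip L (g i)) (hf : ∀ i, Lip L (f i)) {y y' : ℝ → Fin n → ℝ} {w w' : ℝ → Fin k → ℝ}
    (h : IsTruncated L T a b d M e g f η₀ u₀ y w)
    (h' : IsTruncated L T a b d M e g f η₀ u₀ y' w') :
    ∀ t ∈ Icc 0 T, y t = y' t ∧ w t = w' t := by
  obtain ⟨K, hK⟩ := exists_lipschitz_truncRhs (M := M) hL hM a he hg hf
  have key := ode_solution_unique (T := T) hK (α := fun t => Sum.elim (y t) (w t))
    (β := fun t => Sum.elim (y' t) (w' t))
    (by rintro (i | i); exacts [h.continuous_y i, h.continuous_w i])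
    (by rintro (i | i); exacts [h'.continuous_y i, h'.continuous_w i])
    (by rintro t ht (i | i); exacts [h.deriv_y t ht i, h.deriv_w t ht i])
    (by rintro t ht (i | i); exacts [h'.deriv_y t ht i, h'.deriv_w t ht i])
    (by
      funext i
      rcases i with i | i
      · simp [h.init_y, h'.init_y]
      · simp [h.init_w, h'.init_w])
  intro t ht
  have h1 := key t ht
  exact ⟨funext fun i => congrFun h1 (.inl i), funext fun i => congrFun h1 (.inr i)⟩

/-- Solutions of the truncated problem exist for all times. -/
theorem exists_isTruncated (hL : 0 < L) (hT : 0 ≤ T) (hM : 0 ≤ M) (a b d : ℝ)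
    (he : ∀ i, Lip L (e i)) (hg : ∀ i, Lip L (g i)) (hf : ∀ i, Lip L (f i)) (η₀ u₀ : ℝ → ℝ) :
    ∃ y w, IsTruncated L T a b d M e g f η₀ u₀ y w ∧
      (∀ t ∈ Icc 0 T, ∀ i, HasDerivWithinAt (fun t => y t i)
        (ip L (massFlux L a M f (comb e (y t)) (comb g (w t))) (deriv (e i))) (Icc 0 T) t) ∧
      (∀ t ∈ Icc 0 T, ∀ i, HasDerivWithinAt (fun t => w t i)
        (ip L (momentumFlux M (comb e (y t)) (comb g (w t))) (deriv (g i))) (Icc 0 T) t) := by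
  obtain ⟨K, hK⟩ := exists_lipschitz_truncRhs (M := M) hL hM a he hg hf
  obtain ⟨α, h0, hα⟩ := exists_ode_solution hT hK
    (Sum.elim (fun i => bilin L b η₀ (e i)) fun i => bilin L d u₀ (g i))
  have h1 := fun t ht => hasDerivWithinAt_pi.1 (hα t ht)
  refine ⟨fun t i => α t (.inl i), fun t i => α t (.inr i),
    ⟨fun i t ht => (h1 t ht (.inl i)).continuousWithinAt,
      fun i t ht => (h1 t ht (.inr i)).continuousWithinAt,
      fun t ht i => (h1 t (Ioo_subset_Icc_self ht) (.inl i)).hasDerivAt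
        (Icc_mem_nhds ht.1 ht.2),
      fun t ht i => (h1 t (Ioo_subset_Icc_self ht) (.inr i)).hasDerivAt
        (Icc_mem_nhds ht.1 ht.2),
      fun i => congrFun h0 (.inl i), fun i => congrFun h0 (.inr i)⟩,
    fun t ht i => h1 t ht (.inl i), fun t ht i => h1 t ht (.inr i)⟩

end

/-! ### Passage between semidiscrete and truncated solutions; uniqueness -/

noncomputable section

open MeasureTheory
open scoped NNReal ENNReal

variable {L T q : ℝ} {a b d M : ℝ} {N μ r n k l : ℕ} {v w φ : ℝ → ℝ} {S : Set (ℝ → ℝ)}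
  {e : Fin n → ℝ → ℝ} {g : Fin k → ℝ → ℝ} {f : Fin l → ℝ → ℝ} {η₀ u₀ : ℝ → ℝ}
  {Y U : ℝ → ℝ → ℝ}

theorem exists_isBases (hL : 0 < L) (hN : 1 ≤ N) (hr : 2 ≤ r) (hb : 0 ≤ b) (hd : 0 ≤ d) (μ : ℕ) :
    ∃ (n k l : ℕ) (e : Fin n → ℝ → ℝ) (g : Fin k → ℝ → ℝ) (f : Fin l → ℝ → ℝ),
      IsBases L b d N μ r e g f := by
  have hS := isFE_femSpace (μ := μ) hL hN hr
  have hS0 := isFE_femSpaceZero (μ := μ) hL hN hr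
  obtain ⟨n, e, he⟩ := exists_isONB hL hN hr hS hb
  obtain ⟨k, g, hg⟩ := exists_isONB hL hN hr hS0 hd
  obtain ⟨l, f, hf⟩ := exists_isONB hL hN hr hS0 le_rfl
  exact ⟨n, k, l, e, g, f, he, hg, hf, hS, hS0⟩

/-- The truncation is inactive on functions bounded by `M`. -/
theorem massFlux_eqOn {Y U Y' U' : ℝ → ℝ} (hY : EqOn Y Y' (dom L))
    (hU : EqOn U U' (dom L)) (bY : ∀ x ∈ dom L, |Y x| ≤ M) (bU : ∀ x ∈ dom L, |U x| ≤ M)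
    {z : ℝ → ℝ} (hz : EqOn z (lap L f U') (dom L)) :
    EqOn (massFlux L a M f Y' U') (fun x => U x + Y x * U x + a * z x) (dom L) := by
  intro x hx
  simp only [massFlux]
  rw [← hY hx, ← hU hx, clip_eq (bY x hx), clip_eq (bU x hx), hz hx]

theorem momentumFlux_eqOn {Y U Y' U' : ℝ → ℝ} (hY : EqOn Y Y' (dom L))
    (hU : EqOn U U' (dom L)) (bU : ∀ x ∈ dom L, |U x| ≤ M) :
    EqOn (momentumFlux M Y' U') (fun x => Y x + 1 / 2 * (U x * U x)) (dom L) := by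
  intro x hx
  simp only [momentumFlux]
  rw [← hY hx, ← hU hx, clip_eq (bU x hx)]
  ring

/-- The weak form of the mass flux term. -/
theorem ip_deriv_massFlux {Y U z χ : ℝ → ℝ} (hL : 0 < L) (hY : Lip L Y) (hU : Lip L U)
    (hz : Lip L z) (hχ : Lip L χ) (h0 : U (-L) = 0 ∧ U L = 0) (hz0 : z (-L) = 0 ∧ z L = 0) :
    ip L (deriv fun x => U x + Y x * U x + a * z x) χ
      = -ip L (fun x => U x + Y x * U x + a * z x) (deriv χ) :=
  ip_deriv_left_of_zero hL ((hU.add (hY.mul hU)).add (hz.const_mul a)) hχ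
    (by simp [h0.1, hz0.1]) (by simp [h0.2, hz0.2])

/-- The weak form of the momentum flux term. -/
theorem ip_deriv_momentumFlux {Y U φ : ℝ → ℝ} (hL : 0 < L) (hY : Lip L Y) (hU : Lip L U)
    (hφ : Lip L φ) (h0 : φ (-L) = 0 ∧ φ L = 0) :
    ip L (fun x => deriv Y x + U x * deriv U x) φ
      = -ip L (fun x => Y x + 1 / 2 * (U x * U x)) (deriv φ) := by
  have hUU := (hU.mul hU).const_mul (1 / 2)
  have h := ip_deriv_left hL (hY.add hUU) hφ
  rw [h0.1, h0.2, mul_zero, mul_zero, sub_zero, zero_sub] at h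
  rw [← h]
  refine ip_congr hL ?_ (EventuallyEq.refl _ φ)
  filter_upwards [hY.deriv_add hL hUU, hU.deriv_mul hL hU] with x h1 h2
  rw [h1, deriv_const_mul_field, h2]
  ring

/-- Time derivatives of coordinates. -/
theorem IsONB.hasDerivAt_coord (he : IsONB L q S e) (hL : 0 < L) (hS : IsFE L N r S)
    (hmem : ∀ t ∈ Icc 0 T, Y t ∈ S)
    (hdiff : ∀ x ∈ dom L, ∀ t ∈ Ioc 0 T, DifferentiableWithinAt ℝ (fun s => Y s x) (Icc 0 T) t)
    {t : ℝ} (ht : t ∈ Ioo 0 T) (i : Fin n) :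
    HasDerivAt (fun t => bilin L q (Y t) (e i)) (bilin L q (dt T Y t) (e i)) t := by
  have hn : Icc 0 T ∈ 𝓝 t := Icc_mem_nhds ht.1 ht.2
  have hx : ∀ x ∈ dom L, HasDerivAt (fun s => Y s x) (dt T Y t x) t := fun x hx =>
    (hdiff x hx t ⟨ht.1, ht.2.le⟩).hasDerivWithinAt.hasDerivAt hn
  -- Coordinates are finite combinations of point values, hence differentiable. Their derivatives
  -- are identified afterwards: pointwise in `x` the expansion with coefficients `y'` must agree
  -- with the time derivative of `Y`.
  have hc : ∀ j, ∃ y', HasDerivAt (fun t => bilin L q (Y t) (e j)) y' t := by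
    intro j
    obtain ⟨ι, _, p, c, hp, hpc⟩ := he.eval j
    refine ⟨∑ k, c k * dt T Y t (p k), ?_⟩
    have h1 : HasDerivAt (fun s => ∑ k, c k * Y s (p k)) (∑ k, c k * dt T Y t (p k)) t :=
      HasDerivAt.fun_sum fun k _ => (hx (p k) (hp k)).const_mul (c k)
    refine h1.congr_of_eventuallyEq ?_
    filter_upwards [hn] with s hs using hpc _ (hmem s hs)
  choose y' hy' using hc
  have h2 : EqOn (dt T Y t) (comb e y') (dom L) := by
    intro x hxd
    refine (hx x hxd).unique ?_
    have h3 : HasDerivAt (fun s => ∑ j, bilin L q (Y s) (e j) * e j x) (∑ j, y' j * e j x) t :=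
      HasDerivAt.fun_sum fun j _ => (hy' j).mul_const _
    refine h3.congr_of_eventuallyEq ?_
    filter_upwards [hn] with s hs using he.expand _ (hmem s hs) x hxd
  rw [bilin_congr hL q h2 (eqOn_refl (e i) _), he.bilin_comb hL hS]
  exact hy' i

theorem IsONB.continuousOn_coord (he : IsONB L q S e) (hmem : ∀ t ∈ Icc 0 T, Y t ∈ S)
    (hc : ∀ x ∈ dom L, ContinuousOn (fun t => Y t x) (Icc 0 T)) (i : Fin n) :
    ContinuousOn (fun t => bilin L q (Y t) (e i)) (Icc 0 T) := by
  obtain ⟨ι, _, p, c, hp, hpc⟩ := he.eval i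
  have h1 : ContinuousOn (fun s => ∑ k, c k * Y s (p k)) (Icc 0 T) :=
    continuousOn_finsetSum _ fun k _ => (hc (p k) (hp k)).const_mul (c k)
  exact h1.congr fun s hs => hpc _ (hmem s hs)

/-- The coordinates of a bounded semidiscrete solution solve the truncated problem. -/
theorem IsSemidiscreteSolution.isTruncated (hL : 0 < L) (hB : IsBases L b d N μ r e g f)
    (h : IsSemidiscreteSolution L T a b d N μ r η₀ u₀ Y U)
    (bY : ∀ t ∈ Icc 0 T, ∀ x ∈ dom L, |Y t x| ≤ M) (bU : ∀ t ∈ Icc 0 T, ∀ x ∈ dom L, |U t x| ≤ M) :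
    IsTruncated L T a b d M e g f η₀ u₀ (fun t i => bilin L b (Y t) (e i))
      (fun t i => bilin L d (U t) (g i)) := by
  refine ⟨hB.e_onb.continuousOn_coord h.mem_η h.continuous_η,
    hB.g_onb.continuousOn_coord h.mem_u h.continuous_u, fun t ht i => ?_, fun t ht i => ?_,
    fun i => h.init_η.2 _ (hB.e_onb.mem i), fun i => h.init_u.2 _ (hB.g_onb.mem i)⟩
  · have ht' := Ioo_subset_Icc_self ht
    obtain ⟨z, hz, hm⟩ := h.mass t ⟨ht.1, ht.2.le⟩
    have h1 := hB.e_onb.hasDerivAt_coord hL hB.fe h.mem_η h.differentiable_η ht i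
    have hU := hB.g_onb.eqOn_comb (h.mem_u t ht')
    have hYl := hB.fe.lip _ (h.mem_η t ht')
    have hUl := hB.fe_zero.lip _ (h.mem_u t ht')
    have hz' := hz.eqOn hL hB.fe_zero hU (isDiscreteLaplacian_lap hL hB.fe_zero hB.f_onb
      (lip_comb (hB.g_onb.lip hB.fe_zero) _))
    have h2 := massFlux_eqOn (a := a) (hB.e_onb.eqOn_comb (h.mem_η t ht')) hU (bY t ht')
      (bU t ht') hz'
    have h3 := hm _ (hB.e_onb.mem i)
    rw [ip_deriv_massFlux hL hYl hUl (hB.fe_zero.lip _ hz.1) (hB.e_onb.lip hB.fe i)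
      (h.mem_u t ht').2 hz.1.2] at h3
    rw [ip_congr hL (ae_eq_of_dom h2) (EventuallyEq.refl _ _)]
    convert h1 using 1
    linarith
  · have ht' := Ioo_subset_Icc_self ht
    have h1 := hB.g_onb.hasDerivAt_coord hL hB.fe_zero h.mem_u h.differentiable_u ht i
    have h2 := momentumFlux_eqOn (hB.e_onb.eqOn_comb (h.mem_η t ht'))
      (hB.g_onb.eqOn_comb (h.mem_u t ht')) (bU t ht')
    have h3 := h.momentum t ⟨ht.1, ht.2.le⟩ _ (hB.g_onb.mem i)
    rw [ip_deriv_momentumFlux hL (hB.fe.lip _ (h.mem_η t ht')) (hB.fe_zero.lip _ (h.mem_u t ht'))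
      (hB.g_onb.lip hB.fe_zero i) (hB.g_onb.mem i).2] at h3
    rw [ip_congr hL (ae_eq_of_dom h2) (EventuallyEq.refl _ _)]
    convert h1 using 1
    linarith

/-- Semidiscrete solutions are bounded. -/
theorem IsONB.exists_bound (he : IsONB L q S e) (hS : IsFE L N r S)
    (hmem : ∀ t ∈ Icc 0 T, Y t ∈ S) (hc : ∀ x ∈ dom L, ContinuousOn (fun t => Y t x) (Icc 0 T)) :
    ∃ M, 0 ≤ M ∧ ∀ t ∈ Icc 0 T, ∀ x ∈ dom L, |Y t x| ≤ M := by
  have h1 : ContinuousOn (fun p : ℝ × ℝ => ∑ i, bilin L q (Y p.1) (e i) * e i p.2)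
      (Icc 0 T ×ˢ dom L) :=
    continuousOn_finsetSum _ fun i _ =>
      ((he.continuousOn_coord hmem hc i).comp continuousOn_fst fun p hp => hp.1).mul
        ((he.lip hS i).continuousOn.comp continuousOn_snd fun p hp => hp.2)
  obtain ⟨M, hM, h⟩ := exists_bound_rect (g := fun t x => ∑ i, bilin L q (Y t) (e i) * e i x) h1
  refine ⟨M, hM, fun t ht x hx => ?_⟩
  rw [he.expand _ (hmem t ht) x hx]
  exact h t ht x hx

theorem comb_hasDerivWithinAt {y : ℝ → Fin n → ℝ} {y' : Fin n → ℝ} {s : Set ℝ} {t : ℝ}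
    (h : ∀ i, HasDerivWithinAt (fun t => y t i) (y' i) s t) (x : ℝ) :
    HasDerivWithinAt (fun t => comb e (y t) x) (comb e y' x) s t :=
  HasDerivWithinAt.fun_sum fun i _ => (h i).mul_const _

/-- A bounded solution of the truncated problem is a semidiscrete solution. -/
theorem IsTruncated.isSemidiscreteSolution (hL : 0 < L) (hT : 0 < T)
    (hB : IsBases L b d N μ r e g f) {y : ℝ → Fin n → ℝ} {w : ℝ → Fin k → ℝ}
    (h : IsTruncated L T a b d M e g f η₀ u₀ y w) (hη₀ : Lip L η₀) (hu₀ : Lip L u₀)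
    (hy : ∀ t ∈ Icc 0 T, ∀ i, HasDerivWithinAt (fun t => y t i)
      (ip L (massFlux L a M f (comb e (y t)) (comb g (w t))) (deriv (e i))) (Icc 0 T) t)
    (hw : ∀ t ∈ Icc 0 T, ∀ i, HasDerivWithinAt (fun t => w t i)
      (ip L (momentumFlux M (comb e (y t)) (comb g (w t))) (deriv (g i))) (Icc 0 T) t)
    (bY : ∀ t ∈ Icc 0 T, ∀ x ∈ dom L, |comb e (y t) x| ≤ M)
    (bU : ∀ t ∈ Icc 0 T, ∀ x ∈ dom L, |comb g (w t) x| ≤ M) :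
    IsSemidiscreteSolution L T a b d N μ r η₀ u₀ (fun t => comb e (y t))
      (fun t => comb g (w t)) := by
  have he := hB.e_onb
  have hg := hB.g_onb
  have d1 := fun t ht x => comb_hasDerivWithinAt (e := e) (hy t ht) x
  have d2 := fun t ht x => comb_hasDerivWithinAt (e := g) (hw t ht) x
  have mY : ∀ t, comb e (y t) ∈ femSpace L N μ r := fun t => he.comb_mem hB.fe _
  have mU : ∀ t, comb g (w t) ∈ femSpaceZero L N μ r := fun t => hg.comb_mem hB.fe_zero _
  have hud : ∀ t ∈ Icc 0 T, UniqueDiffWithinAt ℝ (Icc 0 T) t := uniqueDiffOn_Icc hT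
  refine ⟨fun t _ => mY t, fun t _ => mU t, fun x _ t ht => (d1 t ht x).continuousWithinAt,
    fun x _ t ht => (d2 t ht x).continuousWithinAt,
    fun x _ t ht => (d1 t (Ioc_subset_Icc_self ht) x).differentiableWithinAt,
    fun x _ t ht => (d2 t (Ioc_subset_Icc_self ht) x).differentiableWithinAt,
    ⟨mY 0, fun χ hχ => ?_⟩, ⟨mU 0, fun χ hχ => ?_⟩, fun t ht => ?_, fun t ht φ hφ => ?_⟩
  · rw [funext h.init_y]
    exact he.isProjection hL hB.fe hη₀ hχ
  · rw [funext h.init_w]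
    exact hg.isProjection hL hB.fe_zero hu₀ hχ
  · have ht' := Ioc_subset_Icc_self ht
    have hYl := hB.fe.lip _ (mY t)
    have hUl := hB.fe_zero.lip _ (mU t)
    have hz := isDiscreteLaplacian_lap hL hB.fe_zero hB.f_onb hUl
    refine ⟨_, hz, fun χ hχ => ?_⟩
    have e1 : dt T (fun t => comb e (y t)) t = comb e fun i =>
        ip L (massFlux L a M f (comb e (y t)) (comb g (w t))) (deriv (e i)) :=
      funext fun x => (d1 t ht' x).derivWithin (hud t ht')
    rw [e1, he.bilin_comb_right hL hB.fe _ hχ, ← he.ip_deriv_right hL hB.fe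
      (bm_massFlux (hB.f_onb.lip hB.fe_zero) hYl hUl) hχ,
      ip_deriv_massFlux hL hYl hUl (hB.fe_zero.lip _ hz.1) (hB.fe.lip _ hχ) (mU t).2 hz.1.2,
      ip_congr hL (ae_eq_of_dom (massFlux_eqOn (eqOn_refl _ _) (eqOn_refl _ _) (bY t ht')
        (bU t ht') (eqOn_refl _ _))) (EventuallyEq.refl _ _), add_neg_cancel]
  · have ht' := Ioc_subset_Icc_self ht
    have hYl := hB.fe.lip _ (mY t)
    have hUl := hB.fe_zero.lip _ (mU t)
    have e1 : dt T (fun t => comb g (w t)) t = comb g fun i =>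
        ip L (momentumFlux M (comb e (y t)) (comb g (w t))) (deriv (g i)) :=
      funext fun x => (d2 t ht' x).derivWithin (hud t ht')
    rw [e1, hg.bilin_comb_right hL hB.fe_zero _ hφ, ← hg.ip_deriv_right hL hB.fe_zero
      (bm_momentumFlux hYl hUl) hφ,
      ip_deriv_momentumFlux hL hYl hUl (hB.fe_zero.lip _ hφ) hφ.2,
      ip_congr hL (ae_eq_of_dom (momentumFlux_eqOn (eqOn_refl _ _) (eqOn_refl _ _) (bU t ht')))
        (EventuallyEq.refl _ _), add_neg_cancel]

/-- Two semidiscrete solutions agree. -/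
theorem IsSemidiscreteSolution.unique (hL : 0 < L) (hN : 1 ≤ N) (hr : 2 ≤ r) (hb : 0 ≤ b)
    (hd : 0 ≤ d) {Y' U' : ℝ → ℝ → ℝ} (h : IsSemidiscreteSolution L T a b d N μ r η₀ u₀ Y U)
    (h' : IsSemidiscreteSolution L T a b d N μ r η₀ u₀ Y' U') :
    ∀ t ∈ Icc 0 T, EqOn (Y t) (Y' t) (dom L) ∧ EqOn (U t) (U' t) (dom L) := by
  obtain ⟨n, k, l, e, g, f, hB⟩ := exists_isBases hL hN hr hb hd μ
  obtain ⟨M₁, p1, b1⟩ := hB.e_onb.exists_bound hB.fe h.mem_η h.continuous_η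
  obtain ⟨M₂, p2, b2⟩ := hB.g_onb.exists_bound hB.fe_zero h.mem_u h.continuous_u
  obtain ⟨M₃, p3, b3⟩ := hB.e_onb.exists_bound hB.fe h'.mem_η h'.continuous_η
  obtain ⟨M₄, p4, b4⟩ := hB.g_onb.exists_bound hB.fe_zero h'.mem_u h'.continuous_u
  -- One truncation level above all four bounds makes both pairs solutions of the same Lipschitz
  -- system.
  have t1 := h.isTruncated (M := M₁ + M₂ + M₃ + M₄) hL hB
    (fun t ht x hx => (b1 t ht x hx).trans (by linarith))
    (fun t ht x hx => (b2 t ht x hx).trans (by linarith))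
  have t2 := h'.isTruncated (M := M₁ + M₂ + M₃ + M₄) hL hB
    (fun t ht x hx => (b3 t ht x hx).trans (by linarith))
    (fun t ht x hx => (b4 t ht x hx).trans (by linarith))
  intro t ht
  obtain ⟨c1, c2⟩ := t1.unique hL (by positivity) (hB.e_onb.lip hB.fe) (hB.g_onb.lip hB.fe_zero)
    (hB.f_onb.lip hB.fe_zero) t2 t ht
  constructor
  · intro x hx
    rw [hB.e_onb.eqOn_comb (h.mem_η t ht) hx, hB.e_onb.eqOn_comb (h'.mem_η t ht) hx]
    exact congrArg (comb e · x) c1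
  · intro x hx
    rw [hB.g_onb.eqOn_comb (h.mem_u t ht) hx, hB.g_onb.eqOn_comb (h'.mem_u t ht) hx]
    exact congrArg (comb g · x) c2

end

/-! ### Bounds for the dispersive term and the truncated nonlinearities -/

noncomputable section

open MeasureTheory
open scoped NNReal ENNReal

variable {L T q : ℝ} {a b d M M₀ : ℝ} {N μ r n k l m : ℕ} {S : Set (ℝ → ℝ)}
  {e : Fin n → ℝ → ℝ} {g : Fin k → ℝ → ℝ} {f : Fin l → ℝ → ℝ} {η₀ u₀ : ℝ → ℝ}
  {η u w : ℝ → ℝ → ℝ}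

theorem IsDiscreteLaplacian.sub (hL : 0 < L) (hS : IsFE L N r S) {v v' z z' : ℝ → ℝ}
    (hv : Lip L v) (hv' : Lip L v') (h : IsDiscreteLaplacian L S v z)
    (h' : IsDiscreteLaplacian L S v' z') :
    IsDiscreteLaplacian L S (fun x => v x - v' x) fun x => z x - z' x := by
  refine ⟨hS.sub h.1 h'.1, fun φ hφ => ?_⟩
  have hφl := hS.lip _ hφ
  rw [ip_sub_left hL (hS.lip _ h.1).bm (hS.lip _ h'.1).bm hφl.bm, h.2 _ hφ, h'.2 _ hφ,
    ip_congr hL (hv.deriv_sub hL hv') (EventuallyEq.refl _ _),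
    ip_sub_left hL hv.bm_deriv hv'.bm_deriv hφl.bm_deriv]
  ring

/-- The consistency error of the discrete Laplacian against elements of `S_h^0`. -/
theorem ip_laplacian_consistency (hL : 0 < L) (hS : IsFE L N r S) (hd : 0 < d)
    {v w R z W : ℝ → ℝ} (hv : Lip L v) (hw : BM L w)
    (hvw : ip L (deriv v) (deriv W) = -ip L w W) (hR : IsGalerkin L d S v R)
    (hz : IsDiscreteLaplacian L S R z) (hW : W ∈ S) :
    ip L (fun x => w x - z x) W = d⁻¹ * ip L (fun x => v x - R x) W := by
  have hWl := hS.lip _ hW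
  have hRl := hS.lip _ hR.mem
  have h1 := hR.orth_sub hL hS hv hW
  rw [bilin, ip_congr hL (hv.deriv_sub hL hRl) (EventuallyEq.refl _ _),
    ip_sub_left hL hv.bm_deriv hRl.bm_deriv hWl.bm_deriv] at h1
  rw [ip_sub_left hL hw (hS.lip _ hz.1).bm hWl.bm, hz.2 _ hW]
  have h2 : ip L (fun x => v x - R x) W
      = -(d * (ip L (deriv v) (deriv W) - ip L (deriv R) (deriv W))) := by linarith
  rw [h2, mul_neg, ← mul_assoc, inv_mul_cancel₀ hd.ne', one_mul]
  linarith

/-- The dispersive term, tested with the derivative of the Riesz representative of `θ`. -/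
theorem exists_dispersive_bound (hL : 0 < L) (hb : 0 < b) (hd : 0 < d) (hM₀ : 0 ≤ M₀) (a : ℝ)
    (T : ℝ) (m : ℕ) : ∃ C, 0 ≤ C ∧ ∀ (N μ : ℕ), 1 ≤ N → μ ≤ m → ∀ (n k l : ℕ)
    (e : Fin n → ℝ → ℝ) (g : Fin k → ℝ → ℝ) (f : Fin l → ℝ → ℝ),
    IsBases L b d N μ (m + 2) e g f → ∀ η u w : ℝ → ℝ → ℝ, IsWeakSolution L T a b d m M₀ η u w →
    ∀ t ∈ Icc 0 T, ∀ R, IsGalerkin L d (femSpaceZero L N μ (m + 2)) (u t) R →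
    ∀ U ∈ femSpaceZero L N μ (m + 2), ∀ θ, Lip L θ →
      |ip L (fun x => w t x - lap L f U x) (deriv (comb e fun i => ip L θ (e i)))|
        ≤ C * (meshSize L N ^ (m + 2) + normL2 L (fun x => u t x - R x)
          + normL2 L (deriv fun x => R x - U x)) * normL2 L θ := by
  obtain ⟨C₁, p1, k1⟩ := exists_dual_close hb m
  obtain ⟨C₂, p2, k2⟩ := exists_laplacian_inverse (m + 2)
  obtain ⟨C₃, p3, k3⟩ := exists_laplacian_consistency hL hd m
  refine ⟨C₃ * M₀ * C₁ + C₃ * (C₁ * (2 * L)) + d⁻¹ * (C₁ * (1 + 2 * L)) + (C₂ * C₁ + C₁),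
    by positivity, fun N μ hN hμ n k l e g f hB η u w hw t ht R hR U hU θ hθ => ?_⟩
  have hS := hB.fe_zero
  have hh := meshSize_pos hL hN
  have hh2 := meshSize_le hL hN
  obtain ⟨q1, W, hW, q2, q3⟩ := k1 L N μ hL hN hμ n e hB.e_onb θ hθ
  set χ := comb e fun i => ip L θ (e i) with hχ
  have hχl : Lip L χ := lip_comb (hB.e_onb.lip hB.fe) _
  have hWl := hS.lip _ hW
  have hRl := hS.lip _ hR.mem
  have hUl := hS.lip _ hU
  have hul : Lip L (u t) := ContDiffOn.lip (by simp) (hw.contDiff_u t ht)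
  have hwb : BM L (w t) := ContinuousOn.bm (hw.contDiff_w t ht).continuousOn
  have hz := isDiscreteLaplacian_lap hL hS hB.f_onb hRl
  have hzU := isDiscreteLaplacian_lap hL hS hB.f_onb hUl
  have hξ := hz.sub hL hS hRl hUl hzU
  have hzl := (hS.lip _ hz.1).bm
  have hzUl := (hS.lip _ hzU.1).bm
  set z := lap L f R with hzdef
  set zU := lap L f U with hzUdef
  have c3 := k3 N μ hN hμ (u t) (w t) R z M₀ hM₀ hul (hw.contDiff_w t ht) (hw.top_w_le t ht)
    (hw.boundary_w t ht).1 (hw.boundary_w t ht).2 (hw.weak_w t ht) hR hz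
  have c2 := k2 L N μ hL hN _ _ (hRl.sub hUl) hξ
  have o1 := ip_laplacian_consistency hL hS hd hul hwb
    (hw.weak_w t ht W hWl hW.2.1 hW.2.2) hR hz hW
  have o2 := hξ.2 W hW
  have hD : BM L fun x => deriv χ x - W x := hχl.bm_deriv.sub hWl.bm
  have hwz := hwb.sub hzl
  have hzz := hzl.sub hzUl
  -- With `z` and `zU` the discrete Laplacians of `R` and `U`, `w - zU` is split at `z` and `χ'` at
  -- `W`. Against `χ' - W = O(h‖θ‖)` the consistency error and the inverse inequality for `z - zU`
  -- may each lose one power of `h`. Against `W` the first factor reduces to `d⁻¹ (u - R, W)` and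
  -- the second to `-((R - U)', W')`, with no loss.
  have key : ip L (fun x => w t x - zU x) (deriv χ)
      = ip L (fun x => w t x - z x) (fun x => deriv χ x - W x)
        + d⁻¹ * ip L (fun x => u t x - R x) W
        + (ip L (fun x => z x - zU x) (fun x => deriv χ x - W x)
          - ip L (deriv fun x => R x - U x) (deriv W)) := by
    rw [← o1, sub_eq_add_neg (ip L (fun x => z x - zU x) _), ← o2,
      ip_sub_right hL hwz hχl.bm_deriv hWl.bm, ip_sub_right hL hzz hχl.bm_deriv hWl.bm,
      ip_sub_left hL hwb hzUl hχl.bm_deriv, ip_sub_left hL hwb hzl hχl.bm_deriv,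
      ip_sub_left hL hzl hzUl hχl.bm_deriv]
    ring
  set h := meshSize L N
  set A := normL2 L (fun x => u t x - R x) with hA
  set B := normL2 L (deriv fun x => R x - U x) with hBdef
  set Θ := normL2 L θ
  have nA : 0 ≤ A := normL2_nonneg
  have nB : 0 ≤ B := normL2_nonneg
  have nΘ : 0 ≤ Θ := normL2_nonneg
  have nW : normL2 L W ≤ C₁ * (1 + 2 * L) * Θ := by
    have h1 := normL2_sub_trans hL hWl.bm hχl.bm_deriv (BM.const 0)
    simp only [sub_zero] at h1
    rw [normL2_sub_comm hL] at h1
    have h2 : C₁ * (h * Θ) ≤ C₁ * (2 * L * Θ) := by gcongr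
    linarith
  have a1 := abs_ip_le hL hwz hD
  have a2 := abs_ip_le hL (hul.sub hRl).bm hWl.bm
  have a3 := abs_ip_le hL hzz hD
  have a4 := abs_ip_le hL (hRl.sub hUl).bm_deriv hWl.bm_deriv
  have b1 : normL2 L (fun x => w t x - z x) * normL2 L (fun x => deriv χ x - W x)
      ≤ (C₃ * M₀ * C₁ * h ^ (m + 2) + C₃ * (C₁ * (2 * L)) * A) * Θ := by
    calc _ ≤ C₃ * (h ^ (m + 1) * M₀ + A) * (C₁ * (h * Θ)) := by
          gcongr
          exact normL2_nonneg
      _ = (C₃ * M₀ * C₁ * h ^ (m + 2) + C₃ * (C₁ * h) * A) * Θ := by ring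
      _ ≤ _ := by gcongr
  have b2 : d⁻¹ * (A * normL2 L W) ≤ d⁻¹ * (C₁ * (1 + 2 * L)) * A * Θ := by
    calc _ ≤ d⁻¹ * (A * (C₁ * (1 + 2 * L) * Θ)) := by gcongr
      _ = _ := by ring
  have b3 : normL2 L (fun x => z x - zU x) * normL2 L (fun x => deriv χ x - W x)
      ≤ C₂ * C₁ * B * Θ := by
    calc _ ≤ normL2 L (fun x => z x - zU x) * (C₁ * (h * Θ)) := by
          gcongr
          exact normL2_nonneg
      _ = h * normL2 L (fun x => z x - zU x) * (C₁ * Θ) := by ring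
      _ ≤ C₂ * B * (C₁ * Θ) := by gcongr
      _ = _ := by ring
  have b4 : B * normL2 L (deriv W) ≤ C₁ * B * Θ := by
    calc _ ≤ B * (C₁ * Θ) := by gcongr
      _ = _ := by ring
  rw [key]
  have t1 : |ip L (fun x => w t x - z x) (fun x => deriv χ x - W x)
        + d⁻¹ * ip L (fun x => u t x - R x) W
        + (ip L (fun x => z x - zU x) (fun x => deriv χ x - W x)
          - ip L (deriv fun x => R x - U x) (deriv W))|
      ≤ |ip L (fun x => w t x - z x) (fun x => deriv χ x - W x)|
        + d⁻¹ * |ip L (fun x => u t x - R x) W|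
        + (|ip L (fun x => z x - zU x) (fun x => deriv χ x - W x)|
          + |ip L (deriv fun x => R x - U x) (deriv W)|) := by
    refine (abs_add_le _ _).trans (add_le_add ((abs_add_le _ _).trans ?_) (abs_sub _ _))
    rw [abs_mul, abs_of_pos (inv_pos.2 hd)]
  have a2' : d⁻¹ * |ip L (fun x => u t x - R x) W| ≤ d⁻¹ * (A * normL2 L W) := by gcongr
  refine t1.trans ?_
  have hH : 0 ≤ h ^ (m + 2) := by positivity
  have z1 : 0 ≤ C₃ * M₀ * C₁ * (A + B) * Θ := by positivity
  have z2 : 0 ≤ C₃ * (C₁ * (2 * L)) * (h ^ (m + 2) + B) * Θ := by positivity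
  have z3 : 0 ≤ d⁻¹ * (C₁ * (1 + 2 * L)) * (h ^ (m + 2) + B) * Θ := by positivity
  have z4 : 0 ≤ (C₂ * C₁ + C₁) * (h ^ (m + 2) + A) * Θ := by positivity
  linarith

/-- The truncated nonlinearities are Lipschitz perturbations of the exact ones. -/
theorem normL2_massFlux_sub_le (hL : 0 < L) {η u Y U : ℝ → ℝ} (hη : Lip L η) (hu : Lip L u)
    (hY : Lip L Y) (hU : Lip L U) (hM : 0 ≤ M) (bη : ∀ x ∈ dom L, |η x| ≤ M)
    (bu : ∀ x ∈ dom L, |u x| ≤ M) :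
    normL2 L (fun x => u x + η x * u x - (U x + clip M (Y x) * clip M (U x)))
      ≤ (1 + M) * normL2 L (fun x => u x - U x) + M * normL2 L (fun x => η x - Y x) := by
  have hc := bm_clip (M := M) hY
  have hc' := bm_clip (M := M) hU
  have d1 := hu.bm.sub hU.bm
  have d2 := hη.bm.sub hY.bm
  have h1 := normL2_add_le hL (v := fun x => (1 + M) * |u x - U x|)
    (w := fun x => M * |η x - Y x|) (d1.abs.const_mul _) (d2.abs.const_mul _)
  rw [normL2_smul hL, normL2_smul hL, abs_of_nonneg hM, abs_of_nonneg (by positivity)] at h1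
  have n1 : normL2 L (fun x => |u x - U x|) ≤ normL2 L fun x => u x - U x :=
    normL2_mono hL d1.abs d1 (ae_of_all _ fun x => by rw [abs_abs])
  have n2 : normL2 L (fun x => |η x - Y x|) ≤ normL2 L fun x => η x - Y x :=
    normL2_mono hL d2.abs d2 (ae_of_all _ fun x => by rw [abs_abs])
  have h2 : normL2 L (fun x => u x + η x * u x - (U x + clip M (Y x) * clip M (U x)))
      ≤ normL2 L fun x => (1 + M) * |u x - U x| + M * |η x - Y x| := by
    refine normL2_mono hL ((hu.bm.add (hη.bm.mul hu.bm)).sub (hU.bm.add (hc.mul hc')))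
      ((d1.abs.const_mul _).add (d2.abs.const_mul _)) ?_
    filter_upwards [ae_mem_Ioo] with x hx
    have hx' := Ioo_subset_dom hx
    -- Truncation does not change the exact solution, which is bounded by `M`, and is 1-Lipschitz;
    -- the error is therefore linear in `η - Y` and `u - U` without any bound on `Y` or `U`.
    have e1 := abs_clip_sub_le M (η x) (Y x)
    have e2 := abs_clip_sub_le M (u x) (U x)
    rw [clip_eq (bη x hx')] at e1
    rw [clip_eq (bu x hx')] at e2
    rw [show u x + η x * u x - (U x + clip M (Y x) * clip M (U x))
      = (u x - U x) + ((η x - clip M (Y x)) * u x + clip M (Y x) * (u x - clip M (U x))) by ring]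
    refine (abs_add_le _ _).trans ?_
    refine (add_le_add_right (abs_add_le _ _) _).trans ?_
    rw [abs_mul, abs_mul]
    have b1 := bu x hx'
    have b2 := abs_clip_le hM (Y x)
    refine le_trans ?_ (le_abs_self _)
    calc _ ≤ |u x - U x| + (|η x - Y x| * M + M * |u x - U x|) := by gcongr
      _ = _ := by ring
  have h3 := mul_le_mul_of_nonneg_left n1 (by positivity : 0 ≤ 1 + M)
  have h4 := mul_le_mul_of_nonneg_left n2 hM
  linarith

theorem normL2_momentumFlux_sub_le (hL : 0 < L) {η u Y U : ℝ → ℝ} (hη : Lip L η) (hu : Lip L u)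
    (hY : Lip L Y) (hU : Lip L U) (hM : 0 ≤ M) (bu : ∀ x ∈ dom L, |u x| ≤ M) :
    normL2 L (fun x => η x + u x ^ 2 / 2 - momentumFlux M Y U x)
      ≤ normL2 L (fun x => η x - Y x) + M * normL2 L (fun x => u x - U x) := by
  have hc := bm_clip (M := M) hU
  have d1 := hu.bm.sub hc
  have h1 := normL2_add_le hL (v := fun x => η x - Y x)
    (w := fun x => 1 / 2 * ((u x + clip M (U x)) * (u x - clip M (U x)))) (hη.bm.sub hY.bm)
    (((hu.bm.add hc).mul d1).const_mul _)
  have h2 : normL2 L (fun x => 1 / 2 * ((u x + clip M (U x)) * (u x - clip M (U x))))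
      ≤ M * normL2 L (fun x => u x - U x) := by
    refine normL2_le_mul hL (((hu.bm.add hc).mul d1).const_mul _) (hu.bm.sub hU.bm) hM
      fun x hx => ?_
    have e2 := abs_clip_sub_le M (u x) (U x)
    rw [clip_eq (bu x (Ioo_subset_dom hx))] at e2
    rw [abs_mul, abs_mul]
    have b1 := bu x (Ioo_subset_dom hx)
    have b2 := abs_clip_le hM (U x)
    have b3 := abs_add_le (u x) (clip M (U x))
    have b4 : |u x + clip M (U x)| ≤ 2 * M := by linarith
    calc _ ≤ |(1 / 2 : ℝ)| * (2 * M * |u x - U x|) := by gcongr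
      _ = M * |u x - U x| := by
        rw [abs_of_pos (by norm_num)]
        ring
  have h3 : (fun x => η x + u x ^ 2 / 2 - momentumFlux M Y U x)
      = fun x => η x - Y x + 1 / 2 * ((u x + clip M (U x)) * (u x - clip M (U x))) := by
    funext x
    simp only [momentumFlux]
    ring
  rw [h3]
  linarith

end

/-! ### The energy estimate -/

noncomputable section

open MeasureTheory
open scoped NNReal ENNReal

variable {L T q : ℝ} {a b d M M₀ : ℝ} {N μ r n k l m : ℕ} {S : Set (ℝ → ℝ)}
  {e : Fin n → ℝ → ℝ} {g : Fin k → ℝ → ℝ} {f : Fin l → ℝ → ℝ} {η₀ u₀ : ℝ → ℝ}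
  {η u w : ℝ → ℝ → ℝ}

theorem sq_add_four_le (x y z s : ℝ) :
    (x + y + z + s) ^ 2 ≤ 4 * (x ^ 2 + y ^ 2 + z ^ 2 + s ^ 2) := by
  nlinarith [sq_nonneg (x - y), sq_nonneg (x - z), sq_nonneg (x - s), sq_nonneg (y - z),
    sq_nonneg (y - s), sq_nonneg (z - s)]

/-- The energy contains `d * z ^ 2` rather than `z ^ 2`, which accounts for the factor `1 + d⁻¹`. -/
theorem sq_sum_le (hd : 0 < d) (x y z s : ℝ) :
    (x + y + z + s) ^ 2 ≤ 4 * (1 + d⁻¹) * (x ^ 2 + (y ^ 2 + d * z ^ 2) + s ^ 2) := by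
  have h1 := sq_add_four_le x y z s
  have h2 : d⁻¹ * (d * z ^ 2) = z ^ 2 := by field_simp
  have h3 : 0 ≤ d⁻¹ * (x ^ 2 + y ^ 2 + s ^ 2) := by positivity
  have h4 : 0 ≤ d * z ^ 2 := by positivity
  linarith

theorem two_mul_add_le {x y z A B C s : ℝ} (hx : x ≤ A * s) (hy : y ≤ B * s) (hz : z ≤ C * s) :
    2 * (x + y) + 2 * z ≤ 2 * (A + B + C) * s := by
  linarith

/-- The growth rate of the energy of the difference between the elliptic projections and the
solution of the truncated problem. -/
theorem exists_energy_rate (hL : 0 < L) (hb : 0 < b) (hd : 0 < d) (hM₀ : 0 ≤ M₀) (hM : M₀ ≤ M)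
    (a : ℝ) (T : ℝ) (m : ℕ) : ∃ K, 0 ≤ K ∧ ∀ (N μ : ℕ), 1 ≤ N → μ ≤ m → ∀ (n k l : ℕ)
    (e : Fin n → ℝ → ℝ) (g : Fin k → ℝ → ℝ) (f : Fin l → ℝ → ℝ),
    IsBases L b d N μ (m + 2) e g f → ∀ η u w : ℝ → ℝ → ℝ, IsWeakSolution L T a b d m M₀ η u w →
    ∀ t ∈ Icc 0 T, ∀ R R', IsGalerkin L b (femSpace L N μ (m + 2)) (η t) R →
    IsGalerkin L d (femSpaceZero L N μ (m + 2)) (u t) R' →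
    ∀ Y ∈ femSpace L N μ (m + 2), ∀ U ∈ femSpaceZero L N μ (m + 2),
      2 * ip L (fun x => u t x + η t x * u t x + a * w t x - massFlux L a M f Y U x)
          (deriv (comb e fun i => ip L (fun x => R x - Y x) (e i)))
        + 2 * ip L (fun x => η t x + u t x ^ 2 / 2 - momentumFlux M Y U x)
          (deriv fun x => R' x - U x)
        ≤ K * (ip L (fun x => R x - Y x) (fun x => R x - Y x)
          + bilin L d (fun x => R' x - U x) (fun x => R' x - U x)
          + (meshSize L N ^ (m + 2)) ^ 2) := by
  obtain ⟨Ca, pa, ka⟩ := exists_projection_femSpace hL hb m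
  obtain ⟨Cb, pb, kb⟩ := exists_projection_femSpaceZero hL hd m
  obtain ⟨C₁, p1, k1⟩ := exists_dual_close hb m
  obtain ⟨C₂, p2, k2⟩ := exists_dispersive_bound hL hb hd hM₀ a T m
  have hM0 : 0 ≤ M := hM₀.trans hM
  set P := (1 + M) * (Cb * M₀ + 1) + M * (Ca * M₀ + 1) with hP
  set Q := (Ca * M₀ + 1) + M * (Cb * M₀ + 1) with hQ
  set D := P * C₁ + |a| * (C₂ * (1 + Cb * M₀)) + Q with hD
  have hP0 : 0 ≤ P := by positivity
  have hQ0 : 0 ≤ Q := by positivity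
  have hD0 : 0 ≤ D := by positivity
  refine ⟨2 * D * (4 * (1 + d⁻¹)), by positivity,
    fun N μ hN hμ n k l e g f hB η u w hw t ht R R' hR hR' Y hY U hU => ?_⟩
  have hh := meshSize_pos hL hN
  have hηl : Lip L (η t) := ContDiffOn.lip (by simp) (hw.contDiff_η t ht)
  have hul : Lip L (u t) := ContDiffOn.lip (by simp) (hw.contDiff_u t ht)
  have hwb : BM L (w t) := ContinuousOn.bm (hw.contDiff_w t ht).continuousOn
  have hRl := hB.fe.lip _ hR.mem
  have hRl' := hB.fe_zero.lip _ hR'.mem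
  have hYl := hB.fe.lip _ hY
  have hUl := hB.fe_zero.lip _ hU
  have hfl := hB.f_onb.lip hB.fe_zero
  have hθ := hRl.sub hYl
  have hξ := hRl'.sub hUl
  have r1 := (ka N μ hN hμ (η t) M₀ hM₀ (hw.contDiff_η t ht) (hw.top_η_le t ht) R hR).1
  have r2 := (kb N μ hN hμ (u t) M₀ hM₀ (hw.contDiff_u t ht) (hw.top_u_le t ht)
    (hw.boundary t ht).1 (hw.boundary t ht).2 R' hR').1
  have q1 := (k1 L N μ hL hN hμ n e hB.e_onb _ hθ).1
  have q2 := k2 N μ hN hμ n k l e g f hB η u w hw t ht R' hR' U hU _ hθ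
  have s1 := normL2_sub_trans hL hηl.bm hRl.bm hYl.bm
  have s2 := normL2_sub_trans hL hul.bm hRl'.bm hUl.bm
  have f1 := normL2_massFlux_sub_le hL hηl hul hYl hUl hM0
    (fun x hx => (hw.η_le t ht x hx).trans hM) (fun x hx => (hw.u_le t ht x hx).trans hM)
  have f2 := normL2_momentumFlux_sub_le hL hηl hul hYl hUl hM0
    (fun x hx => (hw.u_le t ht x hx).trans hM)
  have hχl : Lip L (comb e fun i => ip L (fun x => R x - Y x) (e i)) :=
    lip_comb (hB.e_onb.lip hB.fe) _
  set χ := comb e fun i => ip L (fun x => R x - Y x) (e i) with hχ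
  have hc := (bm_clip (M := M) hYl).mul (bm_clip (M := M) hUl)
  have bF1 : BM L fun x => u t x + η t x * u t x - (U x + clip M (Y x) * clip M (U x)) :=
    (hul.bm.add (hηl.bm.mul hul.bm)).sub (hUl.bm.add hc)
  have bF2 : BM L fun x => w t x - lap L f U x := hwb.sub (lip_comb hfl _).bm
  have bG : BM L fun x => η t x + u t x ^ 2 / 2 - momentumFlux M Y U x := by
    have h1 : BM L fun x => η t x + u t x ^ 2 / 2 := by
      have h2 : Lip L fun x => η t x + 1 / 2 * (u t x * u t x) :=
        hηl.add ((hul.mul hul).const_mul _)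
      exact (h2.congr fun x _ => by ring).bm
    exact h1.sub (bm_momentumFlux hYl hUl)
  -- Only the nonlinear part is estimated by Cauchy-Schwarz; the dispersive part, too large in `L²`,
  -- goes through `exists_dispersive_bound`.
  have split : ip L (fun x => u t x + η t x * u t x + a * w t x - massFlux L a M f Y U x) (deriv χ)
      = ip L (fun x => u t x + η t x * u t x - (U x + clip M (Y x) * clip M (U x))) (deriv χ)
        + a * ip L (fun x => w t x - lap L f U x) (deriv χ) := by
    rw [← ip_smul_left hL, ← ip_add_left hL bF1 (bF2.const_mul a) hχl.bm_deriv]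
    congr 1
    funext x
    simp only [massFlux]
    ring
  have i1 := (le_abs_self _).trans (abs_ip_le hL bF1 hχl.bm_deriv)
  have i2 := (le_abs_self _).trans (abs_ip_le hL bG hξ.bm_deriv)
  rw [split, ← normL2_sq hL, bilin_self hL]
  set H := meshSize L N ^ (m + 2) with hH
  set Θ := normL2 L fun x => R x - Y x
  set Ξ := normL2 L fun x => R' x - U x
  set B := normL2 L (deriv fun x => R' x - U x)
  have nH : 0 ≤ H := by positivity
  have nΘ : 0 ≤ Θ := normL2_nonneg
  have nΞ : 0 ≤ Ξ := normL2_nonneg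
  have nB : 0 ≤ B := normL2_nonneg
  -- Every factor is bounded by a multiple of `s`, so each term is at most a constant times `s ^ 2`,
  -- which the energy together with `H ^ 2` controls.
  set s := Θ + Ξ + B + H with hs
  have ns : 0 ≤ s := by positivity
  have t1 : normL2 L (fun x => η t x - Y x) ≤ (Ca * M₀ + 1) * s := by
    have h1 : Ca * M₀ * H ≤ Ca * M₀ * s := by gcongr; linarith
    linarith
  have t2 : normL2 L (fun x => u t x - U x) ≤ (Cb * M₀ + 1) * s := by
    have h1 : Cb * M₀ * H ≤ Cb * M₀ * s := by gcongr; linarith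
    linarith
  have u1 : ip L (fun x => u t x + η t x * u t x - (U x + clip M (Y x) * clip M (U x))) (deriv χ)
      ≤ P * C₁ * s ^ 2 := by
    refine i1.trans ?_
    calc _ ≤ ((1 + M) * ((Cb * M₀ + 1) * s) + M * ((Ca * M₀ + 1) * s)) * (C₁ * s) := by
          refine mul_le_mul (f1.trans ?_) (q1.trans ?_) normL2_nonneg (by positivity)
          · gcongr
          · gcongr; linarith
      _ = _ := by ring
  have u2 : a * ip L (fun x => w t x - lap L f U x) (deriv χ)
      ≤ |a| * (C₂ * (1 + Cb * M₀)) * s ^ 2 := by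
    have h1 := le_abs_self (a * ip L (fun x => w t x - lap L f U x) (deriv χ))
    rw [abs_mul] at h1
    have h2 : H + normL2 L (fun x => u t x - R' x) + B ≤ (1 + Cb * M₀) * s := by
      have h3 : Cb * M₀ * H ≤ Cb * M₀ * s := by gcongr; linarith
      linarith
    have h4 : 0 ≤ H + normL2 L (fun x => u t x - R' x) + B :=
      add_nonneg (add_nonneg nH normL2_nonneg) nB
    calc _ ≤ |a| * (C₂ * (H + normL2 L (fun x => u t x - R' x) + B) * Θ) := by
          refine h1.trans ?_
          gcongr
      _ ≤ |a| * (C₂ * ((1 + Cb * M₀) * s) * s) := by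
          gcongr
          linarith
      _ = _ := by ring
  have u3 : ip L (fun x => η t x + u t x ^ 2 / 2 - momentumFlux M Y U x)
      (deriv fun x => R' x - U x) ≤ Q * s ^ 2 := by
    refine i2.trans ?_
    calc _ ≤ ((Ca * M₀ + 1) * s + M * ((Cb * M₀ + 1) * s)) * s := by
          refine mul_le_mul (f2.trans ?_) (by linarith) normL2_nonneg (by positivity)
          gcongr
      _ = _ := by ring
  have u4 := sq_sum_le hd Θ Ξ B H
  have u5 := mul_le_mul_of_nonneg_left u4 (by positivity : 0 ≤ 2 * D)
  exact (two_mul_add_le u1 u2 u3).trans (u5.trans (le_of_eq (by ring)))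

theorem hasDerivAt_ip_comb (hL : 0 < L) (he : ∀ i, Lip L (e i)) {p : ℝ → Fin n → ℝ}
    {p' : Fin n → ℝ} {t : ℝ} (h : ∀ i, HasDerivAt (fun t => p t i) (p' i) t) :
    HasDerivAt (fun t => ip L (comb e (p t)) (comb e (p t)))
      (2 * ∑ i, p' i * ip L (comb e (p t)) (e i)) t := by
  have e1 : ∀ t, ip L (comb e (p t)) (comb e (p t))
      = ∑ i, p t i * ∑ j, p t j * ip L (e i) (e j) := fun t => by
    rw [ip_comb_right hL he (lip_comb he _).bm]
    simp only [ip_comm (comb e (p t)), ip_comb_right hL he (he _).bm]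
  simp only [e1]
  have h1 : HasDerivAt (fun t => ∑ i, p t i * ∑ j, p t j * ip L (e i) (e j))
      (∑ i, (p' i * ∑ j, p t j * ip L (e i) (e j) + p t i * ∑ j, p' j * ip L (e i) (e j))) t :=
    HasDerivAt.fun_sum fun i _ => (h i).mul (HasDerivAt.fun_sum fun j _ => (h j).mul_const _)
  convert h1 using 1
  simp only [ip_comm (comb e (p t)), ip_comb_right hL he (he _).bm, Finset.sum_add_distrib]
  rw [two_mul]
  congr 1
  simp only [Finset.mul_sum]
  rw [Finset.sum_comm]
  refine Finset.sum_congr rfl fun i _ => Finset.sum_congr rfl fun j _ => ?_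
  rw [ip_comm]
  ring

theorem continuousOn_ip_comb (hL : 0 < L) (he : ∀ i, Lip L (e i)) {p : ℝ → Fin n → ℝ} {s : Set ℝ}
    (h : ∀ i, ContinuousOn (fun t => p t i) s) :
    ContinuousOn (fun t => ip L (comb e (p t)) (comb e (p t))) s := by
  have e1 : ∀ t, ip L (comb e (p t)) (comb e (p t))
      = ∑ i, p t i * ∑ j, p t j * ip L (e i) (e j) := fun t => by
    rw [ip_comb_right hL he (lip_comb he _).bm]
    simp only [ip_comm (comb e (p t)), ip_comb_right hL he (he _).bm]
  simp only [e1]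
  exact continuousOn_finsetSum _ fun i _ => (h i).mul
    (continuousOn_finsetSum _ fun j _ => (h j).mul continuousOn_const)

theorem IsONB.bilin_comb_self (he : IsONB L q S e) (hL : 0 < L) (hS : IsFE L N r S)
    (y : Fin n → ℝ) : bilin L q (comb e y) (comb e y) = ∑ i, y i ^ 2 := by
  rw [he.bilin_comb_right hL hS y (he.comb_mem hS y)]
  exact Finset.sum_congr rfl fun i _ => by rw [he.bilin_comb hL hS, sq]

theorem comb_sub (y z : Fin n → ℝ) :
    comb e (fun i => y i - z i) = fun x => comb e y x - comb e z x := by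
  funext x
  simp only [comb, sub_mul, Finset.sum_sub_distrib]

/-- The energy estimate. -/
theorem exists_energy_bound (hL : 0 < L) (hb : 0 < b) (hd : 0 < d) (hM₀ : 0 ≤ M₀) (hM : M₀ ≤ M)
    (a : ℝ) (T : ℝ) (m : ℕ) : ∃ K, 0 ≤ K ∧ ∀ (N μ : ℕ), 1 ≤ N → μ ≤ m → ∀ (n k l : ℕ)
    (e : Fin n → ℝ → ℝ) (g : Fin k → ℝ → ℝ) (f : Fin l → ℝ → ℝ),
    IsBases L b d N μ (m + 2) e g f → ∀ η u w : ℝ → ℝ → ℝ, IsWeakSolution L T a b d m M₀ η u w →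
    ∀ (η₀ u₀ : ℝ → ℝ), EqOn (η 0) η₀ (dom L) → EqOn (u 0) u₀ (dom L) →
    ∀ (y : ℝ → Fin n → ℝ) (ω : ℝ → Fin k → ℝ), IsTruncated L T a b d M e g f η₀ u₀ y ω →
    ∀ t ∈ Icc 0 T,
      normL2 L (fun x => comb e (fun i => bilin L b (η t) (e i)) x - comb e (y t) x) ^ 2
        + (normL2 L (fun x => comb g (fun i => bilin L d (u t) (g i)) x - comb g (ω t) x) ^ 2
          + d * normL2 L (deriv fun x =>
            comb g (fun i => bilin L d (u t) (g i)) x - comb g (ω t) x) ^ 2)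
        ≤ K * (meshSize L N ^ (m + 2)) ^ 2 := by
  obtain ⟨K, hK, hrate⟩ := exists_energy_rate hL hb hd hM₀ hM a T m
  refine ⟨Real.exp (K * T), (Real.exp_pos _).le,
    fun N μ hN hμ n k l e g f hB η u w hw η₀ u₀ hη₀ hu₀ y ω hy t ht => ?_⟩
  have hel := hB.e_onb.lip hB.fe
  have hgl := hB.g_onb.lip hB.fe_zero
  -- `p` and `s` are the coordinates of projection minus truncated solution. Since the bases are
  -- orthonormal for `A_b` and `A_d`, the equations give the derivatives of single coordinates,
  -- without a mass matrix.
  set p : ℝ → Fin n → ℝ := fun t i => bilin L b (η t) (e i) - y t i with hp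
  set s : ℝ → Fin k → ℝ := fun t i => bilin L d (u t) (g i) - ω t i with hs
  set ε := (meshSize L N ^ (m + 2)) ^ 2 with hε
  have cp : ∀ i, ContinuousOn (fun t => p t i) (Icc 0 T) := fun i =>
    (hw.continuous_η _ (hel i)).sub (hy.continuous_y i)
  have cs : ∀ i, ContinuousOn (fun t => s t i) (Icc 0 T) := fun i =>
    (hw.continuous_u _ (hgl i)).sub (hy.continuous_w i)
  have bW : ∀ t ∈ Icc 0 T, BM L (fun x => u t x + η t x * u t x + a * w t x) ∧
      BM L (fun x => η t x + u t x ^ 2 / 2) := by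
    intro t ht
    have h1 := (hw.contDiff_η t ht).continuousOn
    have h2 := (hw.contDiff_u t ht).continuousOn
    have h3 := (hw.contDiff_w t ht).continuousOn
    exact ⟨ContinuousOn.bm ((h2.add (h1.mul h2)).add (h3.const_mul a)),
      ContinuousOn.bm (h1.add ((h2.pow 2).div_const 2))⟩
  have hfl := hB.f_onb.lip hB.fe_zero
  have bMF : ∀ t, BM L (massFlux L a M f (comb e (y t)) (comb g (ω t))) := fun t =>
    bm_massFlux hfl (lip_comb hel _) (lip_comb hgl _)
  have bPF : ∀ t, BM L (momentumFlux M (comb e (y t)) (comb g (ω t))) := fun t =>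
    bm_momentumFlux (lip_comb hel _) (lip_comb hgl _)
  have dp : ∀ t ∈ Ioo 0 T, ∀ i, HasDerivAt (fun t => p t i)
      (ip L (fun x => u t x + η t x * u t x + a * w t x
        - massFlux L a M f (comb e (y t)) (comb g (ω t)) x) (deriv (e i))) t := by
    intro t ht i
    rw [ip_sub_left hL (bW t (Ioo_subset_Icc_self ht)).1 (bMF t) (hel i).bm_deriv]
    exact (hw.mass t ht _ (hel i)).sub (hy.deriv_y t ht i)
  have ds : ∀ t ∈ Ioo 0 T, ∀ i, HasDerivAt (fun t => s t i)
      (ip L (fun x => η t x + u t x ^ 2 / 2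
        - momentumFlux M (comb e (y t)) (comb g (ω t)) x) (deriv (g i))) t := by
    intro t ht i
    rw [ip_sub_left hL (bW t (Ioo_subset_Icc_self ht)).2 (bPF t) (hgl i).bm_deriv]
    have hm := (hB.g_onb.mem i).2
    exact (hw.momentum t ht _ (hgl i) hm.1 hm.2).sub (hy.deriv_w t ht i)
  -- The first term of the energy is the `L²` norm, although `e` is orthonormal for `A_b`. The
  -- numbers `ip L (comb e (p t)) (e i)` in its derivative are the coordinates of the Riesz
  -- representative, which is how that function becomes the test function.
  have hE := le_exp_of_deriv_le (T := T) (K := K) (ε := ε)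
    (E := fun t => ip L (comb e (p t)) (comb e (p t)) + ∑ i, s t i ^ 2)
    (E' := fun t => 2 * ∑ i, ip L (fun x => u t x + η t x * u t x + a * w t x
        - massFlux L a M f (comb e (y t)) (comb g (ω t)) x) (deriv (e i))
        * ip L (comb e (p t)) (e i)
      + ∑ i, (2 : ℕ) * s t i ^ (2 - 1) * ip L (fun x => η t x + u t x ^ 2 / 2
        - momentumFlux M (comb e (y t)) (comb g (ω t)) x) (deriv (g i)))
    ((continuousOn_ip_comb hL hel cp).add (continuousOn_finsetSum _ fun i _ => (cs i).pow 2))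
    (fun t ht => (hasDerivAt_ip_comb hL hel (dp t ht)).add
      (HasDerivAt.fun_sum fun i _ => (ds t ht i).pow 2))
    (by
      intro t ht
      have ht' := Ioo_subset_Icc_self ht
      have hηl : Lip L (η t) := ContDiffOn.lip (by simp) (hw.contDiff_η t ht')
      have hul : Lip L (u t) := ContDiffOn.lip (by simp) (hw.contDiff_u t ht')
      have key := hrate N μ hN hμ n k l e g f hB η u w hw t ht' _ _
        ⟨hB.e_onb.comb_mem hB.fe _, fun φ hφ => hB.e_onb.isProjection hL hB.fe hηl hφ⟩
        ⟨hB.g_onb.comb_mem hB.fe_zero _, fun φ hφ => hB.g_onb.isProjection hL hB.fe_zero hul hφ⟩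
        (comb e (y t)) (hB.e_onb.comb_mem hB.fe _) (comb g (ω t))
        (hB.g_onb.comb_mem hB.fe_zero _)
      rw [← comb_sub, ← comb_sub,
        ip_deriv_comb_right hL hel ((bW t ht').1.sub (bMF t)),
        ip_deriv_comb_right hL hgl ((bW t ht').2.sub (bPF t)),
        hB.g_onb.bilin_comb_self hL hB.fe_zero] at key
      refine le_trans (le_of_eq ?_) key
      congr 1
      · congr 1
        exact Finset.sum_congr rfl fun i _ => mul_comm _ _
      · rw [Finset.mul_sum]
        refine Finset.sum_congr rfl fun i _ => ?_
        norm_num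
        ring)
  -- The initial values are the elliptic projections themselves, so the energy starts from zero.
  have h0 : ∀ i, p 0 i = 0 := fun i => by
    simp only [hp, hy.init_y, bilin_congr hL b hη₀ (eqOn_refl (e i) _), sub_self]
  have h0' : ∀ i, s 0 i = 0 := fun i => by
    simp only [hs, hy.init_w, bilin_congr hL d hu₀ (eqOn_refl (g i) _), sub_self]
  have h1 := hE t ht
  have hE0 : ip L (comb e (p 0)) (comb e (p 0)) + ∑ i, s 0 i ^ 2 = 0 := by
    have h2 : comb e (p 0) = fun _ => 0 := by
      funext x
      simp [comb, h0]
    rw [h2]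
    simp [h0', ip]
  simp only [hE0, zero_add] at h1
  rw [← bilin_self hL, normL2_sq hL, ← comb_sub, ← comb_sub,
    hB.g_onb.bilin_comb_self hL hB.fe_zero]
  have h2 : Real.exp (K * t) ≤ Real.exp (K * T) :=
    Real.exp_le_exp.2 (mul_le_mul_of_nonneg_left ht.2 hK)
  have h3 : 0 ≤ ε := sq_nonneg _
  have h4 := mul_le_mul_of_nonneg_right h2 h3
  change ip L (comb e (p t)) (comb e (p t)) + ∑ i, s t i ^ 2 ≤ _
  linarith

end

noncomputable section

open MeasureTheory
open scoped NNReal ENNReal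

variable {L T : ℝ} {a b d M M₀ : ℝ} {N μ r n k l m : ℕ} {η₀ u₀ : ℝ → ℝ} {η u w : ℝ → ℝ → ℝ}

/-! ### The error estimates -/

theorem normH1_nonneg {v : ℝ → ℝ} : 0 ≤ normH1 L v := Real.sqrt_nonneg _

/-- The errors have the optimal order, with constant `C`. -/
def HasRate (L T : ℝ) (m N : ℕ) (C : ℝ) (η u Y U : ℝ → ℝ → ℝ) : Prop :=
  ∀ t ∈ Icc 0 T,
    (normL2 L (fun x => Y t x - η t x) ≤ C * meshSize L N ^ (m + 2) ∧
      normL2 L (deriv fun x => Y t x - η t x) ≤ C * meshSize L N ^ (m + 1)) ∧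
    (normL2 L (fun x => U t x - u t x) ≤ C * meshSize L N ^ (m + 2) ∧
      normL2 L (deriv fun x => U t x - u t x) ≤ C * meshSize L N ^ (m + 1))

theorem HasRate.mono (hL : 0 < L) (hN : 1 ≤ N) {C C' : ℝ} {Y U : ℝ → ℝ → ℝ}
    (h : HasRate L T m N C η u Y U) (hC : C ≤ C') : HasRate L T m N C' η u Y U := by
  have hh := meshSize_pos hL hN
  have h1 : C * meshSize L N ^ (m + 2) ≤ C' * meshSize L N ^ (m + 2) := by gcongr
  have h2 : C * meshSize L N ^ (m + 1) ≤ C' * meshSize L N ^ (m + 1) := by gcongr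
  exact fun t ht => ⟨⟨(h t ht).1.1.trans h1, (h t ht).1.2.trans h2⟩,
    (h t ht).2.1.trans h1, (h t ht).2.2.trans h2⟩

theorem HasRate.congr (hL : 0 < L) {C : ℝ} {Y U Y' U' : ℝ → ℝ → ℝ}
    (h : HasRate L T m N C η u Y U)
    (he : ∀ t ∈ Icc 0 T, EqOn (Y t) (Y' t) (dom L) ∧ EqOn (U t) (U' t) (dom L)) :
    HasRate L T m N C η u Y' U' := by
  intro t ht
  have h1 : EqOn (fun x => Y t x - η t x) (fun x => Y' t x - η t x) (dom L) := fun x hx => by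
    simp only [(he t ht).1 hx]
  have h2 : EqOn (fun x => U t x - u t x) (fun x => U' t x - u t x) (dom L) := fun x hx => by
    simp only [(he t ht).2 hx]
  rw [← normL2_congr hL (ae_eq_of_dom h1), ← normL2_congr hL (ae_eq_of_dom h2),
    ← normL2_deriv_congr hL h1, ← normL2_deriv_congr hL h2]
  exact h t ht

/-- In the `H¹` norm the `L²` part is weakened from `h ^ (m + 2)` to `h ^ (m + 1)` by means of `h ≤
2 * L`. -/
theorem HasRate.norms_le (hL : 0 < L) (hN : 1 ≤ N) {C : ℝ} (hC : 0 ≤ C) {Y U : ℝ → ℝ → ℝ}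
    (h : HasRate L T m N C η u Y U) {t : ℝ} (ht : t ∈ Icc 0 T) :
    normL2 L (fun x => Y t x - η t x) + normL2 L (fun x => U t x - u t x)
        ≤ 2 * (2 * L + 1) * C * meshSize L N ^ (m + 2) ∧
      normH1 L (fun x => Y t x - η t x) + normH1 L (fun x => U t x - u t x)
        ≤ 2 * (2 * L + 1) * C * meshSize L N ^ (m + 1) := by
  obtain ⟨⟨h1, h2⟩, h3, h4⟩ := h t ht
  have hh := meshSize_pos hL hN
  have hh2 := meshSize_le hL hN
  have e1 := normH1_le hL fun x => Y t x - η t x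
  have e2 := normH1_le hL fun x => U t x - u t x
  have e3 : 0 ≤ L * (C * meshSize L N ^ (m + 2)) := by positivity
  have e4 : C * meshSize L N ^ (m + 2) ≤ 2 * L * (C * meshSize L N ^ (m + 1)) := by
    calc _ = meshSize L N * (C * meshSize L N ^ (m + 1)) := by ring
      _ ≤ _ := by gcongr
  constructor <;> linarith

/-- Projection error plus discrete error. The energy contains the derivative of the `u` part, which
is thus `O(h ^ (m + 2))`; for the `η` part it contains only the `L²` norm, and the inverse
inequality costs one power of `h`. -/
theorem exists_error_bound (hL : 0 < L) (hb : 0 < b) (hd : 0 < d) (hM₀ : 0 ≤ M₀) (hM : M₀ ≤ M)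
    (a : ℝ) (T : ℝ) (m : ℕ) : ∃ C, 0 ≤ C ∧ ∀ (N μ : ℕ), 1 ≤ N → μ ≤ m → ∀ (n k l : ℕ)
    (e : Fin n → ℝ → ℝ) (g : Fin k → ℝ → ℝ) (f : Fin l → ℝ → ℝ),
    IsBases L b d N μ (m + 2) e g f → ∀ η u w : ℝ → ℝ → ℝ, IsWeakSolution L T a b d m M₀ η u w →
    ∀ (η₀ u₀ : ℝ → ℝ), EqOn (η 0) η₀ (dom L) → EqOn (u 0) u₀ (dom L) →
    ∀ (y : ℝ → Fin n → ℝ) (ω : ℝ → Fin k → ℝ), IsTruncated L T a b d M e g f η₀ u₀ y ω →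
      HasRate L T m N C η u (fun t => comb e (y t)) (fun t => comb g (ω t)) := by
  obtain ⟨K, hK, henergy⟩ := exists_energy_bound hL hb hd hM₀ hM a T m
  obtain ⟨Ca, pa, ka⟩ := exists_projection_femSpace hL hb m
  obtain ⟨Cb, pb, kb⟩ := exists_projection_femSpaceZero hL hd m
  obtain ⟨Ci, pi, ki⟩ := exists_inverse_inequality (m + 2)
  set Q := √K with hQ
  have hQ0 : 0 ≤ Q := Real.sqrt_nonneg _
  refine ⟨Ca * M₀ + Cb * M₀ + Q + Ci * Q + √(K / d) * (2 * L), by positivity,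
    fun N μ hN hμ n k l e g f hB η u w hw η₀ u₀ hη₀ hu₀ y ω hy t ht => ?_⟩
  have hh := meshSize_pos hL hN
  have hh2 := meshSize_le hL hN
  have hηl : Lip L (η t) := ContDiffOn.lip (by simp) (hw.contDiff_η t ht)
  have hul : Lip L (u t) := ContDiffOn.lip (by simp) (hw.contDiff_u t ht)
  have gR : IsGalerkin L b (femSpace L N μ (m + 2)) (η t)
      (comb e fun i => bilin L b (η t) (e i)) :=
    ⟨hB.e_onb.comb_mem hB.fe _, fun φ hφ => hB.e_onb.isProjection hL hB.fe hηl hφ⟩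
  have gR' : IsGalerkin L d (femSpaceZero L N μ (m + 2)) (u t)
      (comb g fun i => bilin L d (u t) (g i)) :=
    ⟨hB.g_onb.comb_mem hB.fe_zero _, fun φ hφ => hB.g_onb.isProjection hL hB.fe_zero hul hφ⟩
  have hE := henergy N μ hN hμ n k l e g f hB η u w hw η₀ u₀ hη₀ hu₀ y ω hy t ht
  obtain ⟨r1, r1'⟩ := ka N μ hN hμ (η t) M₀ hM₀ (hw.contDiff_η t ht) (hw.top_η_le t ht) _ gR
  obtain ⟨r2, r2'⟩ := kb N μ hN hμ (u t) M₀ hM₀ (hw.contDiff_u t ht) (hw.top_u_le t ht)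
    (hw.boundary t ht).1 (hw.boundary t ht).2 _ gR'
  have mY : comb e (y t) ∈ femSpace L N μ (m + 2) := hB.e_onb.comb_mem hB.fe _
  have mU : comb g (ω t) ∈ femSpaceZero L N μ (m + 2) := hB.g_onb.comb_mem hB.fe_zero _
  have hYl := hB.fe.lip _ mY
  have hUl := hB.fe_zero.lip _ mU
  have inv := ki L N μ hL hN _ (hB.fe.sub gR.mem mY)
  have hRl := hB.fe.lip _ gR.mem
  have hRl' := hB.fe_zero.lip _ gR'.mem
  set R := comb e fun i => bilin L b (η t) (e i)
  set R' := comb g fun i => bilin L d (u t) (g i)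
  set Y := comb e (y t)
  set U := comb g (ω t)
  have s1 := normL2_sub_trans hL hηl.bm hRl.bm hYl.bm
  have s2 := normL2_sub_trans hL hul.bm hRl'.bm hUl.bm
  have s3 := normL2_deriv_sub_trans hL hηl hRl hYl
  have s4 := normL2_deriv_sub_trans hL hul hRl' hUl
  have c1 : normL2 L (fun x => Y x - η t x) = normL2 L fun x => η t x - Y x :=
    normL2_sub_comm hL _ _
  have c2 : normL2 L (fun x => U x - u t x) = normL2 L fun x => u t x - U x :=
    normL2_sub_comm hL _ _
  have cd : ∀ v v' : ℝ → ℝ, normL2 L (deriv fun x => v x - v' x)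
      = normL2 L (deriv fun x => v' x - v x) := fun v v' => by
    rw [← normL2_neg hL (deriv fun x => v' x - v x), ← deriv.fun_neg']
    simp only [neg_sub]
  set H := meshSize L N ^ (m + 1) with hH
  have nH : 0 ≤ H := by positivity
  have eH : meshSize L N ^ (m + 2) = meshSize L N * H := by rw [hH]; ring
  have nG : 0 ≤ meshSize L N * H := by positivity
  rw [eH] at hE r1 r2
  set G := meshSize L N * H with hG
  have n1 := sq_nonneg (normL2 L fun x => R x - Y x)
  have n2 := sq_nonneg (normL2 L fun x => R' x - U x)
  have n3 := mul_nonneg hd.le (sq_nonneg (normL2 L (deriv fun x => R' x - U x)))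
  have q1 : normL2 L (fun x => R x - Y x) ≤ Q * G := by
    refine le_of_sq_le_sq ?_ (by positivity)
    rw [mul_pow, Real.sq_sqrt hK]
    linarith
  have q2 : normL2 L (fun x => R' x - U x) ≤ Q * G := by
    refine le_of_sq_le_sq ?_ (by positivity)
    rw [mul_pow, Real.sq_sqrt hK]
    linarith
  have q3 : normL2 L (deriv fun x => R' x - U x) ≤ √(K / d) * (2 * L) * H := by
    have h1 : normL2 L (deriv fun x => R' x - U x) ≤ √(K / d) * G := by
      refine le_of_sq_le_sq ?_ (by positivity)
      rw [mul_pow, Real.sq_sqrt (by positivity), div_mul_eq_mul_div, le_div_iff₀ hd]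
      linarith
    refine h1.trans ?_
    rw [hG, mul_assoc]
    gcongr
  have q4 : normL2 L (deriv fun x => R x - Y x) ≤ Ci * Q * H := by
    have h1 : meshSize L N * normL2 L (deriv fun x => R x - Y x)
        ≤ meshSize L N * (Ci * Q * H) := by
      refine inv.trans ((mul_le_mul_of_nonneg_left q1 pi).trans (le_of_eq ?_))
      rw [hG]
      ring
    exact le_of_mul_le_mul_left h1 hh
  have z1 : 0 ≤ Ca * M₀ := by positivity
  have z2 : 0 ≤ Cb * M₀ := by positivity
  have z3 : 0 ≤ Ci * Q := by positivity
  have z4 : 0 ≤ √(K / d) * (2 * L) := by positivity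
  change (normL2 L (fun x => Y x - η t x) ≤ _ ∧ normL2 L (deriv fun x => Y x - η t x) ≤ _) ∧
    (normL2 L (fun x => U x - u t x) ≤ _ ∧ normL2 L (deriv fun x => U x - u t x) ≤ _)
  rw [c1, c2, cd Y, cd U, eH]
  have y1 := mul_nonneg z1 nG
  have y2 := mul_nonneg z2 nG
  have y3 := mul_nonneg z3 nG
  have y4 := mul_nonneg z4 nG
  have x1 := mul_nonneg z1 nH
  have x2 := mul_nonneg z2 nH
  have x3 := mul_nonneg z3 nH
  have x4 := mul_nonneg z4 nH
  have x5 := mul_nonneg hQ0 nH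
  refine ⟨⟨?_, ?_⟩, ?_, ?_⟩ <;> linarith

/-- Semidiscrete solutions exist on fine grids, with optimal error estimates. -/
theorem IsWeakSolution.exists_semidiscrete (hL : 0 < L) (hT : 0 < T) (hb : 0 < b) (hd : 0 < d)
    (hw : IsWeakSolution L T a b d m M₀ η u w) (hη₀ : EqOn (η 0) η₀ (dom L))
    (hu₀ : EqOn (u 0) u₀ (dom L)) (hμ : μ ≤ m) :
    ∃ (N₀ : ℕ) (C : ℝ), 0 ≤ C ∧ ∀ N, N₀ ≤ N → 1 ≤ N → ∃ Y U,
      IsSemidiscreteSolution L T a b d N μ (m + 2) η₀ u₀ Y U ∧ HasRate L T m N C η u Y U := by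
  have hM₀ := hw.M_nonneg
  obtain ⟨C, hC, herr⟩ := exists_error_bound hL hb hd hM₀ (by linarith : M₀ ≤ M₀ + 1) a T m
  -- The Sobolev inequality bounds `2 * L` times the sup error by `K * h`, using `h ^ m ≤ (2 * L) ^
  -- m` and `h + 2 * L ≤ 4 * L`. As `N * h = 2 * L`, the condition `N ≥ K` makes the sup error at
  -- most 1, the margin left by truncating at `M₀ + 1`.
  set K := √(2 * L) * (4 * L) * C * (2 * L) ^ m with hK
  have hK0 : 0 ≤ K := by positivity
  refine ⟨⌈K⌉₊, C, hC, fun N hN₀ hN => ?_⟩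
  obtain ⟨n, k, l, e, g, f, hB⟩ := exists_isBases hL hN (by omega : 2 ≤ m + 2) hb.le hd.le μ
  obtain ⟨y, ω, hy, d1, d2⟩ := exists_isTruncated hL hT.le (by linarith : 0 ≤ M₀ + 1) a b d
    (hB.e_onb.lip hB.fe) (hB.g_onb.lip hB.fe_zero) (hB.f_onb.lip hB.fe_zero) η₀ u₀
  have hrate := herr N μ hN hμ n k l e g f hB η u w hw η₀ u₀ hη₀ hu₀ y ω hy
  have hh := meshSize_pos hL hN
  have hh2 := meshSize_le hL hN
  have hKh : K * meshSize L N ≤ 2 * L := by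
    have h1 : K ≤ N := Nat.ceil_le.1 hN₀
    calc K * meshSize L N ≤ N * meshSize L N := by gcongr
      _ = 2 * L := mul_meshSize hN
  have key : ∀ v : ℝ → ℝ, Lip L v → normL2 L v ≤ C * meshSize L N ^ (m + 2) →
      normL2 L (deriv v) ≤ C * meshSize L N ^ (m + 1) → ∀ x ∈ dom L, |v x| ≤ 1 := by
    intro v hv h0 h1 x hx
    have h2 := hv.abs_le_sobolev hL hx
    have h3 : √(2 * L) * normL2 L v + 2 * L * (√(2 * L) * normL2 L (deriv v)) ≤ 2 * L := by
      calc _ ≤ √(2 * L) * (C * meshSize L N ^ (m + 2))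
            + 2 * L * (√(2 * L) * (C * meshSize L N ^ (m + 1))) := by gcongr
        _ = √(2 * L) * C * (meshSize L N ^ m * meshSize L N) * (meshSize L N + 2 * L) := by ring
        _ ≤ √(2 * L) * C * ((2 * L) ^ m * meshSize L N) * (2 * L + 2 * L) := by gcongr
        _ = K * meshSize L N := by rw [hK]; ring
        _ ≤ _ := hKh
    have h4 : 2 * L * |v x| ≤ 2 * L * 1 := by linarith
    exact le_of_mul_le_mul_left h4 (by positivity)
  have hηl : ∀ t ∈ Icc 0 T, Lip L (η t) := fun t ht =>
    ContDiffOn.lip (by simp) (hw.contDiff_η t ht)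
  have hul : ∀ t ∈ Icc 0 T, Lip L (u t) := fun t ht =>
    ContDiffOn.lip (by simp) (hw.contDiff_u t ht)
  have h0 : (0 : ℝ) ∈ Icc 0 T := ⟨le_rfl, hT.le⟩
  refine ⟨_, _, hy.isSemidiscreteSolution hL hT hB ((hηl 0 h0).congr hη₀) ((hul 0 h0).congr hu₀)
    d1 d2 (fun t ht x hx => ?_) (fun t ht x hx => ?_), hrate⟩
  · have h1 := key (fun x => comb e (y t) x - η t x)
      ((lip_comb (hB.e_onb.lip hB.fe) _).sub (hηl t ht)) (hrate t ht).1.1 (hrate t ht).1.2 x hx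
    have h2 := hw.η_le t ht x hx
    have h3 := abs_sub_abs_le_abs_sub (comb e (y t) x) (η t x)
    linarith
  · have h1 := key (fun x => comb g (ω t) x - u t x)
      ((lip_comb (hB.g_onb.lip hB.fe_zero) _).sub (hul t ht)) (hrate t ht).2.1 (hrate t ht).2.2 x hx
    have h2 := hw.u_le t ht x hx
    have h3 := abs_sub_abs_le_abs_sub (comb g (ω t) x) (u t x)
    linarith

/-- A single semidiscrete solution satisfies the error estimates with some constant. -/
theorem IsSemidiscreteSolution.exists_rate (hL : 0 < L) (hb : 0 < b) (hd : 0 < d)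
    (hw : IsWeakSolution L T a b d m M₀ η u w) (hη₀ : EqOn (η 0) η₀ (dom L))
    (hu₀ : EqOn (u 0) u₀ (dom L)) (hμ : μ ≤ m) (hN : 1 ≤ N) {Y U : ℝ → ℝ → ℝ}
    (h : IsSemidiscreteSolution L T a b d N μ (m + 2) η₀ u₀ Y U) :
    ∃ C, 0 ≤ C ∧ HasRate L T m N C η u Y U := by
  obtain ⟨n, k, l, e, g, f, hB⟩ := exists_isBases hL hN (by omega : 2 ≤ m + 2) hb.le hd.le μ
  obtain ⟨M₁, p1, b1⟩ := hB.e_onb.exists_bound hB.fe h.mem_η h.continuous_η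
  obtain ⟨M₂, p2, b2⟩ := hB.g_onb.exists_bound hB.fe_zero h.mem_u h.continuous_u
  have hM₀ := hw.M_nonneg
  -- The level depends on bounds of this particular solution, so the constant is not uniform in `N`.
  obtain ⟨C, hC, herr⟩ := exists_error_bound hL hb hd hM₀
    (by linarith : M₀ ≤ M₀ + M₁ + M₂) a T m
  have t1 := h.isTruncated (M := M₀ + M₁ + M₂) hL hB
    (fun t ht x hx => (b1 t ht x hx).trans (by linarith))
    (fun t ht x hx => (b2 t ht x hx).trans (by linarith))
  refine ⟨C, hC, HasRate.congr hL
    (herr N μ hN hμ n k l e g f hB η u w hw η₀ u₀ hη₀ hu₀ _ _ t1) fun t ht => ⟨?_, ?_⟩⟩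
  · exact (hB.e_onb.eqOn_comb (h.mem_η t ht)).symm
  · exact (hB.g_onb.eqOn_comb (h.mem_u t ht)).symm

/-- The error estimates with a constant that does not depend on the grid. -/
theorem IsWeakSolution.exists_rate (hL : 0 < L) (hT : 0 < T) (hb : 0 < b) (hd : 0 < d)
    (hw : IsWeakSolution L T a b d m M₀ η u w) (hη₀ : EqOn (η 0) η₀ (dom L))
    (hu₀ : EqOn (u 0) u₀ (dom L)) (hμ : μ ≤ m) :
    ∃ C, 0 ≤ C ∧ ∀ N, 1 ≤ N → ∀ Y U,
      IsSemidiscreteSolution L T a b d N μ (m + 2) η₀ u₀ Y U → HasRate L T m N C η u Y U := by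
  obtain ⟨N₀, C, hC, hlarge⟩ := hw.exists_semidiscrete hL hT hb hd hη₀ hu₀ hμ
  -- By uniqueness the constant of one solution serves for all solutions on its grid; where none
  -- exists any constant will do. Only the finitely many `N < N₀` are used, and the sum of their
  -- constants replaces a maximum.
  have hsmall : ∀ N, ∃ c, 0 ≤ c ∧ (1 ≤ N → ∀ Y U,
      IsSemidiscreteSolution L T a b d N μ (m + 2) η₀ u₀ Y U → HasRate L T m N c η u Y U) := by
    intro N
    by_cases hex : 1 ≤ N ∧ ∃ Y U, IsSemidiscreteSolution L T a b d N μ (m + 2) η₀ u₀ Y U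
    · obtain ⟨hN, Y, U, h⟩ := hex
      obtain ⟨c, hc, hr⟩ := h.exists_rate hL hb hd hw hη₀ hu₀ hμ hN
      exact ⟨c, hc, fun _ Y' U' h' =>
        hr.congr hL (h.unique hL hN (by omega) hb.le hd.le h')⟩
    · exact ⟨0, le_rfl, fun hN Y U h => (hex ⟨hN, Y, U, h⟩).elim⟩
  choose c hc hrate using hsmall
  have hsum : 0 ≤ ∑ i ∈ Finset.range N₀, c i := Finset.sum_nonneg fun i _ => hc i
  refine ⟨C + ∑ i ∈ Finset.range N₀, c i, by positivity, fun N hN Y U h => ?_⟩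
  rcases lt_or_ge N N₀ with hlt | hge
  · refine (hrate N hN Y U h).mono hL hN ?_
    have := Finset.single_le_sum (fun i _ => hc i) (Finset.mem_range.2 hlt)
    linarith
  · obtain ⟨Y', U', h', hr⟩ := hlarge N hge hN
    exact (hr.congr hL (h'.unique hL hN (by omega) hb.le hd.le h)).mono hL hN (by linarith)

end

end RegNwogu

/-! ### The main theorem -/

theorem proposition4p8 (L T a b d : ℝ) (hL : 0 < L) (hT : 0 < T) (ha : a < 0) (hb : 0 < b)
    (hd : 0 < d) (r μ : ℕ) (hr : 2 ≤ r) (hμ : μ ≤ r - 2)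
    (η₀ u₀ : ℝ → ℝ) (η u : ℝ → ℝ → ℝ)
    (hsol : RegNwogu.IsClassicalSolution L T a b d r η₀ u₀ η u) :
    -- on every grid there is at most one semidiscrete solution on `[0, T]`
    (∀ N : ℕ, 1 ≤ N → ∀ η₁ u₁ η₂ u₂ : ℝ → ℝ → ℝ,
      RegNwogu.IsSemidiscreteSolution L T a b d N μ r η₀ u₀ η₁ u₁ →
      RegNwogu.IsSemidiscreteSolution L T a b d N μ r η₀ u₀ η₂ u₂ →
      ∀ t ∈ Set.Icc 0 T, ∀ x ∈ Set.Icc (-L) L, η₁ t x = η₂ t x ∧ u₁ t x = u₂ t x) ∧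
    -- for all sufficiently small `h` it exists on the whole of `[0, T]`
    (∃ N₀ : ℕ, ∀ N : ℕ, N₀ ≤ N → 1 ≤ N → ∃ η' u' : ℝ → ℝ → ℝ,
      RegNwogu.IsSemidiscreteSolution L T a b d N μ r η₀ u₀ η' u') ∧
    -- the error estimates, with one constant for all grids and all times
    (∃ C : ℝ, 0 < C ∧ ∀ N : ℕ, 1 ≤ N → ∀ η' u' : ℝ → ℝ → ℝ,
      RegNwogu.IsSemidiscreteSolution L T a b d N μ r η₀ u₀ η' u' →
      ∀ t ∈ Set.Icc 0 T,
        RegNwogu.normL2 L (fun x => η' t x - η t x) + RegNwogu.normL2 L (fun x => u' t x - u t x)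
            ≤ C * RegNwogu.meshSize L N ^ r ∧
        RegNwogu.normH1 L (fun x => η' t x - η t x) + RegNwogu.normH1 L (fun x => u' t x - u t x)
            ≤ C * RegNwogu.meshSize L N ^ (r - 1)) ∧
    -- convergence as `h → 0`, uniformly in time
    (∀ η' u' : ℕ → ℝ → ℝ → ℝ,
      (∀ᶠ N in Filter.atTop,
        RegNwogu.IsSemidiscreteSolution L T a b d N μ r η₀ u₀ (η' N) (u' N)) →
      TendstoUniformlyOn
        (fun N t => RegNwogu.normH1 L (fun x => η' N t x - η t x)
          + RegNwogu.normH1 L (fun x => u' N t x - u t x))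
        (fun _ => 0) Filter.atTop (Set.Icc 0 T)) := by
  obtain ⟨m, rfl⟩ := Nat.exists_eq_add_of_le' hr
  have hμ' : μ ≤ m := by omega
  obtain ⟨M₀, hw⟩ := hsol.exists_isWeakSolution hL
  have hη₀ : EqOn (η 0) η₀ (RegNwogu.dom L) := hsol.init_η
  have hu₀ : EqOn (u 0) u₀ (RegNwogu.dom L) := hsol.init_u
  obtain ⟨C, hC, hrate⟩ := hw.exists_rate hL hT hb hd hη₀ hu₀ hμ'
  -- The factor comes from `HasRate.norms_le`; the summand 1 makes the constant positive.
  set C' := 2 * (2 * L + 1) * C + 1 with hC'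
  have hC0 : 0 < C' := by positivity
  have est : ∀ N : ℕ, 1 ≤ N → ∀ η' u' : ℝ → ℝ → ℝ,
      RegNwogu.IsSemidiscreteSolution L T a b d N μ (m + 2) η₀ u₀ η' u' → ∀ t ∈ Set.Icc 0 T,
        RegNwogu.normL2 L (fun x => η' t x - η t x) + RegNwogu.normL2 L (fun x => u' t x - u t x)
            ≤ C' * RegNwogu.meshSize L N ^ (m + 2) ∧
        RegNwogu.normH1 L (fun x => η' t x - η t x) + RegNwogu.normH1 L (fun x => u' t x - u t x)
            ≤ C' * RegNwogu.meshSize L N ^ (m + 1) := by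
    intro N hN η' u' h t ht
    have hh := RegNwogu.meshSize_pos hL hN
    have hle : 2 * (2 * L + 1) * C ≤ C' := by linarith
    obtain ⟨h1, h2⟩ := (hrate N hN η' u' h).norms_le hL hN hC ht
    exact ⟨h1.trans (by gcongr), h2.trans (by gcongr)⟩
  refine ⟨fun N hN η₁ u₁ η₂ u₂ h₁ h₂ t ht x hx => ?_, ?_, ⟨C', hC0, est⟩, fun η' u' h => ?_⟩
  · have h3 := h₁.unique hL hN hr hb.le hd.le h₂ t ht
    exact ⟨h3.1 hx, h3.2 hx⟩
  · obtain ⟨N₀, _, -, hex⟩ := hw.exists_semidiscrete hL hT hb hd hη₀ hu₀ hμ'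
    refine ⟨N₀, fun N hN hN1 => ?_⟩
    obtain ⟨Y, U, hYU, -⟩ := hex N hN hN1
    exact ⟨Y, U, hYU⟩
  · rw [Metric.tendstoUniformlyOn_iff]
    intro ε hε
    have hlim : Tendsto (fun N : ℕ => C' * RegNwogu.meshSize L N ^ (m + 1)) atTop (𝓝 0) := by
      have h1 : Tendsto (fun N : ℕ => RegNwogu.meshSize L N) atTop (𝓝 0) :=
        tendsto_const_div_atTop_nhds_zero_nat (2 * L)
      simpa using (h1.pow (m + 1)).const_mul C'
    filter_upwards [h, eventually_ge_atTop 1, hlim.eventually_lt_const hε] with N hN hN1 hlt t ht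
    rw [dist_comm, Real.dist_eq, sub_zero,
      abs_of_nonneg (add_nonneg RegNwogu.normH1_nonneg RegNwogu.normH1_nonneg)]
    exact ((est N hN1 _ _ hN t ht).2).trans_lt hlt
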